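/- Let $\mathscr T$ be a hierarchical T-mesh of $2\times 2$ division: one starts with a tensor product mesh of a rectangle (its cells have level $0$) and finitely many times subdivides a current cell of some level $k$ into its four equal subcells, which have level $k+1$. Let $\Omega$ be the rectangle occupied by the cells. A vertex is a corner of a cell; an edge joins two consecutive vertices along a grid line; the valence of a vertex is the number of edges ending at it. A vertex not on $\partial\Omega$ is a crossing-vertex if its valence is $4$ and a T-junction if its valence is $3$. An interior-cell is a cell none of whose edges lies on $\partial\Omega$. A P-cell is an interior-cell whose four corners are crossing-vertices; a T-cell is an interior-cell with at least one corner that is a T-junction. Two T-cells are T-connected if some T-junction is a corner of both; a T-connection $\mathcal{TC}$ is an equivalence class of T-cells for the equivalence relation generated by this. Its T-connection-domain is the union of its (closed) cells, and its T-rectangle-domain $\mathcal{TRD}$ is the smallest rectangle containing it. The one-neighbour-cells of $\mathcal{TC}$ are the cells of lowest level among those cells that do not belong to $\mathcal{TC}$ and share an edge with a cell of $\mathcal{TC}$. The CVR graph $\mathscr G$ of $\mathscr T$ consists of the crossing-vertices and of all line segments along grid lines of $\mathscr T$ whose two end points are crossing-vertices. Its g-cells are the bounded connected components of the complement in $\mathbb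 R^2$ of the union of these segments. A g-cell is the P-g-cell of a P-cell (the T-g-cell of a T-connection) if its closure is that P-cell (that T-connection-domain). Let $\overline{\mathbf S}^2(\mathscr T)$ be the space of all $f\in C^{1,1}(\mathbb R^2)$ (that is, $f$, $\partial_x f$, $\partial_y f$ exist and are continuous on $\mathbb R^2$) that agree on each cell with a polynomial of bi-degree $(2,2)$ and vanish outside $\Omega$, and let $\overline{\mathbf S}^0(\mathscr G)$ be the space of functions that are constant on each g-cell and zero outside the g-cells. For a polynomial $p$ of bi-degree $(2,2)$ and a rectangle $D=[x_0,x_1]\times[y_0,y_1]$ write $$p(x,y)=\sum_{j,k=0}^2 b_{j,k}\,B^2_j\!\left(\tfrac{x-x_0}{x_1-x_0}\right)B^2_k\!\left(\tfrac{y-y_0}{y_1-y_0}\right)$$ with the quadratic Bernstein polynomials $B^2_j$, and put $\varphi(p:D)=b_{1,1}$. For a cell $C$ let $f|_C$ denote the polynomial that agrees with $f$ on $C$. Theorem. (1) Every T-connection $\mathcal{TC}$ has at least one one-neighbour-cell, and for every $f\in\overline{\mathbf S}^2(\mathscr T)$ the value $\varphi(f|_C:\mathcal{TRD})$ is the same for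 all one-neighbour-cells $C$ of $\mathcal{TC}$. (2) Every P-cell has exactly one P-g-cell, and every g-cell is either the P-g-cell of exactly one P-cell or the T-g-cell of exactly one T-connection, but not both. (3) Hence there is exactly one map $\Phi:\overline{\mathbf S}^2(\mathscr T)\to\overline{\mathbf S}^0(\mathscr G)$ such that $\Phi(f)$ has the value $\varphi(f|_{\mathcal{PC}}:\mathcal{PC})$ on the P-g-cell of each P-cell $\mathcal{PC}$, and the value $\varphi(f|_C:\mathcal{TRD})$, with $C$ any one-neighbour-cell of $\mathcal{TC}$, on the T-g-cell of each T-connection $\mathcal{TC}$ that has one. This map $\Phi$ is linear and injective; that is, a spline $f\in\overline{\mathbf S}^2(\mathscr T)$ for which all these values are zero is identically zero. -/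

import Mathlib

noncomputable section

namespace TMesh

/-- The rectangle `[x₀, x₁] × [y₀, y₁]`. -/
@[ext]
structure Rect where
  x₀ : ℝ
  x₁ : ℝ
  y₀ : ℝ
  y₁ : ℝ

namespace Rect

/-- The closed rectangle as a set of points. -/
def carrier (r : Rect) : Set (ℝ × ℝ) := Set.Icc r.x₀ r.x₁ ×ˢ Set.Icc r.y₀ r.y₁

/-- The open rectangle as a set of points. -/
def inner (r : Rect) : Set (ℝ × ℝ) := Set.Ioo r.x₀ r.x₁ ×ˢ Set.Ioo r.y₀ r.y₁

/-- The four sides of the rectangle. -/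
def sides (r : Rect) : Set (ℝ × ℝ) := r.carrier \ r.inner

/-- The four corner points. -/
def corners (r : Rect) : Set (ℝ × ℝ) :=
  {(r.x₀, r.y₀), (r.x₁, r.y₀), (r.x₀, r.y₁), (r.x₁, r.y₁)}

end Rect

/-- A cell of a hierarchical mesh: a rectangle together with its level. -/
@[ext]
structure Cell extends Rect where
  level : ℕ

/-- The four equal subcells of a cell; their level is one higher. -/
def Cell.children (c : Cell) : Set Cell :=
  let xm := (c.x₀ + c.x₁) / 2
  let ym := (c.y₀ + c.y₁) / 2
  {⟨⟨c.x₀, xm, c.y₀, ym⟩, c.level + 1⟩, ⟨⟨xm, c.x₁, c.y₀, ym⟩, c.level + 1⟩,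
   ⟨⟨c.x₀, xm, ym, c.y₁⟩, c.level + 1⟩, ⟨⟨xm, c.x₁, ym, c.y₁⟩, c.level + 1⟩}

/-- The level-zero cells of the tensor product mesh with grid lines `x 0 < ⋯ < x m` and
`y 0 < ⋯ < y n`. -/
def tensorCells {m n : ℕ} (x : Fin (m + 1) → ℝ) (y : Fin (n + 1) → ℝ) : Set Cell :=
  {c | ∃ (i : Fin m) (j : Fin n),
    c = ⟨⟨x i.castSucc, x i.succ, y j.castSucc, y j.succ⟩, 0⟩}

/-- The cell sets of hierarchical T-meshes of `2 × 2` division: start from a tensor product mesh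
and subdivide finitely many times one of the current cells into its four equal subcells. -/
inductive IsHierarchical : Set Cell → Prop
  | tensor {m n : ℕ} (hm : 0 < m) (hn : 0 < n) (x : Fin (m + 1) → ℝ) (y : Fin (n + 1) → ℝ)
      (hx : StrictMono x) (hy : StrictMono y) : IsHierarchical (tensorCells x y)
  | subdivide {F : Set Cell} (hF : IsHierarchical F) (c : Cell) (hc : c ∈ F) :
      IsHierarchical ((F \ {c}) ∪ c.children)

/-- A hierarchical T-mesh of `2 × 2` division, given by its cells. -/
structure HMesh where
  cells : Set Cell
  hier : IsHierarchical cells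

/-! ### Polynomials, Bézier ordinates -/

/-- The space of (functions given by) bivariate polynomials of bi-degree `(m, n)`. -/
def biPoly (m n : ℕ) : Submodule ℝ (ℝ × ℝ → ℝ) :=
  Submodule.span ℝ
    {p | ∃ i j : ℕ, i ≤ m ∧ j ≤ n ∧ p = fun z => z.1 ^ i * z.2 ^ j}

/-- `b` is the array of Bézier ordinates of the biquadratic polynomial `p` over `D`. -/
def IsBezierNet (p : ℝ × ℝ → ℝ) (D : Rect) (b : Fin 3 → Fin 3 → ℝ) : Prop :=
  ∀ z : ℝ × ℝ, p z = ∑ j : Fin 3, ∑ k : Fin 3,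
    b j k * (bernsteinPolynomial ℝ 2 j).eval ((z.1 - D.x₀) / (D.x₁ - D.x₀))
      * (bernsteinPolynomial ℝ 2 k).eval ((z.2 - D.y₀) / (D.y₁ - D.y₀))

/-- The Bézier ordinates of a biquadratic polynomial over a (nondegenerate) rectangle. -/
def bezierNet (p : ℝ × ℝ → ℝ) (D : Rect) : Fin 3 → Fin 3 → ℝ :=
  Classical.epsilon (IsBezierNet p D)

/-- The functional `φ(p : D) = b₁₁`, the central Bézier ordinate of `p` over `D`. -/
def phi (p : ℝ × ℝ → ℝ) (D : Rect) : ℝ := bezierNet p D 1 1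

/-- The biquadratic polynomial that agrees with `f` on the (nondegenerate) rectangle `D`. -/
def expression (f : ℝ × ℝ → ℝ) (D : Rect) : ℝ × ℝ → ℝ :=
  Classical.epsilon fun p => p ∈ biPoly 2 2 ∧ Set.EqOn f p D.carrier

/-- `C^{α,β}(ℝ²)`: continuously differentiable up to order `α` along the `x`-direction and up to
order `β` along the `y`-direction, continuity being joint in both variables. -/
def IsCOrder (α β : ℕ) (f : ℝ × ℝ → ℝ) : Prop :=
  (∀ y : ℝ, ContDiff ℝ α fun s => f (s, y)) ∧
  (∀ i ≤ α, Continuous fun z : ℝ × ℝ => iteratedDeriv i (fun s => f (s, z.2)) z.1) ∧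
  (∀ x : ℝ, ContDiff ℝ β fun t => f (x, t)) ∧
  (∀ j ≤ β, Continuous fun z : ℝ × ℝ => iteratedDeriv j (fun t => f (z.1, t)) z.2)

namespace HMesh

variable (T : HMesh)

/-! ### Vertices, edges and cells -/

/-- The region occupied by the cells. -/
def region : Set (ℝ × ℝ) := ⋃ c ∈ T.cells, c.carrier

/-- The union of all grid lines. -/
def skeleton : Set (ℝ × ℝ) := ⋃ c ∈ T.cells, c.sides

def IsVertex (v : ℝ × ℝ) : Prop := ∃ c ∈ T.cells, v ∈ c.corners

/-- `p q` is a horizontal or vertical line segment of positive length along the grid lines. -/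
def IsGridSegment (p q : ℝ × ℝ) : Prop :=
  p ≠ q ∧ (p.1 = q.1 ∨ p.2 = q.2) ∧ segment ℝ p q ⊆ T.skeleton

/-- An edge joins two adjacent vertices on a grid line. -/
def IsEdge (p q : ℝ × ℝ) : Prop :=
  T.IsVertex p ∧ T.IsVertex q ∧ T.IsGridSegment p q ∧ ∀ r ∈ openSegment ℝ p q, ¬ T.IsVertex r

/-- The number of edges that end at `v`. -/
def valence (v : ℝ × ℝ) : ℕ := {q | T.IsEdge v q}.ncard

/-- A vertex that does not lie on the boundary. -/
def IsInteriorVertex (v : ℝ × ℝ) : Prop := T.IsVertex v ∧ v ∉ frontier T.region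

def IsCrossing (v : ℝ × ℝ) : Prop := T.IsInteriorVertex v ∧ T.valence v = 4

def IsTJunction (v : ℝ × ℝ) : Prop := T.IsInteriorVertex v ∧ T.valence v = 3

/-- The edge `p q` is (part of) a side of the cell `c`. -/
def IsEdgeOf (c : Cell) (p q : ℝ × ℝ) : Prop := T.IsEdge p q ∧ segment ℝ p q ⊆ c.sides

/-- A cell none of whose edges lies on the boundary. -/
def IsInteriorCell (c : Cell) : Prop :=
  c ∈ T.cells ∧ ∀ p q, T.IsEdgeOf c p q → ¬ segment ℝ p q ⊆ frontier T.region

/-- A P-cell: an interior cell all of whose corners are crossing vertices. -/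
def IsPCell (c : Cell) : Prop := T.IsInteriorCell c ∧ ∀ v ∈ c.corners, T.IsCrossing v

/-- A T-cell: an interior cell with at least one T-junction among its corners. -/
def IsTCell (c : Cell) : Prop := T.IsInteriorCell c ∧ ∃ v ∈ c.corners, T.IsTJunction v

/-- Two T-cells that meet at a T-junction, which is a corner of both. -/
def TConnected (c d : Cell) : Prop :=
  T.IsTCell c ∧ T.IsTCell d ∧ ∃ v ∈ c.corners ∩ d.corners, T.IsTJunction v

/-- A T-connection: all T-cells that can be reached from a T-cell by T-connected steps. -/
def IsTConnection (K : Set Cell) : Prop :=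
  ∃ c, T.IsTCell c ∧ K = {d | Relation.ReflTransGen T.TConnected c d}

/-- Two different cells with a common edge. -/
def Adjacent (c d : Cell) : Prop :=
  c ∈ T.cells ∧ d ∈ T.cells ∧ c ≠ d ∧ ∃ p q, T.IsEdgeOf c p q ∧ T.IsEdgeOf d p q

/-- A cell outside of `K` adjacent to a cell of `K`. -/
def IsNeighbour (K : Set Cell) (C : Cell) : Prop := C ∉ K ∧ ∃ c ∈ K, T.Adjacent c C

/-- The one-neighbour-cells of `K`: the neighbours of lowest level. -/
def IsOneNeighbour (K : Set Cell) (C : Cell) : Prop :=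
  T.IsNeighbour K C ∧ ∀ C', T.IsNeighbour K C' → C.level ≤ C'.level

/-! ### The crossing-vertex-relationship graph -/

/-- The union of the edges of the CVR graph: the line segments of the mesh whose two end points
are crossing vertices. (Isolated vertices of the graph do not bound any region.) -/
def cvrLines : Set (ℝ × ℝ) :=
  {z | ∃ p q, T.IsCrossing p ∧ T.IsCrossing q ∧ T.IsGridSegment p q ∧ z ∈ segment ℝ p q}

/-- The g-cells: the bounded regions into which the CVR graph divides the plane. -/
def IsGCell (F : Set (ℝ × ℝ)) : Prop :=
  (∃ z ∈ T.cvrLinesᶜ, F = connectedComponentIn T.cvrLinesᶜ z) ∧ Bornology.IsBounded F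

/-! ### The spline spaces -/

/-- The condition for `f` to lie in the spline space of bi-degree `(m, n)` and smoothness `(α, β)`
with homogeneous boundary conditions. -/
def IsSpline (m n α β : ℕ) (f : ℝ × ℝ → ℝ) : Prop :=
  IsCOrder α β f ∧ (∀ c ∈ T.cells, ∃ p ∈ biPoly m n, Set.EqOn f p c.carrier) ∧
    ∀ z ∉ T.region, f z = 0

end HMesh

theorem IsCOrder.zero (α β : ℕ) : IsCOrder α β 0 := by
  refine ⟨fun _ => contDiff_const, fun i _ => ?_, fun _ => contDiff_const, fun i _ => ?_⟩ <;>
  · simp only [Pi.zero_apply, iteratedDeriv_const]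
    split_ifs <;> exact continuous_const

theorem IsCOrder.add {α β : ℕ} {f g : ℝ × ℝ → ℝ} (hf : IsCOrder α β f) (hg : IsCOrder α β g) :
    IsCOrder α β (f + g) := by
  obtain ⟨f1, f2, f3, f4⟩ := hf
  obtain ⟨g1, g2, g3, g4⟩ := hg
  refine ⟨fun y => (f1 y).add (g1 y), fun i hi => ?_, fun x => (f3 x).add (g3 x), fun j hj => ?_⟩
  · refine ((f2 i hi).add (g2 i hi)).congr fun z => ?_
    exact (iteratedDeriv_fun_add ((f1 z.2).contDiffAt.of_le (by exact_mod_cast hi))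
      ((g1 z.2).contDiffAt.of_le (by exact_mod_cast hi))).symm
  · refine ((f4 j hj).add (g4 j hj)).congr fun z => ?_
    exact (iteratedDeriv_fun_add ((f3 z.1).contDiffAt.of_le (by exact_mod_cast hj))
      ((g3 z.1).contDiffAt.of_le (by exact_mod_cast hj))).symm

theorem IsCOrder.smul {α β : ℕ} {f : ℝ × ℝ → ℝ} (a : ℝ) (hf : IsCOrder α β f) :
    IsCOrder α β (a • f) := by
  obtain ⟨f1, f2, f3, f4⟩ := hf
  refine ⟨fun y => (f1 y).const_smul a, fun i hi => ?_, fun x => (f3 x).const_smul a,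
    fun j hj => ?_⟩
  · refine ((f2 i hi).const_smul a).congr fun z => ?_
    exact (iteratedDeriv_fun_const_smul ((f1 z.2).contDiffAt.of_le (by exact_mod_cast hi)) a).symm
  · refine ((f4 j hj).const_smul a).congr fun z => ?_
    exact (iteratedDeriv_fun_const_smul ((f3 z.1).contDiffAt.of_le (by exact_mod_cast hj)) a).symm

namespace HMesh

variable (T : HMesh)

/-- The spline space of bi-degree `(m, n)` and smoothness `(α, β)` over `T` with homogeneous
boundary conditions. -/
def splineSpace (m n α β : ℕ) : Submodule ℝ (ℝ × ℝ → ℝ) where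
  carrier := {f | T.IsSpline m n α β f}
  zero_mem' := ⟨IsCOrder.zero α β, fun _ _ => ⟨0, Submodule.zero_mem _, fun _ _ => rfl⟩,
    fun _ _ => rfl⟩
  add_mem' := by
    rintro f g ⟨hf, hf', hf''⟩ ⟨hg, hg', hg''⟩
    refine ⟨hf.add hg, fun c hc => ?_, fun z hz => by simp [hf'' z hz, hg'' z hz]⟩
    obtain ⟨p, hp, hfp⟩ := hf' c hc
    obtain ⟨q, hq, hgq⟩ := hg' c hc
    exact ⟨p + q, Submodule.add_mem _ hp hq, fun z hz => by simp [hfp hz, hgq hz]⟩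
  smul_mem' := by
    rintro a f ⟨hf, hf', hf''⟩
    refine ⟨hf.smul a, fun c hc => ?_, fun z hz => by simp [hf'' z hz]⟩
    obtain ⟨p, hp, hfp⟩ := hf' c hc
    exact ⟨a • p, Submodule.smul_mem _ a hp, fun z hz => by simp [hfp hz]⟩

/-- The space of biquadratic `C^{1,1}` splines over `T` with homogeneous boundary conditions. -/
abbrev S2bar : Submodule ℝ (ℝ × ℝ → ℝ) := T.splineSpace 2 2 1 1

/-- The space of piecewise constant functions over the CVR graph with homogeneous boundary
conditions: constant on each g-cell, zero outside of the g-cells. (The g-cells are open; on the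
lines of the graph the functions are normalized to be zero.) -/
def S0bar : Submodule ℝ (ℝ × ℝ → ℝ) where
  carrier := {g | (∀ F, T.IsGCell F → ∃ a : ℝ, ∀ z ∈ F, g z = a) ∧
    ∀ z, (∀ F, T.IsGCell F → z ∉ F) → g z = 0}
  zero_mem' := ⟨fun _ _ => ⟨0, fun _ _ => rfl⟩, fun _ _ => rfl⟩
  add_mem' := by
    rintro f g ⟨hf, hf'⟩ ⟨hg, hg'⟩
    refine ⟨fun F hF => ?_, fun z hz => by simp [hf' z hz, hg' z hz]⟩
    obtain ⟨a, ha⟩ := hf F hF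
    obtain ⟨b, hb⟩ := hg F hF
    exact ⟨a + b, fun z hz => by simp [ha z hz, hb z hz]⟩
  smul_mem' := by
    rintro r f ⟨hf, hf'⟩
    refine ⟨fun F hF => ?_, fun z hz => by simp [hf' z hz]⟩
    obtain ⟨a, ha⟩ := hf F hF
    exact ⟨r * a, fun z hz => by simp [ha z hz]⟩

end HMesh

/-! ### The mapping -/

/-- The domain occupied by a T-connection. -/
def tDomain (K : Set Cell) : Set (ℝ × ℝ) := ⋃ c ∈ K, c.carrier

/-- The T-rectangle-domain: the smallest rectangle that covers the T-connection. -/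
def tRect (K : Set Cell) : Rect where
  x₀ := sInf (Prod.fst '' tDomain K)
  x₁ := sSup (Prod.fst '' tDomain K)
  y₀ := sInf (Prod.snd '' tDomain K)
  y₁ := sSup (Prod.snd '' tDomain K)

namespace HMesh

variable (T : HMesh)

/-- `F` is the P-g-cell that corresponds to the P-cell `c`. -/
def IsPGCell (c : Cell) (F : Set (ℝ × ℝ)) : Prop :=
  T.IsPCell c ∧ T.IsGCell F ∧ closure F = c.carrier

/-- `F` is the T-g-cell that corresponds to the T-connection `K`. -/
def IsTGCell (K : Set Cell) (F : Set (ℝ × ℝ)) : Prop :=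
  T.IsTConnection K ∧ T.IsGCell F ∧ closure F = tDomain K

/-- The rule that defines `g = Φ f`: on the P-g-cell of a P-cell `c`, the value of `g` is the
central ordinate of `f|_c` over `c`; on the T-g-cell of a T-connection `K`, it is the central
ordinate, over the T-rectangle-domain of `K`, of the expression of `f` on any
one-neighbour-cell of `K`. -/
def MapsTo (f g : ℝ × ℝ → ℝ) : Prop :=
  (∀ c F, T.IsPGCell c F → ∀ z ∈ F, g z = phi (expression f c.toRect) c.toRect) ∧
  ∀ K F, T.IsTGCell K F → ∀ C, T.IsOneNeighbour K C →
    ∀ z ∈ F, g z = phi (expression f C.toRect) (tRect K)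

end HMesh

end TMesh

end

noncomputable section

namespace TMesh

/-! ### Coordinates, sides and quadrants

An axis is a Boolean `i` (`false` for the first coordinate), a direction along an axis is a Boolean
`σ` (`true` for the positive direction). -/

/-! Ordinates. The central Bézier ordinate of `p` over `D` is the polar form (blossom) of `p`,
symmetric and affine in its two x-arguments and in its two y-arguments, taken at the two x-sides and
the two y-sides of `D` (`bezierNet_center`). If two pieces of a C¹ spline meet along part of a line
x = ξ, their polar forms agree whenever one x-argument is ξ (`polar_glue`). Hence an ordinate over
`D` can be carried from cell to cell across a grid line that contains a side of `D`, wherever `D`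
lies otherwise, and it is zero if that line is the boundary.

G-cells. Each of the four quadrants at an interior point belongs near that point to exactly one cell
(`Frame`). A grid line leaves a point in some direction iff the two quadrants flanking that
direction have different owners, so valences are read off from owners: an interior vertex is a
crossing or a T-junction, where one larger cell owns two quadrants (`crossing_or_tpat`). Call two
cells linked if a T-junction is a corner of both. Linked cells lie in the same component of the
complement of the CVR graph, since the edge between them that ends at the T-junction is not in the
graph near it. Conversely, a class of linked interior cells fills its whole component: off the graph
a grid line can be followed in at least one direction without meeting a crossing, until the cells on
its two sides turn out to be linked (`walk_aux`, `component_subset`). A class with a boundary cell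
gives an unbounded component. So g-cells are the classes of linked interior cells: single P-cells or
T-connections.

One-neighbour-cells. Let `A` be the ancestor of a cell of the T-connection at the lowest level of a
larger cell touching the T-connection. No link leaves `A`, and every one-neighbour-cell covers a
whole side of `A`. Covers of two sides with a common corner of `A` give the same value, through the
mesh cell in that corner; covers of opposite sides are compared through a cover of a third side,
without which the T-connection could not cross the middle of `A` (`oneNeighbour_polar`).

Injectivity. Induct on the level of a cell `B`. The piece on `B` is zero once its polar form
vanishes on `B`, on a rectangle beyond each side and on one beyond each corner
(`biPoly_zero_of_polar`): nine conditions on a nine-dimensional space. Each is supplied by the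
boundary, by a cell of lower level, by a P-cell, or by a T-connection for which the cell in question
is a one-neighbour-cell (`polar_self`, `side_condition`, `corner_condition`). -/

/-- The sign of a direction. -/
def sg (σ : Bool) : ℝ := cond σ 1 (-1)

@[simp] theorem sg_not (σ : Bool) : sg (!σ) = -sg σ := by cases σ <;> simp [sg]

@[simp] theorem sg_true : sg true = 1 := rfl

@[simp] theorem sg_false : sg false = -1 := rfl

theorem sg_ne_zero (σ : Bool) : sg σ ≠ 0 := by cases σ <;> simp [sg]

theorem sg_mul_sg (σ : Bool) : sg σ * sg σ = 1 := by cases σ <;> simp [sg]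

theorem sg_cancel {σ : Bool} {a b : ℝ} (h : sg σ * a = sg σ * b) : a = b :=
  mul_left_cancel₀ (sg_ne_zero σ) h

theorem sg_antisymm {σ : Bool} {a b : ℝ} (h : sg σ * a ≤ sg σ * b) (h' : sg σ * b ≤ sg σ * a) :
    a = b := sg_cancel (le_antisymm h h')

/-- The coordinate of a point along an axis. -/
def co (i : Bool) (z : ℝ × ℝ) : ℝ := cond i z.2 z.1

/-- The point with coordinate `a` along the axis `i` and `b` along the other axis. -/
def pt (i : Bool) (a b : ℝ) : ℝ × ℝ := cond i (b, a) (a, b)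

@[simp] theorem co_pt (i : Bool) (a b : ℝ) : co i (pt i a b) = a := by cases i <;> rfl

@[simp] theorem co_not_pt (i : Bool) (a b : ℝ) : co (!i) (pt i a b) = b := by cases i <;> rfl

theorem pt_not (i : Bool) (a b : ℝ) : pt (!i) a b = pt i b a := by cases i <;> rfl

@[simp] theorem pt_co (i : Bool) (z : ℝ × ℝ) : pt i (co i z) (co (!i) z) = z := by cases i <;> rfl

theorem pt_ext (i : Bool) {z w : ℝ × ℝ} (h : co i z = co i w) (h' : co (!i) z = co (!i) w) :
    z = w := by
  rw [← pt_co i z, ← pt_co i w, h, h']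

theorem bool_forall (i : Bool) {P : Bool → Prop} : (∀ j, P j) ↔ P i ∧ P (!i) := by
  cases i <;> simp [Bool.forall_bool, and_comm]

/-- The coordinate of the side of a rectangle in direction `σ` of the axis `i`. -/
def Rect.sd (r : Rect) (i σ : Bool) : ℝ := cond i (cond σ r.y₁ r.y₀) (cond σ r.x₁ r.x₀)

theorem Rect.ext_sd {r s : Rect} (h : ∀ i σ, r.sd i σ = s.sd i σ) : r = s := by
  simp only [Bool.forall_bool, Rect.sd, cond] at h
  ext <;> tauto

theorem Cell.ext_sd {c d : Cell} (h : ∀ i σ, c.sd i σ = d.sd i σ) (h' : c.level = d.level) :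
    c = d := by
  have := Rect.ext_sd h
  cases c; cases d; simp_all

/-- A rectangle with sides of positive length. -/
def Rect.Nondeg (r : Rect) : Prop := ∀ i, r.sd i false < r.sd i true

theorem Rect.Nondeg.lt {r : Rect} (h : r.Nondeg) (i σ : Bool) :
    sg σ * r.sd i (!σ) < sg σ * r.sd i σ := by
  have := h i
  cases σ <;> simp [sg] <;> linarith

/-- The interval of `r` along the axis `i` contains all points that follow `t` closely in
direction `σ`. -/
def In1 (r : Rect) (i σ : Bool) (t : ℝ) : Prop :=
  sg σ * r.sd i (!σ) ≤ sg σ * t ∧ sg σ * t < sg σ * r.sd i σ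

/-- The rectangle `r` contains a neighbourhood of `z` in the quadrant in direction `σ` along the
axis `i` and `τ` along the other axis. -/
def InQ (r : Rect) (z : ℝ × ℝ) (i σ τ : Bool) : Prop :=
  In1 r i σ (co i z) ∧ In1 r (!i) τ (co (!i) z)

theorem InQ.swap {r : Rect} {z : ℝ × ℝ} {i σ τ : Bool} (h : InQ r z i σ τ) :
    InQ r z (!i) τ σ := by
  refine ⟨h.2, ?_⟩
  rw [Bool.not_not]; exact h.1

/-- Inclusion of rectangles. -/
def Sub (r s : Rect) : Prop := ∀ i σ, sg σ * r.sd i σ ≤ sg σ * s.sd i σ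

theorem Sub.refl (r : Rect) : Sub r r := fun _ _ => le_rfl

theorem Sub.trans {r s t : Rect} (h : Sub r s) (h' : Sub s t) : Sub r t :=
  fun i σ => (h i σ).trans (h' i σ)

theorem Sub.not {r s : Rect} (h : Sub r s) (i σ : Bool) :
    sg σ * s.sd i (!σ) ≤ sg σ * r.sd i (!σ) := by
  have := h i (!σ)
  simp only [sg_not] at this
  linarith

theorem Sub.in1 {r s : Rect} (h : Sub r s) {i σ : Bool} {t : ℝ} (h' : In1 r i σ t) :
    In1 s i σ t :=
  ⟨(h.not i σ).trans h'.1, h'.2.trans_le (h i σ)⟩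

theorem Sub.inQ {r s : Rect} (h : Sub r s) {z : ℝ × ℝ} {i σ τ : Bool} (h' : InQ r z i σ τ) :
    InQ s z i σ τ := ⟨h.in1 h'.1, h.in1 h'.2⟩

/-- The midpoint of the interval of `r` along the axis `i`. -/
def Rect.mid (r : Rect) (i : Bool) : ℝ := (r.sd i false + r.sd i true) / 2

theorem Rect.mid_eq (r : Rect) (i σ : Bool) : r.mid i = (r.sd i σ + r.sd i (!σ)) / 2 := by
  cases σ <;> simp [Rect.mid, add_comm]

/-- The function `τ` records, for each axis, which half of `P` the child occupies, so that the four
children are handled by one formula. -/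
theorem mem_children {A P : Cell} : A ∈ P.children ↔ A.level = P.level + 1 ∧
    ∃ τ : Bool → Bool, ∀ i, A.sd i (τ i) = P.sd i (τ i) ∧ A.sd i (!τ i) = P.mid i := by
  constructor
  · intro h
    simp only [Cell.children, Set.mem_insert_iff, Set.mem_singleton_iff] at h
    rcases h with rfl | rfl | rfl | rfl
    · exact ⟨rfl, fun i => false, fun i => by cases i <;> simp [Rect.sd, Rect.mid]⟩
    · exact ⟨rfl, fun i => !i, fun i => by cases i <;> simp [Rect.sd, Rect.mid]⟩
    · exact ⟨rfl, fun i => i, fun i => by cases i <;> simp [Rect.sd, Rect.mid]⟩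
    · exact ⟨rfl, fun i => true, fun i => by cases i <;> simp [Rect.sd, Rect.mid]⟩
  · rintro ⟨hl, τ, h⟩
    have h0 := h false
    have h1 := h true
    obtain ⟨⟨a, b, c, d⟩, l⟩ := A
    simp only at hl
    subst hl
    cases h2 : τ false <;> cases h3 : τ true <;>
      simp_all [Cell.children, Rect.sd, Rect.mid]

theorem children_sub {A P : Cell} (h : A ∈ P.children) (hP : P.Nondeg) :
    Sub A.toRect P.toRect := by
  obtain ⟨-, τ, h⟩ := mem_children.1 h
  intro i σ
  obtain ⟨h1, h2⟩ := h i
  have := hP.lt i σ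
  rcases Bool.eq_or_eq_not σ (τ i) with h3 | h3
  · rw [h3, h1]
  · rw [← h3] at h2
    rw [h2, P.mid_eq i σ]
    linarith

theorem children_nondeg {A P : Cell} (h : A ∈ P.children) (hP : P.Nondeg) : A.Nondeg := by
  obtain ⟨-, τ, h⟩ := mem_children.1 h
  intro i
  obtain ⟨h1, h2⟩ := h i
  have := hP i
  cases h3 : τ i <;> simp only [h3, Bool.not_true, Bool.not_false] at h1 h2 <;>
    rw [h1, h2, Rect.mid] <;> linarith

/-! ### Dyadic hierarchies and the frame of a mesh -/

/-- The cells obtained from those in `B` by repeated division. -/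
inductive Dyadic (B : Set Cell) : Cell → Prop
  | base {c : Cell} (h : c ∈ B) : Dyadic B c
  | child {P c : Cell} (hP : Dyadic B P) (h : c ∈ P.children) : Dyadic B c

/-- The intervals of `A` and `B` along each axis coincide or do not overlap. -/
def Aligned (A B : Rect) : Prop :=
  ∀ i, (∀ σ, A.sd i σ = B.sd i σ) ∨ ∃ σ, sg σ * A.sd i σ ≤ sg σ * B.sd i (!σ)

theorem Aligned.eq_of_in1 {A B : Rect} (h : Aligned A B) {i σ : Bool} {t : ℝ} (hA : In1 A i σ t)
    (hB : In1 B i σ t) (τ : Bool) : A.sd i τ = B.sd i τ := by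
  rcases h i with h | ⟨ρ, h⟩
  · exact h τ
  · exfalso
    obtain ⟨a1, a2⟩ := hA
    obtain ⟨b1, b2⟩ := hB
    rcases Bool.eq_or_eq_not ρ σ with rfl | rfl
    · linarith
    · simp only [sg_not, Bool.not_not] at h
      linarith

/-- Along an axis where the parents coincide, the children are equal halves or are separated by the
common midpoint; along an axis where the parents are separated, so are the children. -/
theorem Aligned.children {P P' A A' : Cell} (h : Aligned P.toRect P'.toRect) (hP : P.Nondeg)
    (hP' : P'.Nondeg) (hA : A ∈ P.children) (hA' : A' ∈ P'.children) :
    Aligned A.toRect A'.toRect := by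
  have s1 := children_sub hA hP
  have s2 := children_sub hA' hP'
  obtain ⟨-, τ, hA⟩ := mem_children.1 hA
  obtain ⟨-, τ', hA'⟩ := mem_children.1 hA'
  intro i
  obtain ⟨h1, h2⟩ := hA i
  obtain ⟨h3, h4⟩ := hA' i
  rcases h i with h | ⟨σ, h⟩
  · have hm : P.mid i = P'.mid i := by simp [Rect.mid, h]
    rcases Bool.eq_or_eq_not (τ i) (τ' i) with h5 | h5
    · left
      intro σ
      rw [h5] at h1 h2
      rcases Bool.eq_or_eq_not σ (τ' i) with rfl | rfl
      · rw [h1, h3, h]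
      · rw [h2, h4, hm]
    · right
      refine ⟨!τ i, ?_⟩
      rw [h2, h5, Bool.not_not, h4, hm]
  · right
    refine ⟨σ, (s1 i σ).trans (h.trans (s2.not i σ))⟩

/-- Combinatorial description of a hierarchical mesh with cells `F`: the rectangle it covers,
and a family of nested cells that contains all cells of the mesh and their ancestors. -/
structure Frame (F : Set Cell) where
  Ω : Rect
  V : Set Cell
  fin : F.Finite
  sub : F ⊆ V
  align : ∀ A ∈ V, ∀ B ∈ V, A.level = B.level → Aligned A.toRect B.toRect
  parent : ∀ A ∈ V, ∀ l, A.level = l + 1 → ∃ P ∈ V, P.level = l ∧ A ∈ P.children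
  child : ∀ P ∈ V, P.children ⊆ V
  nd : ∀ A ∈ V, A.Nondeg
  ndΩ : Ω.Nondeg
  inΩ : ∀ A ∈ V, Sub A.toRect Ω
  -- The next two fields say that the cells tile `Ω`: every quadrant at a point has exactly one
  -- owner. The half-open intervals in `In1` make this exact at points on grid lines.
  ex' : ∀ z σ τ, InQ Ω z false σ τ → ∃ c ∈ F, InQ c.toRect z false σ τ
  uniq' : ∀ z σ τ c d, c ∈ F → d ∈ F → InQ c.toRect z false σ τ → InQ d.toRect z false σ τ → c = d

theorem exists_jump {m : ℕ} (p : Fin (m + 1) → Prop) (h0 : p 0) (h1 : ¬ p (Fin.last m)) :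
    ∃ i : Fin m, p i.castSucc ∧ ¬ p i.succ := by
  by_contra! h
  exact h1 (Fin.induction (motive := p) h0 h (Fin.last m))

theorem exists_interval {m : ℕ} (x : Fin (m + 1) → ℝ) (σ : Bool) (t : ℝ)
    (h1 : sg σ * (cond σ (x 0) (x (Fin.last m))) ≤ sg σ * t)
    (h2 : sg σ * t < sg σ * (cond σ (x (Fin.last m)) (x 0))) :
    ∃ i : Fin m, sg σ * (cond σ (x i.castSucc) (x i.succ)) ≤ sg σ * t ∧
      sg σ * t < sg σ * (cond σ (x i.succ) (x i.castSucc)) := by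
  cases σ
  · obtain ⟨i, hi⟩ := exists_jump (fun j => x j < t) (by simpa using h2) (by simpa using h1)
    exact ⟨i, by simpa using hi.2, by simpa using hi.1⟩
  · obtain ⟨i, hi⟩ := exists_jump (fun j => x j ≤ t) (by simpa using h1) (by simpa using h2)
    exact ⟨i, by simpa using hi.1, by simpa using hi.2⟩

theorem tensor_axis {m : ℕ} {x : Fin (m + 1) → ℝ} (hx : StrictMono x) (i j : Fin m) :
    i = j ∨ x i.succ ≤ x j.castSucc ∨ x j.succ ≤ x i.castSucc := by
  rcases lt_trichotomy i j with h | h | h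
  · exact Or.inr (Or.inl (hx.monotone (by
      simp only [Fin.le_def, Fin.val_succ, Fin.val_castSucc]; exact h)))
  · exact Or.inl h
  · exact Or.inr (Or.inr (hx.monotone (by
      simp only [Fin.le_def, Fin.val_succ, Fin.val_castSucc]; exact h)))

section tensor

variable {m n : ℕ} {x : Fin (m + 1) → ℝ} {y : Fin (n + 1) → ℝ}

theorem tensor_aligned (hx : StrictMono x) (hy : StrictMono y) {A B : Cell}
    (hA : A ∈ tensorCells x y) (hB : B ∈ tensorCells x y) : Aligned A.toRect B.toRect := by
  obtain ⟨i, j, rfl⟩ := hA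
  obtain ⟨i', j', rfl⟩ := hB
  intro a
  cases a
  · rcases tensor_axis hx i i' with rfl | h | h
    · exact Or.inl fun σ => rfl
    · exact Or.inr ⟨true, by simpa [Rect.sd] using h⟩
    · exact Or.inr ⟨false, by simpa [Rect.sd] using h⟩
  · rcases tensor_axis hy j j' with rfl | h | h
    · exact Or.inl fun σ => rfl
    · exact Or.inr ⟨true, by simpa [Rect.sd] using h⟩
    · exact Or.inr ⟨false, by simpa [Rect.sd] using h⟩

theorem tensor_nondeg (hx : StrictMono x) (hy : StrictMono y) {A : Cell}
    (hA : A ∈ tensorCells x y) : A.Nondeg := by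
  obtain ⟨i, j, rfl⟩ := hA
  intro a
  cases a
  · exact hx Fin.castSucc_lt_succ
  · exact hy Fin.castSucc_lt_succ

theorem dyadic_nondeg (hx : StrictMono x) (hy : StrictMono y) {A : Cell}
    (hA : Dyadic (tensorCells x y) A) : A.Nondeg := by
  induction hA with
  | base h => exact tensor_nondeg hx hy h
  | child _ h ih => exact children_nondeg h ih

theorem dyadic_level_zero {A : Cell} (hA : Dyadic (tensorCells x y) A) (h : A.level = 0) :
    A ∈ tensorCells x y := by
  cases hA with
  | base h => exact h
  | child hP h' => have := (mem_children.1 h').1; omega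

theorem dyadic_parent {A : Cell} (hA : Dyadic (tensorCells x y) A) {l : ℕ}
    (h : A.level = l + 1) :
    ∃ P, Dyadic (tensorCells x y) P ∧ P.level = l ∧ A ∈ P.children := by
  cases hA with
  | base h' => obtain ⟨i, j, rfl⟩ := h'; simp at h
  | child hP h' => exact ⟨_, hP, by have := (mem_children.1 h').1; omega, h'⟩

theorem dyadic_aligned (hx : StrictMono x) (hy : StrictMono y) (l : ℕ) : ∀ {A B : Cell},
    Dyadic (tensorCells x y) A → Dyadic (tensorCells x y) B → A.level = l → B.level = l →
    Aligned A.toRect B.toRect := by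
  induction l with
  | zero =>
    intro A B hA hB h h'
    exact tensor_aligned hx hy (dyadic_level_zero hA h) (dyadic_level_zero hB h')
  | succ l ih =>
    intro A B hA hB h h'
    obtain ⟨P, hP, h1, h2⟩ := dyadic_parent hA h
    obtain ⟨P', hP', h1', h2'⟩ := dyadic_parent hB h'
    exact (ih hP hP' h1 h1').children (dyadic_nondeg hx hy hP) (dyadic_nondeg hx hy hP') h2 h2'

theorem dyadic_sub (hx : StrictMono x) (hy : StrictMono y) {A : Cell}
    (hA : Dyadic (tensorCells x y) A) :
    Sub A.toRect ⟨x 0, x (Fin.last m), y 0, y (Fin.last n)⟩ := by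
  induction hA with
  | base h =>
    obtain ⟨i, j, rfl⟩ := h
    intro a σ
    cases a <;> cases σ <;> simp only [Rect.sd, cond, sg_true, sg_false, one_mul, neg_mul,
      neg_le_neg_iff]
    · exact hx.monotone (Fin.zero_le _)
    · exact hx.monotone (Fin.le_last _)
    · exact hy.monotone (Fin.zero_le _)
    · exact hy.monotone (Fin.le_last _)
  | child hP h ih => exact (children_sub h (dyadic_nondeg hx hy hP)).trans ih

end tensor

theorem eq_of_inQ {A B : Cell} (h : Aligned A.toRect B.toRect) (hl : A.level = B.level)
    {z : ℝ × ℝ} {i σ τ : Bool} (hA : InQ A.toRect z i σ τ) (hB : InQ B.toRect z i σ τ) : A = B :=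
  Cell.ext_sd (fun j ρ => by
    rcases Bool.eq_or_eq_not j i with rfl | rfl
    · exact h.eq_of_in1 hA.1 hB.1 ρ
    · exact h.eq_of_in1 hA.2 hB.2 ρ) hl

/-- The half-open intervals are closed at the end from which direction `σ` starts, so the midpoint
itself falls to the half in direction `σ`. -/
theorem exists_half {P : Rect} {i σ : Bool} {t : ℝ} (h : In1 P i σ t) :
    ∃ τ, ∀ A : Rect, A.sd i τ = P.sd i τ → A.sd i (!τ) = P.mid i → In1 A i σ t := by
  obtain ⟨h1, h2⟩ := h
  rcases lt_or_ge (sg σ * t) (sg σ * P.mid i) with h3 | h3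
  · refine ⟨!σ, fun A hA hA' => ?_⟩
    rw [Bool.not_not] at hA'
    exact ⟨by rw [hA]; exact h1, by rw [hA']; exact h3⟩
  · exact ⟨σ, fun A hA hA' => ⟨by rw [hA']; exact h3, by rw [hA]; exact h2⟩⟩

theorem exists_child {P : Cell} {z : ℝ × ℝ} {σ τ : Bool} (h : InQ P.toRect z false σ τ) :
    ∃ A ∈ P.children, InQ A.toRect z false σ τ := by
  obtain ⟨ρ, hρ⟩ := exists_half h.1
  obtain ⟨ρ', hρ'⟩ := exists_half h.2
  let A : Cell := ⟨⟨cond ρ (P.mid false) P.x₀, cond ρ P.x₁ (P.mid false),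
    cond ρ' (P.mid true) P.y₀, cond ρ' P.y₁ (P.mid true)⟩, P.level + 1⟩
  have hA : ∀ i, A.sd i (cond i ρ' ρ) = P.sd i (cond i ρ' ρ) ∧
      A.sd i (!cond i ρ' ρ) = P.mid i := by
    intro i
    cases i <;> cases ρ <;> cases ρ' <;> exact ⟨rfl, rfl⟩
  exact ⟨A, mem_children.2 ⟨rfl, fun i => cond i ρ' ρ, hA⟩,
    hρ _ (hA false).1 (hA false).2, hρ' _ (hA true).1 (hA true).2⟩

/-- `V` is taken to be all dyadic descendants of the tensor cells, whether or not they occur in the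
mesh. It then does not change under subdivision, and only finiteness, inclusion in `V` and ownership
of quadrants have to be carried through the induction. -/
theorem exists_frame {F : Set Cell} (h : IsHierarchical F) : Nonempty (Frame F) := by
  induction h with
  | @tensor m n hm hn x y hx hy =>
    refine ⟨⟨⟨x 0, x (Fin.last m), y 0, y (Fin.last n)⟩, {A | Dyadic (tensorCells x y) A},
      ?_, fun c hc => .base hc, fun A hA B hB h => dyadic_aligned hx hy _ hA hB h rfl,
      fun A hA l h => dyadic_parent hA h, fun P hP A hA => .child hP hA, fun A hA => dyadic_nondeg hx hy hA,
      ?_, fun A hA => dyadic_sub hx hy hA, ?_, ?_⟩⟩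
    · refine (Set.finite_range fun p : Fin m × Fin n =>
        (⟨⟨x p.1.castSucc, x p.1.succ, y p.2.castSucc, y p.2.succ⟩, 0⟩ : Cell)).subset ?_
      rintro c ⟨i, j, rfl⟩
      exact ⟨(i, j), rfl⟩
    · intro i
      cases i
      · exact hx (Fin.lt_def.2 (by simpa using hm))
      · exact hy (Fin.lt_def.2 (by simpa using hn))
    · rintro z σ τ ⟨⟨h1, h2⟩, h3, h4⟩
      obtain ⟨i, hi⟩ := exists_interval x σ (co false z) (by cases σ <;> exact h1)
        (by cases σ <;> exact h2)
      obtain ⟨j, hj⟩ := exists_interval y τ (co true z) (by cases τ <;> exact h3)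
        (by cases τ <;> exact h4)
      refine ⟨_, ⟨i, j, rfl⟩, ⟨?_, ?_⟩, ?_, ?_⟩
      · cases σ <;> exact hi.1
      · cases σ <;> exact hi.2
      · cases τ <;> exact hj.1
      · cases τ <;> exact hj.2
    · intro z σ τ c d hc hd h h'
      refine eq_of_inQ (tensor_aligned hx hy hc hd) ?_ h h'
      obtain ⟨_, _, rfl⟩ := hc
      obtain ⟨_, _, rfl⟩ := hd
      rfl
  | @subdivide F hF c hc ih =>
    obtain ⟨M⟩ := ih
    have hcV := M.sub hc
    refine ⟨⟨M.Ω, M.V, ?_, ?_, M.align, M.parent, M.child, M.nd, M.ndΩ, M.inΩ, ?_, ?_⟩⟩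
    · refine (M.fin.subset Set.sdiff_subset).union ?_
      simp only [Cell.children]
      exact Set.toFinite _
    · rintro d (hd | hd)
      · exact M.sub hd.1
      · exact M.child c hcV hd
    · intro z σ τ h
      obtain ⟨d, hd, hz⟩ := M.ex' z σ τ h
      by_cases hdc : d = c
      · subst hdc
        obtain ⟨A, hA, hz'⟩ := exists_child hz
        exact ⟨A, Or.inr hA, hz'⟩
      · exact ⟨d, Or.inl ⟨hd, hdc⟩, hz⟩
    · have key : ∀ z σ τ d e, d ∈ F \ {c} → e ∈ c.children → InQ d.toRect z false σ τ →
          InQ e.toRect z false σ τ → False := fun z σ τ d e hd he h h' =>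
        hd.2 (M.uniq' z σ τ d c hd.1 hc h ((children_sub he (M.nd c hcV)).inQ h'))
      rintro z σ τ d e (hd | hd) (he | he) h h'
      · exact M.uniq' z σ τ d e hd.1 he.1 h h'
      · exact (key z σ τ d e hd he h h').elim
      · exact (key z σ τ e d he hd h' h).elim
      · have hl : d.level = e.level := by
          rw [(mem_children.1 hd).1, (mem_children.1 he).1]
        exact eq_of_inQ (M.align d (M.child c hcV hd) e (M.child c hcV he) hl) hl h h'

theorem In1.flip {r : Rect} {i σ : Bool} {t : ℝ} (h : In1 r i σ t) (h' : r.sd i (!σ) ≠ t) :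
    In1 r i (!σ) t := by
  obtain ⟨h1, h2⟩ := h
  have h3 : sg σ * r.sd i (!σ) < sg σ * t :=
    lt_of_le_of_ne h1 fun h => h' (sg_cancel h)
  constructor <;> simp only [sg_not, Bool.not_not] <;> linarith

theorem In1.strict {r : Rect} {i σ : Bool} {t : ℝ} (h : In1 r i σ t) (h' : In1 r i (!σ) t)
    (ρ : Bool) : sg ρ * t < sg ρ * r.sd i ρ := by
  obtain ⟨h1, h2⟩ := h
  obtain ⟨h3, h4⟩ := h'
  simp only [sg_not, Bool.not_not] at *
  rcases Bool.eq_or_eq_not ρ σ with rfl | rfl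
  · exact h2
  · simp only [sg_not]; linarith

theorem in1_of_strict {r : Rect} {i : Bool} {t : ℝ} (h : ∀ σ, sg σ * t < sg σ * r.sd i σ)
    (σ : Bool) : In1 r i σ t := by
  have h1 := h (!σ)
  simp only [sg_not] at h1
  exact ⟨by linarith, h σ⟩

theorem exists_in1 {r : Rect} {i : Bool} {t : ℝ} (hr : r.Nondeg)
    (h : ∀ σ, sg σ * t ≤ sg σ * r.sd i σ) : ∃ σ, In1 r i σ t := by
  have h1 := h true
  have h2 := h false
  have h3 := hr i
  simp only [sg_true, sg_false] at h1 h2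
  by_cases h4 : t < r.sd i true
  · exact ⟨true, by constructor <;> simp <;> linarith⟩
  · exact ⟨false, by constructor <;> simp <;> linarith⟩

theorem In1.le {r : Rect} {i σ : Bool} {t : ℝ} (h : In1 r i σ t) (ρ : Bool) :
    sg ρ * t ≤ sg ρ * r.sd i ρ := by
  obtain ⟨h1, h2⟩ := h
  rcases Bool.eq_or_eq_not ρ σ with rfl | rfl
  · exact h2.le
  · simp only [sg_not]; linarith

theorem Rect.Nondeg.in1_sd {r : Rect} (h : r.Nondeg) (i σ : Bool) : In1 r i σ (r.sd i (!σ)) :=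
  ⟨le_rfl, h.lt i σ⟩

theorem Rect.Nondeg.inQ_corner {r : Rect} (h : r.Nondeg) (i σ τ : Bool) :
    InQ r (pt i (r.sd i (!σ)) (r.sd (!i) (!τ))) i σ τ := by
  constructor
  · rw [co_pt]; exact h.in1_sd i σ
  · rw [co_not_pt]; exact h.in1_sd (!i) τ

theorem mem_carrier {r : Rect} {z : ℝ × ℝ} :
    z ∈ r.carrier ↔ ∀ i σ, sg σ * co i z ≤ sg σ * r.sd i σ := by
  simp only [Bool.forall_bool, Rect.carrier, Set.mem_prod, Set.mem_Icc, co, Rect.sd, cond, sg_true,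
    sg_false, neg_mul, one_mul, neg_le_neg_iff]

theorem mem_inner {r : Rect} {z : ℝ × ℝ} :
    z ∈ r.inner ↔ ∀ i σ, sg σ * co i z < sg σ * r.sd i σ := by
  simp only [Bool.forall_bool, Rect.inner, Set.mem_prod, Set.mem_Ioo, co, Rect.sd, cond, sg_true,
    sg_false, neg_mul, one_mul, neg_lt_neg_iff]

theorem InQ.mem_carrier {r : Rect} {z : ℝ × ℝ} {i σ τ : Bool} (h : InQ r z i σ τ) :
    z ∈ r.carrier := TMesh.mem_carrier.2 <| (bool_forall i).2 ⟨fun ρ => h.1.le ρ, fun ρ => h.2.le ρ⟩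

theorem exists_inQ {r : Rect} (hr : r.Nondeg) {z : ℝ × ℝ} (h : z ∈ r.carrier) (i : Bool) :
    ∃ σ τ, InQ r z i σ τ := by
  rw [mem_carrier] at h
  obtain ⟨σ, hσ⟩ := exists_in1 hr (h i)
  obtain ⟨τ, hτ⟩ := exists_in1 hr (h (!i))
  exact ⟨σ, τ, hσ, hτ⟩

theorem inQ_of_mem_inner {r : Rect} {z : ℝ × ℝ} (h : z ∈ r.inner) (i σ τ : Bool) :
    InQ r z i σ τ := by
  rw [mem_inner] at h
  exact ⟨in1_of_strict (h i) σ, in1_of_strict (h (!i)) τ⟩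

theorem mem_corners {r : Rect} {z : ℝ × ℝ} (i : Bool) :
    z ∈ r.corners ↔ (∃ σ, co i z = r.sd i σ) ∧ ∃ τ, co (!i) z = r.sd (!i) τ := by
  obtain ⟨a, b⟩ := z
  cases i <;>
    simp [Rect.corners, Bool.exists_bool, co, Rect.sd, Prod.ext_iff] <;> tauto

theorem sub_carrier {r s : Rect} (h : Sub r s) : r.carrier ⊆ s.carrier := fun _ hz =>
  mem_carrier.2 fun i σ => (mem_carrier.1 hz i σ).trans (h i σ)

/-! ### Nesting of cells, the region and the skeleton -/

namespace Frame

variable {T : HMesh} (M : Frame T.cells)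

include M

theorem ndF {c : Cell} (hc : c ∈ T.cells) : c.Nondeg := M.nd c (M.sub hc)

theorem ex {z : ℝ × ℝ} {i σ τ : Bool} (h : InQ M.Ω z i σ τ) :
    ∃ c ∈ T.cells, InQ c.toRect z i σ τ := by
  cases i
  · exact M.ex' z σ τ h
  · obtain ⟨c, hc, h⟩ := M.ex' z τ σ h.swap
    exact ⟨c, hc, h.swap⟩

theorem uniq {z : ℝ × ℝ} {i σ τ : Bool} {c d : Cell} (hc : c ∈ T.cells) (hd : d ∈ T.cells)
    (h : InQ c.toRect z i σ τ) (h' : InQ d.toRect z i σ τ) : c = d := by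
  cases i
  · exact M.uniq' z σ τ c d hc hd h h'
  · exact M.uniq' z τ σ c d hc hd h.swap h'.swap

theorem anc {c : Cell} (hc : c ∈ M.V) {l : ℕ} (hl : l ≤ c.level) :
    ∃ A ∈ M.V, A.level = l ∧ Sub c.toRect A.toRect := by
  obtain ⟨n, hn⟩ := Nat.exists_eq_add_of_le hl
  induction n generalizing c with
  | zero => exact ⟨c, hc, by omega, Sub.refl _⟩
  | succ n ih =>
    obtain ⟨P, hP, h1, h2⟩ := M.parent c hc (l + n) (by omega)
    obtain ⟨A, hA, h3, h4⟩ := ih hP (by omega) (by omega)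
    exact ⟨A, hA, h3, (children_sub h2 (M.nd P hP)).trans h4⟩

theorem eq_of_level {A B : Cell} (hA : A ∈ M.V) (hB : B ∈ M.V) (hl : A.level = B.level)
    {z : ℝ × ℝ} {i σ τ : Bool} (h : InQ A.toRect z i σ τ) (h' : InQ B.toRect z i σ τ) : A = B :=
  eq_of_inQ (M.align A hA B hB hl) hl h h'

/-- The ancestor of `B` on the level of `A` owns the same quadrant as `A`, hence is `A`. -/
theorem nested {A B : Cell} (hA : A ∈ M.V) (hB : B ∈ M.V) (hl : A.level ≤ B.level)
    {z : ℝ × ℝ} {i σ τ : Bool} (h : InQ A.toRect z i σ τ) (h' : InQ B.toRect z i σ τ) :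
    Sub B.toRect A.toRect := by
  obtain ⟨A', hA', h1, h2⟩ := M.anc hB hl
  rwa [M.eq_of_level hA hA' h1.symm h (h2.inQ h')]

theorem nested_of_sub {A B c : Cell} (hA : A ∈ M.V) (hB : B ∈ M.V) (hc : c ∈ M.V)
    (hl : A.level ≤ B.level) (h : Sub c.toRect A.toRect) (h' : Sub c.toRect B.toRect) :
    Sub B.toRect A.toRect :=
  have := (M.nd c hc).inQ_corner false true true
  M.nested hA hB hl (h.inQ this) (h'.inQ this)

theorem eq_of_sub {A B c : Cell} (hA : A ∈ M.V) (hB : B ∈ M.V) (hc : c ∈ M.V)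
    (hl : A.level = B.level) (h : Sub c.toRect A.toRect) (h' : Sub c.toRect B.toRect) : A = B :=
  have := (M.nd c hc).inQ_corner false true true
  M.eq_of_level hA hB hl (h.inQ this) (h'.inQ this)

theorem leaf_eq {c d : Cell} (hc : c ∈ T.cells) (hd : d ∈ T.cells) (h : Sub c.toRect d.toRect) :
    c = d :=
  have := (M.ndF hc).inQ_corner false true true
  M.uniq hc hd this (h.inQ this)

theorem child_of {A B : Cell} (hA : A ∈ M.V) (hB : B ∈ M.V) (h : Sub B.toRect A.toRect)
    (hl : A.level < B.level) : ∃ P ∈ M.V, P ∈ A.children ∧ Sub B.toRect P.toRect := by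
  obtain ⟨P, hP, h1, h2⟩ := M.anc hB (show A.level + 1 ≤ B.level from hl)
  obtain ⟨A', hA', h3, h4⟩ := M.parent P hP _ h1
  have := M.eq_of_sub hA hA' hB h3.symm h (h2.trans (children_sub h4 (M.nd A' hA')))
  subst this
  exact ⟨P, hP, h4, h2⟩

/-- A proper descendant of `A` misses one of the two sides of `A` along each axis. -/
theorem half {A B : Cell} (hA : A ∈ M.V) (hB : B ∈ M.V) (h : Sub B.toRect A.toRect)
    (hl : A.level < B.level) (i : Bool) : ∃ σ, sg σ * B.sd i σ ≤ sg σ * A.mid i := by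
  obtain ⟨P, hP, hc, hs⟩ := M.child_of hA hB h hl
  obtain ⟨-, τ, hτ⟩ := mem_children.1 hc
  refine ⟨!τ i, (hs i (!τ i)).trans ?_⟩
  rw [(hτ i).2]

omit M in
theorem mid_lt {A : Rect} (hA : A.Nondeg) (i σ : Bool) : sg σ * A.mid i < sg σ * A.sd i σ := by
  have := hA.lt i σ
  rw [A.mid_eq i σ]
  linarith

theorem half_lt {A B : Cell} (hA : A ∈ M.V) (hB : B ∈ M.V) (h : Sub B.toRect A.toRect)
    (hl : A.level < B.level) (i : Bool) : ∃ σ, sg σ * B.sd i σ < sg σ * A.sd i σ := by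
  obtain ⟨σ, hσ⟩ := M.half hA hB h hl i
  exact ⟨σ, hσ.trans_lt (mid_lt (M.nd A hA) i σ)⟩

theorem region_eq : T.region = M.Ω.carrier := by
  ext z
  simp only [HMesh.region, Set.mem_iUnion, exists_prop]
  constructor
  · rintro ⟨c, hc, hz⟩
    exact sub_carrier (M.inΩ c (M.sub hc)) hz
  · intro hz
    obtain ⟨σ, τ, h⟩ := exists_inQ M.ndΩ hz false
    obtain ⟨c, hc, h⟩ := M.ex h
    exact ⟨c, hc, h.mem_carrier⟩

theorem frontier_region : frontier T.region = M.Ω.sides := by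
  have hc : IsClosed M.Ω.carrier := isClosed_Icc.prod isClosed_Icc
  rw [M.region_eq, frontier, hc.closure_eq, Rect.carrier, interior_prod_eq, interior_Icc,
    interior_Icc]
  rfl

theorem inner_of_interiorVertex {v : ℝ × ℝ} (h : T.IsInteriorVertex v) : v ∈ M.Ω.inner := by
  obtain ⟨⟨c, hc, hv⟩, h⟩ := h
  rw [M.frontier_region] at h
  by_contra h'
  refine h ⟨?_, h'⟩
  refine sub_carrier (M.inΩ c (M.sub hc)) ?_
  obtain ⟨⟨σ, h1⟩, τ, h2⟩ := (mem_corners false).1 hv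
  rw [mem_carrier, bool_forall false]
  constructor
  · intro ρ
    rw [h1]
    rcases Bool.eq_or_eq_not σ ρ with rfl | rfl
    · exact le_rfl
    · exact ((M.ndF hc).lt _ _).le
  · intro ρ
    rw [h2]
    rcases Bool.eq_or_eq_not τ ρ with rfl | rfl
    · exact le_rfl
    · exact ((M.ndF hc).lt _ _).le

theorem not_skeleton_of_inner {c : Cell} (hc : c ∈ T.cells) {z : ℝ × ℝ} (hz : z ∈ c.inner) :
    z ∉ T.skeleton := by
  intro h
  simp only [HMesh.skeleton, Set.mem_iUnion, exists_prop] at h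
  obtain ⟨d, hd, h⟩ := h
  obtain ⟨σ, τ, h'⟩ := exists_inQ (M.ndF hd) h.1 false
  have := M.uniq hc hd (inQ_of_mem_inner hz _ _ _) h'
  subst this
  exact h.2 hz

omit M in
theorem corner_mem {c : Rect} (hc : c.Nondeg) {v : ℝ × ℝ} (hv : v ∈ c.corners) (i : Bool) :
    ∃ σ τ, InQ c v i σ τ ∧ co i v = c.sd i (!σ) ∧ co (!i) v = c.sd (!i) (!τ) := by
  obtain ⟨⟨σ, h1⟩, τ, h2⟩ := (mem_corners i).1 hv
  refine ⟨!σ, !τ, ⟨?_, ?_⟩, by simpa using h1, by simpa using h2⟩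
  · rw [h1]; simpa using hc.in1_sd i (!σ)
  · rw [h2]; simpa using hc.in1_sd (!i) (!τ)

end Frame

/-! ### Segments parallel to an axis -/

theorem seg_mem {p q z : ℝ × ℝ} {i τ : Bool} (h : co i p = co i q)
    (hτ : sg τ * co (!i) p ≤ sg τ * co (!i) q) :
    z ∈ segment ℝ p q ↔ co i z = co i p ∧ sg τ * co (!i) p ≤ sg τ * co (!i) z ∧
      sg τ * co (!i) z ≤ sg τ * co (!i) q := by
  have key : ∀ a b c : ℝ, sg τ * a ≤ sg τ * b →
      (c ∈ segment ℝ a b ↔ sg τ * a ≤ sg τ * c ∧ sg τ * c ≤ sg τ * b) := by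
    intro a b c hab
    cases τ
    · simp only [sg_false, neg_mul, one_mul, neg_le_neg_iff] at *
      rw [segment_symm, segment_eq_Icc hab, Set.mem_Icc, and_comm]
    · simp only [sg_true, one_mul] at *
      rw [segment_eq_Icc hab, Set.mem_Icc]
  obtain ⟨p1, p2⟩ := p
  obtain ⟨q1, q2⟩ := q
  obtain ⟨z1, z2⟩ := z
  cases i
  · simp only [co, cond, Bool.not_false] at *
    subst h
    rw [← key p2 q2 z2 hτ, ← Prod.image_mk_segment_right]
    simp only [Set.mem_image, Prod.mk.injEq]
    constructor
    · rintro ⟨x, hx, rfl, rfl⟩; exact ⟨rfl, hx⟩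
    · rintro ⟨rfl, hx⟩; exact ⟨_, hx, rfl, rfl⟩
  · simp only [co, cond, Bool.not_true] at *
    subst h
    rw [← key p1 q1 z1 hτ, ← Prod.image_mk_segment_left]
    simp only [Set.mem_image, Prod.mk.injEq]
    constructor
    · rintro ⟨x, hx, rfl, rfl⟩; exact ⟨rfl, hx⟩
    · rintro ⟨rfl, hx⟩; exact ⟨_, hx, rfl, rfl⟩

theorem openSeg_mem {p q z : ℝ × ℝ} {i τ : Bool} (h : co i p = co i q)
    (hτ : sg τ * co (!i) p < sg τ * co (!i) q) :
    z ∈ openSegment ℝ p q ↔ co i z = co i p ∧ sg τ * co (!i) p < sg τ * co (!i) z ∧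
      sg τ * co (!i) z < sg τ * co (!i) q := by
  have hne : p ≠ q := by rintro rfl; exact lt_irrefl _ hτ
  constructor
  · intro hz
    have hp : z ≠ p := fun hp => hne (left_mem_openSegment_iff.1 (hp ▸ hz))
    have hq : z ≠ q := fun hq => hne (right_mem_openSegment_iff.1 (hq ▸ hz))
    obtain ⟨h1, h2, h3⟩ := (seg_mem h hτ.le).1 (openSegment_subset_segment _ _ _ hz)
    refine ⟨h1, lt_of_le_of_ne h2 fun h => hp ?_, lt_of_le_of_ne h3 fun h' => hq ?_⟩
    · exact pt_ext i h1 (sg_cancel h).symm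
    · exact pt_ext i (h1.trans h) (sg_cancel h')
  · rintro ⟨h1, h2, h3⟩
    refine mem_openSegment_of_ne_left_right ?_ ?_ ((seg_mem h hτ.le).2 ⟨h1, h2.le, h3.le⟩)
    · rintro rfl; exact lt_irrefl _ h2
    · rintro rfl; exact lt_irrefl _ h3

theorem exists_dir {p q : ℝ × ℝ} (hne : p ≠ q) (h : p.1 = q.1 ∨ p.2 = q.2) :
    ∃ i τ, co i p = co i q ∧ sg τ * co (!i) p < sg τ * co (!i) q := by
  have key : ∀ i, co i p = co i q → ∃ i τ, co i p = co i q ∧ sg τ * co (!i) p < sg τ * co (!i) q := by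
    intro i hi
    have : co (!i) p ≠ co (!i) q := fun h' => hne (pt_ext i hi h')
    rcases lt_or_gt_of_ne this with h | h
    · exact ⟨i, true, hi, by simpa using h⟩
    · exact ⟨i, false, hi, by simpa using h⟩
  rcases h with h | h
  · exact key false h
  · exact key true h

theorem axis_or {p q : ℝ × ℝ} (i : Bool) (h : co i p = co i q) : p.1 = q.1 ∨ p.2 = q.2 := by
  cases i
  · exact Or.inl h
  · exact Or.inr h

/-! ### Valence -/

/-- The grid lines through `v` continue from `v` along the line on which the coordinate `i` is
constant, in direction `τ`. -/
def HMesh.Ray (T : HMesh) (v : ℝ × ℝ) (i τ : Bool) : Prop :=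
  ∃ σ, ∃ c ∈ T.cells, InQ c.toRect v i σ τ ∧ ¬ InQ c.toRect v i (!σ) τ

namespace Frame

variable {T : HMesh} (M : Frame T.cells)

include M

omit M in
theorem line_of {c : Rect} {z : ℝ × ℝ} {i σ τ : Bool} (h : InQ c z i σ τ)
    (h' : ¬ InQ c z i (!σ) τ) : c.sd i (!σ) = co i z := by
  by_contra h2
  exact h' ⟨h.1.flip h2, h.2⟩

/-- The two cells flanking the ray have sides on it. The nearer of their far ends is a vertex, and
before it no cell has a corner on the ray, because the flanking cells own all quadrants there. -/
theorem ray_next {v : ℝ × ℝ} {i τ : Bool} (h : T.Ray v i τ) :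
    ∃ t, sg τ * co (!i) v < sg τ * t ∧ T.IsVertex (pt i (co i v) t) ∧
      (∀ z, co i z = co i v → sg τ * co (!i) v ≤ sg τ * co (!i) z → sg τ * co (!i) z ≤ sg τ * t →
        z ∈ T.skeleton) ∧
      ∀ z, co i z = co i v → sg τ * co (!i) v < sg τ * co (!i) z → sg τ * co (!i) z < sg τ * t →
        ¬ T.IsVertex z := by
  obtain ⟨σ, c, hc, h1, h2⟩ := h
  have hl := line_of h1 h2
  have hsk : ∀ z, co i z = co i v → sg τ * co (!i) v ≤ sg τ * co (!i) z →
      sg τ * co (!i) z ≤ sg τ * c.sd (!i) τ → z ∈ T.skeleton := by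
    intro z hz h3 h4
    simp only [HMesh.skeleton, Set.mem_iUnion, exists_prop]
    refine ⟨c, hc, ?_, fun h => ?_⟩
    · rw [mem_carrier, bool_forall i]
      refine ⟨fun ρ => by rw [hz]; exact h1.1.le ρ, fun ρ => ?_⟩
      rcases Bool.eq_or_eq_not ρ τ with rfl | rfl
      · exact h4
      · have := h1.2.1
        simp only [sg_not]
        linarith
    · have := mem_inner.1 h i (!σ)
      rw [hz, hl] at this
      exact lt_irrefl _ this
  have hbetween : ∀ (d : Cell) (ρ : Bool), InQ d.toRect v i ρ τ → ∀ z, co i z = co i v →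
      sg τ * co (!i) v < sg τ * co (!i) z → sg τ * co (!i) z < sg τ * d.sd (!i) τ →
      ∀ τ', InQ d.toRect z i ρ τ' := by
    intro d ρ hd z hz h3 h4 τ'
    refine ⟨by rw [hz]; exact hd.1, in1_of_strict (fun ρ' => ?_) τ'⟩
    rcases Bool.eq_or_eq_not ρ' τ with rfl | rfl
    · exact h4
    · have := hd.2.1
      simp only [sg_not]
      linarith
  have hnot : ∀ (d : Cell) (ρ : Bool), d ∈ T.cells → InQ d.toRect v i ρ τ → ∀ z, co i z = co i v →
      sg τ * co (!i) v < sg τ * co (!i) z → sg τ * co (!i) z < sg τ * d.sd (!i) τ →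
      ∀ e ∈ T.cells, ∀ τ', InQ e.toRect z i ρ τ' → z ∉ e.corners := by
    intro d ρ hd hv z hz h3 h4 e he τ' h5 h6
    have := M.uniq he hd h5 (hbetween d ρ hv z hz h3 h4 τ')
    subst this
    obtain ⟨ρ', h7⟩ := ((mem_corners i).1 h6).2
    have h8 := hbetween e ρ hv z hz h3 h4
    have := (h8 true).2.strict (h8 false).2 ρ'
    rw [h7] at this
    exact lt_irrefl _ this
  -- The ray has cells on both sides unless it runs along the boundary.
  by_cases hd : ∃ d ∈ T.cells, InQ d.toRect v i (!σ) τ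
  · obtain ⟨d, hd, h3⟩ := hd
    have hcd : ¬ InQ d.toRect v i σ τ := fun h => h2 (by rwa [M.uniq hc hd h1 h])
    have hl' : d.sd i σ = co i v := by simpa using line_of h3 (by simpa using hcd)
    have hvc : T.IsVertex (pt i (co i v) (c.sd (!i) τ)) :=
      ⟨c, hc, (mem_corners i).2 ⟨⟨!σ, by simp [hl]⟩, τ, by simp⟩⟩
    have hvd : T.IsVertex (pt i (co i v) (d.sd (!i) τ)) :=
      ⟨d, hd, (mem_corners i).2 ⟨⟨σ, by simp [hl']⟩, τ, by simp⟩⟩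
    obtain ⟨t, ht, htc, htd, htv⟩ : ∃ t, T.IsVertex (pt i (co i v) t) ∧
        sg τ * t ≤ sg τ * c.sd (!i) τ ∧ sg τ * t ≤ sg τ * d.sd (!i) τ ∧
        sg τ * co (!i) v < sg τ * t := by
      rcases le_total (sg τ * c.sd (!i) τ) (sg τ * d.sd (!i) τ) with h | h
      · exact ⟨_, hvc, le_rfl, h, h1.2.2⟩
      · exact ⟨_, hvd, h, le_rfl, h3.2.2⟩
    refine ⟨t, htv, ht, fun z hz h5 h6 => hsk z hz h5 (h6.trans htc), ?_⟩
    rintro z hz h5 h6 ⟨e, he, h7⟩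
    obtain ⟨ρ, τ', h8, -, -⟩ := corner_mem (M.ndF he) h7 i
    rcases Bool.eq_or_eq_not ρ σ with rfl | rfl
    · exact hnot c ρ hc h1 z hz h5 (h6.trans_le htc) e he τ' h8 h7
    · exact hnot d _ hd h3 z hz h5 (h6.trans_le htd) e he τ' h8 h7
  · refine ⟨c.sd (!i) τ, h1.2.2, ⟨c, hc, (mem_corners i).2 ⟨⟨!σ, by simp [hl]⟩, τ, by simp⟩⟩,
      hsk, ?_⟩
    rintro z hz h5 h6 ⟨e, he, h7⟩
    obtain ⟨ρ, τ', h8, -, -⟩ := corner_mem (M.ndF he) h7 i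
    rcases Bool.eq_or_eq_not ρ σ with rfl | rfl
    · exact hnot c ρ hc h1 z hz h5 h6 e he τ' h8 h7
    · have h9 := (M.inΩ e (M.sub he)).in1 h8.1
      rw [hz] at h9
      exact hd (M.ex ⟨h9, (M.inΩ c (M.sub hc)).in1 h1.2⟩)

theorem skeleton_subset : T.skeleton ⊆ M.Ω.carrier := by
  intro z hz
  simp only [HMesh.skeleton, Set.mem_iUnion, exists_prop] at hz
  obtain ⟨c, hc, h⟩ := hz
  exact sub_carrier (M.inΩ c (M.sub hc)) h.1

omit M in
/-- A segment in the open strip next to a point inside of a cell leaves the skeleton. -/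
theorem exists_inner_ahead {c : Cell} {v : ℝ × ℝ} {i τ : Bool} (h : InQ c.toRect v i true τ)
    (h' : InQ c.toRect v i false τ) {t : ℝ} (ht : sg τ * co (!i) v < sg τ * t) :
    ∃ z ∈ c.inner, co i z = co i v ∧ sg τ * co (!i) v < sg τ * co (!i) z ∧
      sg τ * co (!i) z < sg τ * t := by
  obtain ⟨s, hs, hs'⟩ := exists_between (lt_min ht h.2.2)
  rw [lt_min_iff] at hs'
  have hss : sg τ * (sg τ * s) = s := by rw [← mul_assoc, sg_mul_sg, one_mul]
  refine ⟨pt i (co i v) (sg τ * s), ?_, by simp, by simpa [hss] using hs, by simpa [hss] using hs'.1⟩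
  rw [mem_inner, bool_forall i]
  simp only [co_pt, co_not_pt]
  refine ⟨fun ρ => h.1.strict h'.1 ρ, fun ρ => ?_⟩
  rcases Bool.eq_or_eq_not ρ τ with rfl | rfl
  · rw [hss]; exact hs'.2
  · have := h.2.1
    simp only [sg_not, neg_mul, hss]
    linarith

/-- If one cell owned both quadrants next to the segment, the segment would run through its interior
and leave the skeleton. -/
theorem ray_of_segment {v q : ℝ × ℝ} {i τ : Bool} (h : co i v = co i q)
    (hτ : sg τ * co (!i) v < sg τ * co (!i) q) (hs : segment ℝ v q ⊆ T.skeleton) :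
    T.Ray v i τ := by
  have hv : v ∈ M.Ω.carrier := M.skeleton_subset (hs (left_mem_segment _ _ _))
  have hq : q ∈ M.Ω.carrier := M.skeleton_subset (hs (right_mem_segment _ _ _))
  rw [mem_carrier] at hv hq
  obtain ⟨σ, hσ⟩ := exists_in1 M.ndΩ (hv i)
  have h1 : In1 M.Ω (!i) τ (co (!i) v) := by
    have := hv (!i) (!τ)
    simp only [sg_not] at this
    exact ⟨by linarith, hτ.trans_le (hq (!i) τ)⟩
  obtain ⟨c, hc, h2⟩ := M.ex ⟨hσ, h1⟩
  refine ⟨σ, c, hc, h2, fun h3 => ?_⟩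
  have h4 : InQ c.toRect v i true τ ∧ InQ c.toRect v i false τ := by
    cases σ
    · exact ⟨h3, h2⟩
    · exact ⟨h2, h3⟩
  obtain ⟨z, hz, h5, h6, h7⟩ := exists_inner_ahead h4.1 h4.2 hτ
  exact M.not_skeleton_of_inner hc hz (hs ((seg_mem h hτ.le).2 ⟨h5, h6.le, h7.le⟩))

/-- Each ray carries exactly one edge from `v`, ending at the vertex from `ray_next`. Valence thus
becomes a count among four directions that depends only on the owners of the four quadrants. -/
theorem valence_eq {v : ℝ × ℝ} (hv : T.IsVertex v) :
    T.valence v = {p : Bool × Bool | T.Ray v p.1 p.2}.ncard := by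
  classical
  choose! t ht using fun (p : Bool × Bool) (hp : T.Ray v p.1 p.2) => M.ray_next hp
  have himg : {q | T.IsEdge v q} =
      (fun p : Bool × Bool => pt p.1 (co p.1 v) (t p)) '' {p : Bool × Bool | T.Ray v p.1 p.2} := by
    ext q
    constructor
    · rintro ⟨-, hq, ⟨hne, hax, hsk⟩, hno⟩
      obtain ⟨i, τ, h1, h2⟩ := exists_dir hne hax
      have hr : T.Ray v i τ := M.ray_of_segment h1 h2 hsk
      obtain ⟨h3, h4, h5, h6⟩ := ht (i, τ) hr
      refine ⟨(i, τ), hr, pt_ext i (by simpa using h1) ?_⟩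
      simp only [co_not_pt]
      refine sg_antisymm (σ := τ) (not_lt.1 fun h => ?_) (not_lt.1 fun h => ?_)
      · exact h6 q h1.symm h2 h hq
      · exact hno _ ((openSeg_mem h1 h2).2 ⟨by simp, by simpa using h3, by simpa using h⟩) h4
    · rintro ⟨⟨i, τ⟩, hr, rfl⟩
      obtain ⟨h3, h4, h5, h6⟩ := ht (i, τ) hr
      have e1 : co i v = co i (pt i (co i v) (t (i, τ))) := by simp
      have e2 : sg τ * co (!i) v < sg τ * co (!i) (pt i (co i v) (t (i, τ))) := by simpa using h3
      refine ⟨hv, h4, ⟨?_, axis_or i e1, ?_⟩, ?_⟩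
      · intro h; exact lt_irrefl _ (e2.trans_eq (by rw [congrArg (co (!i)) h]))
      · intro z hz
        obtain ⟨a, b, c⟩ := (seg_mem e1 e2.le).1 hz
        exact h5 z a b (by simpa using c)
      · intro z hz
        obtain ⟨a, b, c⟩ := (openSeg_mem e1 e2).1 hz
        exact h6 z a b (by simpa using c)
  rw [HMesh.valence, himg]
  refine Set.InjOn.ncard_image ?_
  rintro ⟨i, τ⟩ hp ⟨i', τ'⟩ hp' heq
  have h3 := (ht (i, τ) hp).1
  have h3' := (ht (i', τ') hp').1
  simp only at heq h3 h3'
  rcases Bool.eq_or_eq_not i' i with rfl | rfl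
  · have : t (i', τ) = t (i', τ') := by simpa using congrArg (co (!i')) heq
    rw [← this] at h3'
    rcases Bool.eq_or_eq_not τ' τ with rfl | rfl
    · rfl
    · simp only [sg_not] at h3'; linarith
  · exfalso
    have := congrArg (co i) heq
    rw [co_pt] at this
    rw [pt_not, co_pt] at this
    rw [← this] at h3'
    simp at h3'

end Frame

/-! ### Crossings and T-junctions in terms of the four owners -/

/-- The configuration at a T-junction `v`: the cell `B` has `v` inside of its side in direction
`!σ` of the axis `i`, the cells `c` and `d` lie on the other side. -/
structure HMesh.TPat (T : HMesh) (v : ℝ × ℝ) (i σ τ : Bool) (B c d : Cell) : Prop where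
  hB : B ∈ T.cells
  hc : c ∈ T.cells
  hd : d ∈ T.cells
  B1 : InQ B.toRect v i σ τ
  B2 : InQ B.toRect v i σ (!τ)
  c1 : InQ c.toRect v i (!σ) τ
  d1 : InQ d.toRect v i (!σ) (!τ)
  ne : c ≠ d

namespace Frame

variable {T : HMesh} (M : Frame T.cells)

include M

omit M in
theorem _root_.TMesh.HMesh.TPat.swap {v : ℝ × ℝ} {i σ τ : Bool} {B c d : Cell}
    (h : T.TPat v i σ τ B c d) : T.TPat v i σ (!τ) B d c :=
  ⟨h.hB, h.hd, h.hc, h.B2, by simpa using h.B1, h.d1, by simpa using h.c1, h.ne.symm⟩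

theorem tpat_ne {v : ℝ × ℝ} {i σ τ : Bool} {B c d : Cell} (h : T.TPat v i σ τ B c d) : c ≠ B := by
  intro hcB
  have h1 := h.c1
  rw [hcB] at h1
  have h2 : InQ B.toRect v i (!σ) (!τ) := ⟨h1.1, h.B2.2⟩
  exact h.ne (hcB.trans (M.uniq h.hB h.hd h2 h.d1))

theorem tpat_inner {v : ℝ × ℝ} {i σ τ : Bool} {B c d : Cell} (h : T.TPat v i σ τ B c d) :
    v ∈ M.Ω.inner := by
  rw [mem_inner, bool_forall i]
  exact ⟨fun ρ => ((M.inΩ B (M.sub h.hB)).in1 h.B1.1).strict ((M.inΩ c (M.sub h.hc)).in1 h.c1.1) ρ,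
    fun ρ => ((M.inΩ B (M.sub h.hB)).in1 h.B1.2).strict ((M.inΩ B (M.sub h.hB)).in1 h.B2.2) ρ⟩

/-- The sides of the cells at a T-junction. -/
theorem tpat_sides {v : ℝ × ℝ} {i σ τ : Bool} {B c d : Cell} (h : T.TPat v i σ τ B c d) :
    B.sd i (!σ) = co i v ∧ c.sd i σ = co i v ∧ c.sd (!i) (!τ) = co (!i) v := by
  have hne := M.tpat_ne h
  refine ⟨line_of h.B1 fun h' => hne (M.uniq h.hc h.hB h.c1 h'), ?_, ?_⟩
  · simpa using line_of h.c1 fun h' => hne (M.uniq h.hc h.hB (by simpa using h') h.B1)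
  · exact line_of h.c1.swap fun h' => h.ne (M.uniq h.hc h.hd (by simpa using h'.swap) h.d1)

theorem tpat_corner {v : ℝ × ℝ} {i σ τ : Bool} {B c d : Cell} (h : T.TPat v i σ τ B c d) :
    v ∈ c.corners :=
  have := M.tpat_sides h
  (mem_corners i).2 ⟨⟨_, this.2.1.symm⟩, _, this.2.2.symm⟩

theorem interiorVertex_of_inner {v : ℝ × ℝ} (h : T.IsVertex v) (h' : v ∈ M.Ω.inner) :
    T.IsInteriorVertex v := ⟨h, by rw [M.frontier_region]; exact fun h => h.2 h'⟩

/-- The only missing ray is the one that would enter `B`. -/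
theorem tpat_isTJunction {v : ℝ × ℝ} {i σ τ : Bool} {B c d : Cell} (h : T.TPat v i σ τ B c d) :
    T.IsTJunction v := by
  have hv : T.IsVertex v := ⟨c, h.hc, M.tpat_corner h⟩
  refine ⟨M.interiorVertex_of_inner hv (M.tpat_inner h), ?_⟩
  rw [M.valence_eq hv]
  have hcB := M.tpat_ne h
  have hdB := M.tpat_ne h.swap
  have key : {p : Bool × Bool | T.Ray v p.1 p.2} = {(!i, !σ), (i, τ), (i, !τ)} := by
    ext ⟨j, ρ⟩
    simp only [Set.mem_ofPred_eq, Set.mem_insert_iff, Set.mem_singleton_iff, Prod.mk.injEq]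
    constructor
    · intro hr
      rcases Bool.eq_or_eq_not j i with rfl | rfl
      · rcases Bool.eq_or_eq_not ρ τ with rfl | rfl <;> simp
      · rcases Bool.eq_or_eq_not ρ σ with rfl | rfl
        · exfalso
          obtain ⟨ρ', e, he, h1, h2⟩ := hr
          have a1 : InQ B.toRect v (!i) τ ρ := h.B1.swap
          have a2 : InQ B.toRect v (!i) (!τ) ρ := h.B2.swap
          rcases Bool.eq_or_eq_not ρ' τ with rfl | rfl
          · rw [M.uniq he h.hB h1 a1] at h2; exact h2 a2
          · rw [M.uniq he h.hB h1 a2] at h2; exact h2 (by simpa using a1)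
        · simp
    · rintro (⟨rfl, rfl⟩ | ⟨rfl, rfl⟩ | ⟨rfl, rfl⟩)
      · exact ⟨τ, c, h.hc, h.c1.swap, fun h' => h.ne (M.uniq h.hc h.hd h' h.d1.swap)⟩
      · exact ⟨σ, B, h.hB, h.B1, fun h' => hcB (M.uniq h.hc h.hB h.c1 h')⟩
      · exact ⟨σ, B, h.hB, h.B2, fun h' => hdB (M.uniq h.hd h.hB h.d1 h')⟩
  rw [key, Set.ncard_insert_of_notMem (by simp), Set.ncard_pair (by simp)]

/-- With all four rays the valence is 4. A missing ray means that one cell `B` owns the two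
quadrants beside it, and the other two quadrants then supply the pattern. -/
theorem crossing_or_tpat {v : ℝ × ℝ} (h : T.IsInteriorVertex v) :
    T.IsCrossing v ∨ ∃ i σ τ B c d, T.TPat v i σ τ B c d := by
  have hin := M.inner_of_interiorVertex h
  by_cases hr : ∀ i τ, T.Ray v i τ
  · left
    refine ⟨h, ?_⟩
    rw [M.valence_eq h.1]
    have : {p : Bool × Bool | T.Ray v p.1 p.2} = Set.univ := by ext p; simp [hr]
    rw [this, Set.ncard_univ]
    simp
  · right
    push Not at hr
    obtain ⟨j, σ, hr⟩ := hr
    obtain ⟨B, hB, h1⟩ := M.ex (inQ_of_mem_inner hin j true σ)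
    have h2 : InQ B.toRect v j false σ := by
      by_contra h2
      exact hr ⟨true, B, hB, h1, h2⟩
    obtain ⟨c, hc, h3⟩ := M.ex (inQ_of_mem_inner hin j true (!σ))
    obtain ⟨d, hd, h4⟩ := M.ex (inQ_of_mem_inner hin j false (!σ))
    refine ⟨!j, σ, true, B, c, d, hB, hc, hd, h1.swap, h2.swap, h3.swap, h4.swap, ?_⟩
    -- If a single cell owned the two remaining quadrants as well, every cell at `v` would extend to
    -- both sides of `v` along the axis `j`, so `v` would be no corner.
    rintro rfl
    obtain ⟨e, he, hv⟩ := h.1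
    obtain ⟨ρ, ρ', h5, h6, h7⟩ := corner_mem (M.ndF he) hv j
    have h8 : ∀ ρ, InQ c.toRect v j ρ (!σ) := by intro ρ; cases ρ; exacts [h4, h3]
    have h9 : ∀ ρ, InQ B.toRect v j ρ σ := by intro ρ; cases ρ; exacts [h2, h1]
    have : InQ e.toRect v j (!ρ) ρ' := by
      rcases Bool.eq_or_eq_not ρ' σ with rfl | rfl
      · rw [M.uniq he hB h5 (h9 ρ)]; exact h9 _
      · rw [M.uniq he hc h5 (h8 ρ)]; exact h8 _
    have := h5.1.strict this.1 (!ρ)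
    rw [h6] at this
    exact lt_irrefl _ this

theorem tJunction_tpat {v : ℝ × ℝ} (h : T.IsTJunction v) : ∃ i σ τ B c d, T.TPat v i σ τ B c d := by
  rcases M.crossing_or_tpat h.1 with h' | h'
  · have := h.2.symm.trans h'.2
    omega
  · exact h'

/-- The two cells with a common corner at a T-junction. -/
theorem tJunction_cells {v : ℝ × ℝ} (h : T.IsTJunction v) {c d : Cell} (hc : c ∈ T.cells)
    (hd : d ∈ T.cells) (hcd : c ≠ d) (hvc : v ∈ c.corners) (hvd : v ∈ d.corners) :
    ∃ i σ τ B, T.TPat v i σ τ B c d := by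
  obtain ⟨i, σ, τ, B, e, g, hp⟩ := M.tJunction_tpat h
  have key : ∀ c ∈ T.cells, v ∈ c.corners → c = e ∨ c = g := by
    intro c hc hv
    obtain ⟨ρ, ρ', h1, h2, h3⟩ := corner_mem (M.ndF hc) hv i
    rcases Bool.eq_or_eq_not ρ σ with rfl | rfl
    · exfalso
      have h4 : c = B ∧ InQ B.toRect v i ρ (!ρ') := by
        rcases Bool.eq_or_eq_not ρ' τ with rfl | rfl
        · exact ⟨M.uniq hc hp.hB h1 hp.B1, hp.B2⟩
        · exact ⟨M.uniq hc hp.hB h1 hp.B2, by simpa using hp.B1⟩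
      have := h1.2.strict (h4.1 ▸ h4.2.2) (!ρ')
      rw [h3] at this
      exact lt_irrefl _ this
    · rcases Bool.eq_or_eq_not ρ' τ with rfl | rfl
      · exact Or.inl (M.uniq hc hp.hc h1 hp.c1)
      · exact Or.inr (M.uniq hc hp.hd h1 hp.d1)
  rcases key c hc hvc with rfl | rfl <;> rcases key d hd hvd with rfl | rfl
  · exact (hcd rfl).elim
  · exact ⟨i, σ, τ, B, hp⟩
  · exact ⟨i, σ, !τ, B, hp.swap⟩
  · exact (hcd rfl).elim

end Frame

/-! ### Cells that touch a larger cell, and links -/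

/-- The cell `c` touches the side of the larger cell `B` from outside, `B` lying in direction `σ`
of the axis `i`. -/
structure HMesh.Under (T : HMesh) (c B : Cell) (i σ : Bool) : Prop where
  hc : c ∈ T.cells
  hB : B ∈ T.cells
  lt : B.level < c.level
  line : c.sd i σ = B.sd i (!σ)
  ext : ∀ ρ, sg ρ * c.sd (!i) ρ ≤ sg ρ * B.sd (!i) ρ

/-- Two cells that have a T-junction as a common corner. -/
def HMesh.Link (T : HMesh) (c d : Cell) : Prop :=
  c ∈ T.cells ∧ d ∈ T.cells ∧ ∃ v ∈ c.corners ∩ d.corners, T.IsTJunction v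

theorem HMesh.Link.symm {T : HMesh} {c d : Cell} (h : T.Link c d) : T.Link d c := by
  obtain ⟨h1, h2, v, h3, h4⟩ := h
  exact ⟨h2, h1, v, ⟨h3.2, h3.1⟩, h4⟩

namespace Frame

variable {T : HMesh} (M : Frame T.cells)

include M

/-- Let `A` be the ancestor of `c` on the level of `B`. Alignment on that level forces `A` to be a
mirror position of `B` across the common line: same extent along the line, and no part beyond it. -/
theorem across {B c A : Cell} (hB : B ∈ T.cells) (hc : c ∈ T.cells) {z : ℝ × ℝ} {i σ τ : Bool}
    (h1 : InQ B.toRect z i σ τ) (h2 : InQ c.toRect z i (!σ) τ) (hne : c ≠ B)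
    (hA : A ∈ M.V) (hl : A.level = B.level) (hs : Sub c.toRect A.toRect) :
    (∀ ρ, A.sd (!i) ρ = B.sd (!i) ρ) ∧ A.sd i σ = co i z ∧ B.sd i (!σ) = co i z ∧
      c.sd i σ = co i z := by
  have al := M.align A hA B (M.sub hB) hl
  have hb : B.sd i (!σ) = co i z := line_of h1 fun h => hne (M.uniq hc hB h2 h)
  have hcs : c.sd i σ = co i z := by
    simpa using line_of h2 fun h => hne (M.uniq hc hB (by simpa using h) h1)
  refine ⟨fun ρ => al.eq_of_in1 (hs.in1 h2.2) h1.2 ρ, ?_, hb, hcs⟩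
  have hA2 := (hs.in1 h2.1)
  rcases al i with h | ⟨ρ, h⟩
  · exfalso
    have : In1 B.toRect i (!σ) (co i z) := by
      unfold In1 at hA2 ⊢
      rwa [h, h] at hA2
    exact hne (M.uniq hc hB h2 ⟨this, h1.2⟩)
  · have h3 := hs i σ
    rcases Bool.eq_or_eq_not ρ σ with rfl | rfl
    · rw [hcs] at h3
      rw [hb] at h
      exact sg_antisymm h h3
    · exfalso
      have h4 := hA2.2
      have h5 := h1.1.2
      simp only [sg_not, Bool.not_not] at h h4
      linarith

theorem under_of_adj {B c : Cell} (hB : B ∈ T.cells) (hc : c ∈ T.cells) {z : ℝ × ℝ} {i σ τ : Bool}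
    (h1 : InQ B.toRect z i σ τ) (h2 : InQ c.toRect z i (!σ) τ) (hl : B.level < c.level) :
    T.Under c B i σ := by
  have hne : c ≠ B := by rintro rfl; exact lt_irrefl _ hl
  obtain ⟨A, hA, hA1, hA2⟩ := M.anc (M.sub hc) hl.le
  obtain ⟨h3, h4, h5, h6⟩ := M.across hB hc h1 h2 hne hA hA1 hA2
  exact ⟨hc, hB, hl, h6.trans h5.symm, fun ρ => (hA2 (!i) ρ).trans_eq (by rw [h3])⟩

theorem under_inQ {c B : Cell} {i σ : Bool} (h : T.Under c B i σ) (τ : Bool) :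
    InQ c.toRect (pt i (c.sd i σ) (c.sd (!i) (!τ))) i (!σ) τ ∧
      InQ B.toRect (pt i (c.sd i σ) (c.sd (!i) (!τ))) i σ τ := by
  refine ⟨by simpa using (M.ndF h.hc).inQ_corner i (!σ) τ, ?_, ?_⟩
  · rw [co_pt, h.line]
    exact (M.ndF h.hB).in1_sd i σ
  · rw [co_not_pt]
    have h1 := h.ext (!τ)
    have h2 := h.ext τ
    have h3 := (M.ndF h.hc).lt (!i) τ
    simp only [sg_not] at h1
    exact ⟨by linarith, by linarith⟩

theorem under_anc {c B A : Cell} {i σ : Bool} (h : T.Under c B i σ) (hA : A ∈ M.V)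
    (hl : A.level = B.level) (hs : Sub c.toRect A.toRect) :
    (∀ ρ, A.sd (!i) ρ = B.sd (!i) ρ) ∧ A.sd i σ = B.sd i (!σ) := by
  obtain ⟨h1, h2⟩ := M.under_inQ h true
  obtain ⟨h3, h4, h5, -⟩ := M.across h.hB h.hc h2 h1
    (by rintro rfl; exact lt_irrefl _ h.lt) hA hl hs
  exact ⟨h3, h4.trans h5.symm⟩

/-- Otherwise the ancestor of `B` on the level of `c` would by `across` have the same extent as `c`
along the line. But `c` ends at `v`, while `B` continues beyond it. -/
theorem tpat_level {v : ℝ × ℝ} {i σ τ : Bool} {B c d : Cell} (h : T.TPat v i σ τ B c d) :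
    B.level < c.level := by
  by_contra! hl
  obtain ⟨A, hA, hA1, hA2⟩ := M.anc (M.sub h.hB) hl
  obtain ⟨h3, -⟩ := M.across h.hc h.hB h.c1 (by simpa using h.B1) (M.tpat_ne h).symm hA hA1 hA2
  have h4 := (M.tpat_sides h).2.2
  have h5 := h.B1.2.strict h.B2.2 (!τ)
  have h6 := hA2 (!i) (!τ)
  rw [h3, h4] at h6
  linarith

theorem tpat_under {v : ℝ × ℝ} {i σ τ : Bool} {B c d : Cell} (h : T.TPat v i σ τ B c d) :
    T.Under c B i σ := M.under_of_adj h.hB h.hc h.B1 h.c1 (M.tpat_level h)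

/-- By `under_anc`, `A` faces the whole side of `B` that contains `v` in its interior, so it
contains the cells on both sides of the edge that ends at `v`. -/
theorem tpat_sub {v : ℝ × ℝ} {i σ τ : Bool} {B c d A : Cell} (h : T.TPat v i σ τ B c d)
    (hA : A ∈ M.V) (hl : A.level = B.level) (hs : Sub c.toRect A.toRect) :
    Sub d.toRect A.toRect := by
  obtain ⟨h1, -⟩ := M.under_anc (M.tpat_under h) hA hl hs
  have h2 : In1 A.toRect (!i) (!τ) (co (!i) v) := by
    have := h.B2.2
    unfold In1 at this ⊢
    rwa [h1, h1]
  exact M.nested hA (M.sub h.hd) (hl.le.trans (M.tpat_level h.swap).le) ⟨hs.in1 h.c1.1, h2⟩ h.d1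

theorem link_of_tpat {v : ℝ × ℝ} {i σ τ : Bool} {B c d : Cell} (h : T.TPat v i σ τ B c d) :
    T.Link c d :=
  ⟨h.hc, h.hd, v, ⟨M.tpat_corner h, M.tpat_corner h.swap⟩, M.tpat_isTJunction h⟩

theorem link_tpat {c d : Cell} (h : T.Link c d) (hne : c ≠ d) :
    ∃ v i σ τ B, T.TPat v i σ τ B c d := by
  obtain ⟨hc, hd, v, hv, ht⟩ := h
  obtain ⟨i, σ, τ, B, h⟩ := M.tJunction_cells ht hc hd hne hv.1 hv.2
  exact ⟨v, i, σ, τ, B, h⟩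

/-- An end point of the side of `c` that lies inside of the side of `B` is a T-junction. -/
theorem under_tpat {c B : Cell} {i σ τ : Bool} (h : T.Under c B i σ)
    (hτ : sg τ * c.sd (!i) τ < sg τ * B.sd (!i) τ) :
    ∃ d, T.TPat (pt i (c.sd i σ) (c.sd (!i) τ)) i σ τ B d c := by
  have h1 := M.under_inQ h (!τ)
  rw [Bool.not_not] at h1
  obtain ⟨h1, h2⟩ := h1
  have h3 : InQ B.toRect (pt i (c.sd i σ) (c.sd (!i) τ)) i σ τ := by
    refine ⟨h2.1, ?_⟩
    rw [co_not_pt]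
    have h4 := h.ext (!τ)
    have h5 := (M.ndF h.hc).lt (!i) τ
    simp only [sg_not] at h4
    exact ⟨by linarith, hτ⟩
  obtain ⟨d, hd, h4⟩ := M.ex (z := pt i (c.sd i σ) (c.sd (!i) τ)) (i := i) (σ := !σ) (τ := τ)
    ⟨(M.inΩ c (M.sub h.hc)).in1 h1.1, (M.inΩ B (M.sub h.hB)).in1 h3.2⟩
  refine ⟨d, h.hB, hd, h.hc, h3, h2, h4, h1, ?_⟩
  rintro rfl
  have := h4.2.2
  simp at this

/-- The ancestor of `c` opposite to `B` has the extent of `B`, and a proper descendant of it falls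
short at one end. With `under_tpat` this makes every cell that touches a larger cell have a
T-junction as a corner. -/
theorem under_exists_lt {c B : Cell} {i σ : Bool} (h : T.Under c B i σ) :
    ∃ τ, sg τ * c.sd (!i) τ < sg τ * B.sd (!i) τ := by
  obtain ⟨A, hA, hA1, hA2⟩ := M.anc (M.sub h.hc) h.lt.le
  obtain ⟨τ, hτ⟩ := M.half_lt hA (M.sub h.hc) hA2 (hA1.trans_lt h.lt) (!i)
  refine ⟨τ, ?_⟩
  rwa [(M.under_anc h hA hA1 hA2).1] at hτ

theorem under_tJunction {c B : Cell} {i σ : Bool} (h : T.Under c B i σ) :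
    ∃ v ∈ c.corners, T.IsTJunction v := by
  obtain ⟨τ, hτ⟩ := M.under_exists_lt h
  obtain ⟨d, hd⟩ := M.under_tpat h hτ
  exact ⟨_, M.tpat_corner hd.swap, M.tpat_isTJunction hd⟩

theorem tJunction_under {c : Cell} (hc : c ∈ T.cells) {v : ℝ × ℝ} (hv : v ∈ c.corners)
    (h : T.IsTJunction v) : ∃ B i σ, T.Under c B i σ := by
  obtain ⟨i, σ, τ, B, e, g, hp⟩ := M.tJunction_tpat h
  by_cases hce : c = e
  · exact ⟨B, i, σ, hce ▸ M.tpat_under hp⟩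
  · obtain ⟨i, σ, τ, B, hq⟩ := M.tJunction_cells h hc hp.hc hce hv (M.tpat_corner hp)
    exact ⟨B, i, σ, M.tpat_under hq⟩

/-- If no cell beyond the side has a corner inside of it, the side is a single edge. Cells on the
inner side need no hypothesis, since `c` owns the quadrants there. -/
theorem side_edge {c : Cell} (hc : c ∈ T.cells) {i σ : Bool}
    (h : ∀ z, co i z = c.sd i σ → (∀ ρ, sg ρ * co (!i) z < sg ρ * c.sd (!i) ρ) →
      ∀ e ∈ T.cells, ∀ ρ', InQ e.toRect z i σ ρ' → z ∉ e.corners) :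
    T.IsEdgeOf c (pt i (c.sd i σ) (c.sd (!i) false)) (pt i (c.sd i σ) (c.sd (!i) true)) := by
  have hlt := M.ndF hc (!i)
  have e1 : co i (pt i (c.sd i σ) (c.sd (!i) false)) = co i (pt i (c.sd i σ) (c.sd (!i) true)) := by
    simp
  have e2 : sg true * co (!i) (pt i (c.sd i σ) (c.sd (!i) false)) <
      sg true * co (!i) (pt i (c.sd i σ) (c.sd (!i) true)) := by simpa using hlt
  have hseg : segment ℝ (pt i (c.sd i σ) (c.sd (!i) false)) (pt i (c.sd i σ) (c.sd (!i) true)) ⊆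
      c.sides := by
    intro z hz
    obtain ⟨h1, h2, h3⟩ := (seg_mem e1 e2.le).1 hz
    simp only [co_pt, co_not_pt, sg_true, one_mul] at h1 h2 h3
    constructor
    · rw [mem_carrier, bool_forall i]
      refine ⟨fun ρ => ?_, fun ρ => ?_⟩
      · rw [h1]
        rcases Bool.eq_or_eq_not ρ σ with rfl | rfl
        · exact le_rfl
        · simpa using ((M.ndF hc).lt i (!σ)).le
      · cases ρ <;> simp <;> assumption
    · intro h
      have := mem_inner.1 h i σ
      rw [h1] at this
      exact lt_irrefl _ this
  refine ⟨⟨⟨c, hc, (mem_corners i).2 ⟨⟨σ, by simp⟩, false, by simp⟩⟩,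
    ⟨c, hc, (mem_corners i).2 ⟨⟨σ, by simp⟩, true, by simp⟩⟩, ⟨?_, axis_or i e1, ?_⟩, ?_⟩, hseg⟩
  · intro h; rw [h] at e2; exact lt_irrefl _ e2
  · refine hseg.trans fun z hz => ?_
    simp only [HMesh.skeleton, Set.mem_iUnion, exists_prop]
    exact ⟨c, hc, hz⟩
  · rintro z hz ⟨e, he, hv⟩
    obtain ⟨h1, h2, h3⟩ := (openSeg_mem e1 e2).1 hz
    simp only [co_pt, co_not_pt, sg_true, one_mul] at h1 h2 h3
    have hs : ∀ ρ, sg ρ * co (!i) z < sg ρ * c.sd (!i) ρ := by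
      intro ρ; cases ρ <;> simp <;> assumption
    obtain ⟨ρ, ρ', h4, h5, h6⟩ := corner_mem (M.ndF he) hv i
    rcases Bool.eq_or_eq_not ρ σ with rfl | rfl
    · exact h z h1 hs e he ρ' h4 hv
    · have h7 : In1 c.toRect i (!σ) (co i z) := by
        rw [h1]; simpa using (M.ndF hc).in1_sd i (!σ)
      have := M.uniq he hc h4 ⟨h7, in1_of_strict hs ρ'⟩
      subst this
      have := hs (!ρ')
      rw [h6] at this
      exact lt_irrefl _ this

/-- No cell lies beyond a side on the boundary, so by `side_edge` such a side is one edge. A cell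
that shares no side coordinate with `Ω` lies in its open interior. -/
theorem isInteriorCell_iff {c : Cell} :
    T.IsInteriorCell c ↔ c ∈ T.cells ∧ ∀ i σ, c.sd i σ ≠ M.Ω.sd i σ := by
  constructor
  · rintro ⟨hc, h⟩
    refine ⟨hc, fun i σ hs => ?_⟩
    have he := M.side_edge hc (i := i) (σ := σ) (by
      intro z hz _ e he ρ' h1 _
      have := ((M.inΩ e (M.sub he)).in1 h1.1).2
      rw [hz, hs] at this
      exact lt_irrefl _ this)
    refine h _ _ he ?_
    rw [M.frontier_region]
    intro z hz
    refine ⟨sub_carrier (M.inΩ c (M.sub hc)) (he.2 hz).1, fun h1 => ?_⟩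
    have e2 : sg true * co (!i) (pt i (c.sd i σ) (c.sd (!i) false)) ≤
      sg true * co (!i) (pt i (c.sd i σ) (c.sd (!i) true)) := by simpa using (M.ndF hc (!i)).le
    have h2 := ((seg_mem (by simp) e2).1 hz).1
    rw [co_pt, hs] at h2
    have := mem_inner.1 h1 i σ
    rw [h2] at this
    exact lt_irrefl _ this
  · rintro ⟨hc, h⟩
    refine ⟨hc, fun p q he hf => ?_⟩
    have h1 := (he.2 (left_mem_segment _ _ _)).1
    have h2 := hf (left_mem_segment _ _ _)
    rw [M.frontier_region] at h2
    refine h2.2 (mem_inner.2 fun i σ => ?_)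
    have h3 := mem_carrier.1 h1 i σ
    have h4 := M.inΩ c (M.sub hc) i σ
    exact h3.trans_lt (lt_of_le_of_ne h4 fun h5 => h i σ (sg_cancel h5))

theorem under_adjacent {c B : Cell} {i σ : Bool} (h : T.Under c B i σ) : T.Adjacent c B := by
  refine ⟨h.hc, h.hB, by rintro rfl; exact lt_irrefl _ h.lt, ?_⟩
  have hin : ∀ z, co i z = c.sd i σ → (∀ ρ, sg ρ * co (!i) z < sg ρ * c.sd (!i) ρ) →
      ∀ ρ, sg ρ * co (!i) z < sg ρ * B.sd (!i) ρ := fun z _ hz ρ => (hz ρ).trans_le (h.ext ρ)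
  have he := M.side_edge h.hc (i := i) (σ := σ) (by
    intro z hz hs e he ρ' h1 h2
    have h3 : InQ B.toRect z i σ ρ' := by
      refine ⟨?_, in1_of_strict (hin z hz hs) ρ'⟩
      rw [hz, h.line]
      exact (M.ndF h.hB).in1_sd i σ
    have := M.uniq he h.hB h1 h3
    subst this
    obtain ⟨ρ, h4⟩ := ((mem_corners i).1 h2).2
    have := hin z hz hs ρ
    rw [h4] at this
    exact lt_irrefl _ this)
  refine ⟨_, _, he, he.1, fun z hz => ?_⟩
  have e2 : sg true * co (!i) (pt i (c.sd i σ) (c.sd (!i) false)) ≤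
    sg true * co (!i) (pt i (c.sd i σ) (c.sd (!i) true)) := by simpa using (M.ndF h.hc (!i)).le
  obtain ⟨h1, h2, h3⟩ := (seg_mem (by simp) e2).1 hz
  simp only [co_pt, co_not_pt, sg_true, one_mul] at h1 h2 h3
  constructor
  · rw [mem_carrier, bool_forall i]
    refine ⟨fun ρ => ?_, fun ρ => ?_⟩
    · rw [h1, h.line]
      rcases Bool.eq_or_eq_not ρ σ with rfl | rfl
      · exact ((M.ndF h.hB).lt i ρ).le
      · exact le_rfl
    · have := h.ext ρ
      cases ρ <;> simp at * <;> linarith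
  · intro h4
    have := mem_inner.1 h4 i (!σ)
    rw [h1, h.line] at this
    exact lt_irrefl _ this

theorem adjacent_inQ {c d : Cell} (h : T.Adjacent c d) :
    ∃ z i σ τ, InQ d.toRect z i σ τ ∧ InQ c.toRect z i (!σ) τ := by
  obtain ⟨hc, hd, hne, p, q, ⟨he, h1⟩, -, h2⟩ := h
  obtain ⟨-, -, ⟨hpq, hax, -⟩, -⟩ := he
  obtain ⟨i, τ, e1, e2⟩ := exists_dir hpq hax
  have key : ∀ c ∈ T.cells, segment ℝ p q ⊆ c.sides →
      ∃ ρ, InQ c.toRect p i (!ρ) τ ∧ co i p = c.sd i ρ := by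
    intro c hc hs
    have hp := mem_carrier.1 (hs (left_mem_segment _ _ _)).1
    have hq := mem_carrier.1 (hs (right_mem_segment _ _ _)).1
    have h3 : In1 c.toRect (!i) τ (co (!i) p) := by
      have := hp (!i) (!τ)
      simp only [sg_not] at this
      exact ⟨by linarith, e2.trans_le (hq (!i) τ)⟩
    have : ∃ ρ, co i p = c.sd i ρ := by
      by_contra! hρ
      have hst : ∀ ρ, sg ρ * co i p < sg ρ * c.sd i ρ := fun ρ =>
        lt_of_le_of_ne (hp i ρ) fun h => hρ ρ (sg_cancel h)
      obtain ⟨z, hz, h5, h6, h7⟩ := exists_inner_ahead (i := i) (τ := τ) (v := p) (c := c)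
        ⟨in1_of_strict hst true, h3⟩ ⟨in1_of_strict hst false, h3⟩ e2
      exact (hs ((seg_mem e1 e2.le).2 ⟨h5, h6.le, h7.le⟩)).2 hz
    obtain ⟨ρ, hρ⟩ := this
    refine ⟨ρ, ⟨?_, h3⟩, hρ⟩
    rw [hρ]
    simpa using (M.ndF hc).in1_sd i (!ρ)
  obtain ⟨ρ, h3, h4⟩ := key c hc h1
  obtain ⟨ρ', h5, h6⟩ := key d hd h2
  rcases Bool.eq_or_eq_not ρ' ρ with rfl | rfl
  · exact (hne (M.uniq hc hd h3 h5)).elim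
  · exact ⟨p, i, ρ, τ, by simpa using h5, h3⟩

end Frame

/-- A set of interior cells that contains with a cell all cells linked to it. -/
structure HMesh.Good (T : HMesh) (K : Set Cell) : Prop where
  closed : ∀ c ∈ K, ∀ d, T.Link c d → d ∈ K
  int : ∀ c ∈ K, T.IsInteriorCell c

theorem HMesh.Good.sub {T : HMesh} {K : Set Cell} (h : T.Good K) {c : Cell} (hc : c ∈ K) :
    c ∈ T.cells := (h.int c hc).1

namespace Frame

variable {T : HMesh} (M : Frame T.cells)

include M

/-! ### Walking along grid lines -/

theorem exists_double {v : ℝ × ℝ} (h : T.IsInteriorVertex v) (h' : ¬ T.IsCrossing v) :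
    ∃ B ∈ T.cells, ∃ j ρ, ∀ ρ', InQ B.toRect v j ρ' ρ := by
  obtain h | ⟨i, σ, τ, B, c, d, hp⟩ := M.crossing_or_tpat h
  · exact (h' h).elim
  · refine ⟨B, hp.hB, !i, σ, fun ρ' => ?_⟩
    rcases Bool.eq_or_eq_not ρ' τ with rfl | rfl
    · exact hp.B1.swap
    · exact hp.B2.swap

/-- The four cells at a point that is not a crossing vertex. -/
theorem local_cases {v : ℝ × ℝ} (hv : v ∈ M.Ω.inner) (hcr : ¬ T.IsCrossing v) {i σ τ : Bool}
    {c d c' d' : Cell} (hc : c ∈ T.cells) (hd : d ∈ T.cells) (hc' : c' ∈ T.cells)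
    (hd' : d' ∈ T.cells) (h1 : InQ c.toRect v i σ τ) (h2 : InQ d.toRect v i (!σ) τ)
    (h3 : InQ c'.toRect v i σ (!τ)) (h4 : InQ d'.toRect v i (!σ) (!τ)) (hne : c ≠ d) :
    T.Link c d ∨ (c' ≠ d' ∧ (c = c' ∨ T.Link c c') ∧ (d = d' ∨ T.Link d d')) := by
  by_cases e1 : c' = d'
  · subst e1
    left
    exact M.link_of_tpat (v := v) (i := !i) (σ := !τ) (τ := σ) (B := c') ⟨hc', hc, hd, h3.swap,
      h4.swap, by simpa using h1.swap, by simpa using h2.swap, hne⟩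
  right
  refine ⟨e1, ?_⟩
  by_cases e2 : c = c'
  · subst e2
    refine ⟨Or.inl rfl, ?_⟩
    by_cases e3 : d = d'
    · exact Or.inl e3
    · exact Or.inr <| M.link_of_tpat (v := v) (i := i) (σ := σ) (τ := τ) (B := c)
        ⟨hc, hd, hd', h1, h3, h2, h4, e3⟩
  by_cases e3 : d = d'
  · subst e3
    exact ⟨Or.inr <| M.link_of_tpat (v := v) (i := i) (σ := !σ) (τ := τ) (B := d)
        ⟨hd, hc, hc', h2, h4, by simpa using h1, by simpa using h3, e2⟩, Or.inl rfl⟩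
  -- Now any two neighbouring quadrants have different owners, so `v` is a vertex at which no cell
  -- owns two quadrants, that is, a crossing.
  exfalso
  have n1 : ¬ InQ c.toRect v i (!σ) τ := fun h => hne (M.uniq hc hd h h2)
  have n2 : ¬ InQ c.toRect v (!i) (!τ) σ := fun h =>
    e2 (M.uniq hc hc' (by simpa using h.swap) h3)
  have hvx : T.IsVertex v := ⟨c, hc, (mem_corners i).2
    ⟨⟨_, (line_of h1 n1).symm⟩, _, (line_of h1.swap n2).symm⟩⟩
  obtain ⟨B, hB, j, ρ, h⟩ := M.exists_double (M.interiorVertex_of_inner hvx hv) hcr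
  rcases Bool.eq_or_eq_not j i with rfl | rfl
  · rcases Bool.eq_or_eq_not ρ τ with rfl | rfl
    · exact hne ((M.uniq hc hB h1 (h _)).trans (M.uniq hd hB h2 (h _)).symm)
    · exact e1 ((M.uniq hc' hB h3 (h _)).trans (M.uniq hd' hB h4 (h _)).symm)
  · rcases Bool.eq_or_eq_not ρ σ with rfl | rfl
    · exact e2 ((M.uniq hc hB h1.swap (h _)).trans (M.uniq hc' hB h3.swap (h _)).symm)
    · exact e3 ((M.uniq hd hB h2.swap (h _)).trans (M.uniq hd' hB h4.swap (h _)).symm)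

/-- Follow the line ahead to the first point `v` where `c` or `d` ends. As `v` is no crossing,
`local_cases` says that `c` and `d` are linked there, or that the line goes on between cells `c'`
and `d'` that are equal or linked to `c` and `d`. In the latter case continue from `v`; the number
`n` bounds the number of cells that reach beyond the present point, and it drops. -/
theorem walk_aux {K : Set Cell} (hK : T.Good K) (i τ : Bool) (n : ℕ) : ∀ (z : ℝ × ℝ) (σ : Bool)
    (c d : Cell), {e ∈ T.cells | sg τ * co (!i) z < sg τ * e.sd (!i) τ}.ncard ≤ n →
    d ∈ T.cells → InQ c.toRect z i σ τ → InQ d.toRect z i (!σ) τ → c ≠ d →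
    (∀ u, co i u = co i z → sg τ * co (!i) z < sg τ * co (!i) u →
      segment ℝ z u ⊆ T.skeleton → ¬ T.IsCrossing u) → c ∈ K → d ∈ K := by
  induction n with
  | zero =>
    intro z σ c d hn hd h1 h2
    exfalso
    have hfin : {e ∈ T.cells | sg τ * co (!i) z < sg τ * e.sd (!i) τ}.Finite :=
      M.fin.subset fun e he => he.1
    have := (Set.ncard_eq_zero hfin).1 (Nat.le_zero.1 hn)
    exact Set.notMem_empty d (this ▸ ⟨hd, h2.2.2⟩)
  | succ n ih =>
    intro z σ c d hn hd h1 h2 hne hu hcK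
    have hcF := hK.sub hcK
    have hl := line_of h1 fun h => hne (M.uniq hcF hd h h2)
    obtain ⟨t, htz, htc, htd, hcd⟩ : ∃ t, sg τ * co (!i) z < sg τ * t ∧
        sg τ * t ≤ sg τ * c.sd (!i) τ ∧ sg τ * t ≤ sg τ * d.sd (!i) τ ∧
        (t = c.sd (!i) τ ∨ t = d.sd (!i) τ) := by
      rcases le_total (sg τ * c.sd (!i) τ) (sg τ * d.sd (!i) τ) with h | h
      · exact ⟨_, h1.2.2, le_rfl, h, Or.inl rfl⟩
      · exact ⟨_, h2.2.2, h, le_rfl, Or.inr rfl⟩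
    set v := pt i (co i z) t with hv
    have v1 : co i v = co i z := by simp [hv]
    have v2 : co (!i) v = t := by simp [hv]
    have hcΩ := M.inΩ c (M.sub hcF)
    have hdΩ := M.inΩ d (M.sub hd)
    have hvΩ : v ∈ M.Ω.inner := by
      rw [mem_inner, bool_forall i]
      refine ⟨fun ρ => ?_, fun ρ => ?_⟩
      · rw [v1]
        exact (hcΩ.in1 h1.1).strict (hdΩ.in1 h2.1) ρ
      · rw [v2]
        rcases Bool.eq_or_eq_not ρ τ with rfl | rfl
        -- The walk cannot run into the boundary, because `c` is an interior cell.
        · refine htc.trans_lt (lt_of_le_of_ne (hcΩ (!i) ρ) fun h => ?_)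
          exact (M.isInteriorCell_iff.1 (hK.int c hcK)).2 (!i) ρ (sg_cancel h)
        · have h3 := hcΩ (!i) (!τ)
          have h4 := h1.2.1
          simp only [sg_not] at h3 ⊢
          linarith
    have hzv : segment ℝ z v ⊆ T.skeleton := by
      intro w hw
      obtain ⟨w1, w2, w3⟩ := (seg_mem v1.symm (by rw [v2]; exact htz.le)).1 hw
      rw [v2] at w3
      simp only [HMesh.skeleton, Set.mem_iUnion, exists_prop]
      refine ⟨c, hcF, ?_, fun h => ?_⟩
      · rw [mem_carrier, bool_forall i]
        refine ⟨fun ρ => by rw [w1]; exact h1.1.le ρ, fun ρ => ?_⟩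
        rcases Bool.eq_or_eq_not ρ τ with rfl | rfl
        · exact w3.trans htc
        · have := h1.2.1
          simp only [sg_not]
          linarith
      · have := mem_inner.1 h i (!σ)
        rw [w1, hl] at this
        exact lt_irrefl _ this
    have hcr : ¬ T.IsCrossing v := hu v v1 (by rw [v2]; exact htz) hzv
    have back : ∀ (e : Cell) (ρ : Bool), InQ e.toRect z i ρ τ → sg τ * t ≤ sg τ * e.sd (!i) τ →
        InQ e.toRect v i ρ (!τ) := by
      intro e ρ he ht
      refine ⟨by rw [v1]; exact he.1, ?_⟩
      rw [v2]
      have := he.2.1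
      constructor <;> simp only [sg_not, Bool.not_not] <;> linarith
    obtain ⟨c', hc', h3⟩ := M.ex (inQ_of_mem_inner hvΩ i σ τ)
    obtain ⟨d', hd', h4⟩ := M.ex (inQ_of_mem_inner hvΩ i (!σ) τ)
    rcases M.local_cases hvΩ hcr hcF hd hc' hd' (back c σ h1 htc) (back d _ h2 htd)
      (by simpa using h3) (by simpa using h4) hne with h | ⟨hne', hcc, hdd⟩
    · exact hK.closed c hcK d h
    · have hc'K : c' ∈ K := by
        rcases hcc with rfl | h
        · exact hcK
        · exact hK.closed c hcK c' h
      have hd'K : d' ∈ K := by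
        refine ih v σ c' d' ?_ hd' h3 h4 hne' ?_ hc'K
        · refine Nat.le_of_lt_succ (lt_of_lt_of_le (Set.ncard_lt_ncard ?_
            (M.fin.subset fun e he => he.1)) hn)
          rw [v2]
          refine ⟨fun e he => ⟨he.1, htz.trans he.2⟩, fun hsub => ?_⟩
          rcases hcd with h | h
          · have := (hsub ⟨hcF, h1.2.2⟩).2
            rw [h] at this
            exact lt_irrefl _ this
          · have := (hsub ⟨hd, h2.2.2⟩).2
            rw [h] at this
            exact lt_irrefl _ this
        · intro u u1 u2 u3
          rw [v1] at u1
          rw [v2] at u2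
          refine hu u u1 (htz.trans u2) fun w hw => ?_
          obtain ⟨w1, w2, w3⟩ := (seg_mem u1.symm (htz.trans u2).le).1 hw
          rcases le_total (sg τ * co (!i) w) (sg τ * t) with h | h
          · exact hzv ((seg_mem v1.symm (by rw [v2]; exact htz.le)).2 ⟨w1, w2, by rwa [v2]⟩)
          · exact u3 ((seg_mem (v1.trans u1.symm) (by rw [v2]; exact u2.le)).2
              ⟨w1.trans v1.symm, by rwa [v2], w3⟩)
      rcases hdd with rfl | h
      · exact hd'K
      · exact hK.closed d' hd'K d h.symm

theorem walk {K : Set Cell} (hK : T.Good K) {i τ : Bool} {z : ℝ × ℝ} {σ : Bool}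
    {c d : Cell} (hd : d ∈ T.cells) (h1 : InQ c.toRect z i σ τ) (h2 : InQ d.toRect z i (!σ) τ)
    (hu : ∀ u, co i u = co i z → sg τ * co (!i) z < sg τ * co (!i) u →
      segment ℝ z u ⊆ T.skeleton → ¬ T.IsCrossing u) (hc : c ∈ K) : d ∈ K := by
  by_cases hne : c = d
  · rwa [← hne]
  · exact M.walk_aux hK i τ _ z σ c d le_rfl hd h1 h2 hne hu hc

theorem inner_of_good {K : Set Cell} (hK : T.Good K) {c : Cell} (hc : c ∈ K) {z : ℝ × ℝ}
    (hz : z ∈ c.carrier) : z ∈ M.Ω.inner := by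
  have := M.isInteriorCell_iff.1 (hK.int c hc)
  refine mem_inner.2 fun i σ => (mem_carrier.1 hz i σ).trans_lt ?_
  exact lt_of_le_of_ne (M.inΩ c (M.sub this.1) i σ) fun h => this.2 i σ (sg_cancel h)

/-- Off the CVR graph, a set of interior cells closed under links contains with one cell at a point
the cell on the other side of a line. -/
theorem good_flip {K : Set Cell} (hK : T.Good K) {z : ℝ × ℝ} (hz : z ∉ T.cvrLines) {i σ τ : Bool}
    {c d : Cell} (hc : c ∈ K) (hd : d ∈ T.cells) (h1 : InQ c.toRect z i σ τ)
    (h2 : InQ d.toRect z i (!σ) τ) : d ∈ K := by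
  by_cases hne : c = d
  · rwa [← hne]
  by_cases hu : ∃ u, co i u = co i z ∧ sg τ * co (!i) z < sg τ * co (!i) u ∧
      segment ℝ z u ⊆ T.skeleton ∧ T.IsCrossing u
  swap
  · push Not at hu
    exact M.walk hK hd h1 h2 hu hc
  obtain ⟨u, u1, u2, u3, u4⟩ := hu
  have hzΩ := M.inner_of_good hK hc h1.mem_carrier
  -- There is a crossing `u` ahead. Then neither `z` nor any point reachable backwards is a
  -- crossing, since otherwise `z` would lie on a segment of the graph.
  have hcr : ¬ T.IsCrossing z := fun h => hz ⟨z, u, h, u4,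
    ⟨by rintro rfl; exact lt_irrefl _ u2, axis_or i u1.symm, u3⟩, left_mem_segment _ _ _⟩
  have hu' : ∀ w, co i w = co i z → sg (!τ) * co (!i) z < sg (!τ) * co (!i) w →
      segment ℝ z w ⊆ T.skeleton → ¬ T.IsCrossing w := by
    intro w w1 w2 w3 w4
    simp only [sg_not] at w2
    have hlt : sg τ * co (!i) w < sg τ * co (!i) u := by linarith
    refine hz ⟨w, u, w4, u4, ⟨by rintro rfl; exact lt_irrefl _ hlt, axis_or i (w1.trans u1.symm),
      fun x hx => ?_⟩, (seg_mem (w1.trans u1.symm) hlt.le).2 ⟨w1.symm, by linarith, u2.le⟩⟩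
    obtain ⟨x1, x2, x3⟩ := (seg_mem (w1.trans u1.symm) hlt.le).1 hx
    rcases le_total (sg τ * co (!i) x) (sg τ * co (!i) z) with h | h
    · refine w3 ((seg_mem (τ := !τ) w1.symm (by simp only [sg_not]; linarith)).2
        ⟨x1.trans w1, ?_, ?_⟩) <;> simp only [sg_not] <;> linarith
    · exact u3 ((seg_mem u1.symm u2.le).2 ⟨x1.trans w1, h, x3⟩)
  -- So the walk is made backwards, between the cells `c'` and `d'` behind `z`; `local_cases` at `z`
  -- connects these to `c` and `d`.
  obtain ⟨c', hc', h3⟩ := M.ex (inQ_of_mem_inner hzΩ i σ (!τ))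
  obtain ⟨d', hd', h4⟩ := M.ex (inQ_of_mem_inner hzΩ i (!σ) (!τ))
  rcases M.local_cases hzΩ hcr (hK.sub hc) hd hc' hd' h1 h2 h3 h4 hne with h | ⟨-, hcc, hdd⟩
  · exact hK.closed c hc d h
  · have hc'K : c' ∈ K := by
      rcases hcc with rfl | h
      · exact hc
      · exact hK.closed c hc c' h
    have hd'K : d' ∈ K := M.walk hK hd' h3 h4 hu' hc'K
    rcases hdd with rfl | h
    · exact hd'K
    · exact hK.closed d' hd'K d h.symm

theorem good_all {K : Set Cell} (hK : T.Good K) {z : ℝ × ℝ} (hz : z ∉ T.cvrLines) {c : Cell}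
    (hc : c ∈ K) (hzc : z ∈ c.carrier) (σ τ : Bool) : ∃ d ∈ K, InQ d.toRect z false σ τ := by
  have hzΩ := M.inner_of_good hK hc hzc
  obtain ⟨ρ, ρ', h⟩ := exists_inQ (M.ndF (hK.sub hc)) hzc false
  have step : ∀ τ, (∃ d ∈ K, InQ d.toRect z false ρ τ) → ∃ d ∈ K, InQ d.toRect z false σ τ := by
    rintro τ ⟨d, hd, h⟩
    rcases Bool.eq_or_eq_not σ ρ with rfl | rfl
    · exact ⟨d, hd, h⟩
    · obtain ⟨e, he, h'⟩ := M.ex (inQ_of_mem_inner hzΩ false (!ρ) τ)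
      exact ⟨e, M.good_flip hK hz hd he h h', h'⟩
  obtain ⟨d, hd, h'⟩ := step ρ' ⟨c, hc, h⟩
  rcases Bool.eq_or_eq_not τ ρ' with rfl | rfl
  · exact ⟨d, hd, h'⟩
  · obtain ⟨e, he, h''⟩ := M.ex (inQ_of_mem_inner hzΩ true (!ρ') σ)
    exact ⟨e, M.good_flip hK hz hd he (i := true) h'.swap h'', h''.swap⟩

/-! ### Connected components of the complement of the CVR graph -/

omit M in
theorem continuous_co (i : Bool) : Continuous (co i) := by
  cases i
  · exact continuous_fst
  · exact continuous_snd

omit M in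
-- A point near `z` lies in some closed quadrant at `z`, and there in the cell of `K` that owns this
-- quadrant.
theorem tDomain_mem_nhds {K : Set Cell} {z : ℝ × ℝ}
    (h : ∀ σ τ, ∃ d ∈ K, InQ d.toRect z false σ τ) : tDomain K ∈ nhds z := by
  choose d hd hq using h
  have h1 : ∀ σ τ, ∀ᶠ w in nhds z, sg σ * co false w < sg σ * (d σ τ).sd false σ ∧
      sg τ * co true w < sg τ * (d σ τ).sd true τ := fun σ τ =>
    (((continuous_co false).const_mul (sg σ)).continuousAt.eventually_lt continuousAt_const
      (hq σ τ).1.2).and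
    (((continuous_co true).const_mul (sg τ)).continuousAt.eventually_lt continuousAt_const
      (hq σ τ).2.2)
  filter_upwards [h1 true true, h1 true false, h1 false true, h1 false false] with w a b c e
  have hex : ∀ i, ∃ σ, sg σ * co i z ≤ sg σ * co i w := by
    intro i
    rcases le_total (co i z) (co i w) with h | h
    · exact ⟨true, by simpa using h⟩
    · exact ⟨false, by simpa using h⟩
  have hall : ∀ σ τ, sg σ * co false w < sg σ * (d σ τ).sd false σ ∧
      sg τ * co true w < sg τ * (d σ τ).sd true τ := by
    intro σ τ; cases σ <;> cases τ <;> assumption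
  obtain ⟨σ, hσ⟩ := hex false
  obtain ⟨τ, hτ⟩ := hex true
  simp only [tDomain, Set.mem_iUnion, exists_prop]
  refine ⟨d σ τ, hd σ τ, InQ.mem_carrier (i := false) (σ := σ) (τ := τ) ⟨⟨?_, (hall σ τ).1⟩, ?_,
    (hall σ τ).2⟩⟩
  · exact (hq σ τ).1.1.trans hσ
  · exact (hq σ τ).2.1.trans hτ

omit M in
theorem isClosed_carrier (r : Rect) : IsClosed r.carrier := isClosed_Icc.prod isClosed_Icc

theorem isClosed_tDomain {K : Set Cell} (hK : K ⊆ T.cells) : IsClosed (tDomain K) :=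
  (M.fin.subset hK).isClosed_biUnion fun c _ => isClosed_carrier c.toRect

/-- Off the graph, `tDomain K` is closed and, by `good_all` and `tDomain_mem_nhds`, also open. A
connected set that meets it stays in it. -/
theorem component_subset {K : Set Cell} (hK : T.Good K) {z : ℝ × ℝ} (hz : z ∉ T.cvrLines)
    (hzK : z ∈ tDomain K) : connectedComponentIn T.cvrLinesᶜ z ⊆ tDomain K := by
  have hint : ∀ w ∈ T.cvrLinesᶜ, w ∈ tDomain K → w ∈ interior (tDomain K) := by
    intro w hw hwK
    simp only [tDomain, Set.mem_iUnion, exists_prop] at hwK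
    obtain ⟨c, hc, hwc⟩ := hwK
    exact mem_interior_iff_mem_nhds.2 (tDomain_mem_nhds (M.good_all hK hw hc hwc))
  refine (IsPreconnected.subset_left_of_subset_union isOpen_interior
    (M.isClosed_tDomain fun c hc => hK.sub hc).isOpen_compl ?_ ?_ ?_
    isPreconnected_connectedComponentIn).trans interior_subset
  · exact disjoint_compl_right.mono_left interior_subset
  · intro w hw
    by_cases h : w ∈ tDomain K
    · exact Or.inl (hint w (connectedComponentIn_subset _ _ hw) h)
    · exact Or.inr h
  · exact ⟨z, mem_connectedComponentIn hz, hint z hz hzK⟩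

omit M in
theorem cvrLines_subset_skeleton : T.cvrLines ⊆ T.skeleton := by
  rintro z ⟨p, q, -, -, h, hz⟩
  exact h.2.2 hz

theorem inner_subset_compl {c : Cell} (hc : c ∈ T.cells) : c.inner ⊆ T.cvrLinesᶜ :=
  fun _ hz h => M.not_skeleton_of_inner hc hz (cvrLines_subset_skeleton h)

omit M in
theorem convex_inner (r : Rect) : Convex ℝ r.inner := (convex_Ioo _ _).prod (convex_Ioo _ _)

omit M in
theorem closure_inner {r : Rect} (hr : r.Nondeg) : closure r.inner = r.carrier := by
  have h1 : r.x₀ < r.x₁ := hr false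
  have h2 : r.y₀ < r.y₁ := hr true
  rw [Rect.inner, closure_prod_eq, closure_Ioo h1.ne, closure_Ioo h2.ne]
  rfl

omit M in
theorem inner_nonempty {r : Rect} (hr : r.Nondeg) : r.inner.Nonempty := by
  have h1 : r.x₀ < r.x₁ := hr false
  have h2 : r.y₀ < r.y₁ := hr true
  exact (Set.nonempty_Ioo.2 h1).prod (Set.nonempty_Ioo.2 h2)

theorem inner_subset_component {c : Cell} (hc : c ∈ T.cells) {z : ℝ × ℝ} (hz : z ∈ c.carrier)
    (hz' : z ∉ T.cvrLines) : c.inner ⊆ connectedComponentIn T.cvrLinesᶜ z := by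
  have : IsPreconnected (insert z c.inner) :=
    (convex_inner c.toRect).isPreconnected.subset_closure (Set.subset_insert _ _) (by
      rw [closure_inner (M.ndF hc)]
      exact Set.insert_subset hz fun w hw =>
        mem_carrier.2 fun i σ => (mem_inner.1 hw i σ).le)
  exact (Set.subset_insert _ _).trans (this.subset_connectedComponentIn (Set.mem_insert _ _)
    (Set.insert_subset hz' (M.inner_subset_compl hc)))

/-- Next to a T-junction, the edge that ends there does not belong to the CVR graph. -/
theorem tpat_exists_common {v : ℝ × ℝ} {i σ τ : Bool} {B c d : Cell} (h : T.TPat v i σ τ B c d) :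
    ∃ z ∈ c.carrier, z ∈ d.carrier ∧ z ∉ T.cvrLines := by
  have hc2 := h.c1.1.2
  have hd2 := h.d1.1.2
  -- The point `z` is taken on the edge between `c` and `d` that ends at `v`, closer to `v` than the
  -- far sides of both cells; `s` is its signed coordinate.
  obtain ⟨s, hs, hs'⟩ := exists_between (lt_min hc2 hd2)
  rw [lt_min_iff] at hs'
  simp only [sg_not] at hs hs' hc2 hd2
  obtain ⟨t, rfl⟩ : ∃ t, s = -(sg σ * t) := ⟨-(sg σ * s), by
    rw [mul_neg, ← mul_assoc, sg_mul_sg]; ring⟩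
  obtain ⟨-, hcl, -⟩ := M.tpat_sides h
  obtain ⟨-, hdl, -⟩ := M.tpat_sides h.swap
  have inside : ∀ u, co (!i) u = co (!i) v → sg σ * co i u < sg σ * co i v →
      sg σ * t ≤ sg σ * co i u → ∀ ρ, InQ c.toRect u i ρ τ ∧ InQ d.toRect u i ρ (!τ) := by
    intro u u1 u2 u3 ρ
    have aux : ∀ e : Cell, e.sd i σ = co i v → -(sg σ * t) < -sg σ * e.sd i (!σ) →
        In1 e.toRect i ρ (co i u) := by
      intro e e1 e2
      refine in1_of_strict (fun ρ' => ?_) ρ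
      rcases Bool.eq_or_eq_not ρ' σ with rfl | rfl
      · rw [e1]; exact u2
      · simp only [sg_not]; linarith
    exact ⟨⟨aux c hcl hs'.1, by rw [u1]; exact h.c1.2⟩, ⟨aux d hdl hs'.2, by rw [u1]; exact h.d1.2⟩⟩
  set z := pt i t (co (!i) v) with hz
  have z1 : co i z = t := by simp [hz]
  have z2 : co (!i) z = co (!i) v := by simp [hz]
  have z0 : sg σ * co i z = sg σ * t := by rw [z1]
  have hzi := inside z z2 (by rw [z1]; linarith) (by rw [z1])
  refine ⟨z, (hzi true).1.mem_carrier, (hzi true).2.mem_carrier, ?_⟩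
  rintro ⟨p, q, hp, hq, ⟨hpq, hax, hsk⟩, hzpq⟩
  have cvx : ∀ u ∈ segment ℝ p q, segment ℝ z u ⊆ T.skeleton := fun u hu =>
    ((convex_segment p q).segment_subset hzpq hu).trans hsk
  -- a crossing vertex on the line through `z` and `v`, on the side of `v`
  have key : ∀ u ∈ segment ℝ p q, T.IsCrossing u → co (!i) u = co (!i) v →
      sg σ * t ≤ sg σ * co i u → False := by
    intro u hu hcr u1 u2
    rcases lt_trichotomy (sg σ * co i u) (sg σ * co i v) with hlt | heq | hgt
    · obtain ⟨e, he, hue⟩ := hcr.1.1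
      obtain ⟨ρ, ρ', h1, h2, h3⟩ := corner_mem (M.ndF he) hue i
      have h4 : InQ e.toRect u i (!ρ) ρ' := by
        rcases Bool.eq_or_eq_not ρ' τ with rfl | rfl
        · rw [M.uniq he h.hc h1 (inside u u1 hlt u2 ρ).1]; exact (inside u u1 hlt u2 (!ρ)).1
        · rw [M.uniq he h.hd h1 (inside u u1 hlt u2 ρ).2]; exact (inside u u1 hlt u2 (!ρ)).2
      have := h1.1.strict h4.1 (!ρ)
      rw [h2] at this
      exact lt_irrefl _ this
    · have : u = v := pt_ext i (sg_cancel heq) u1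
      subst this
      have := (M.tpat_isTJunction h).2.symm.trans hcr.2
      omega
    · have b : ∀ ρ, InQ B.toRect v (!i) ρ σ := by
        intro ρ
        rcases Bool.eq_or_eq_not ρ τ with rfl | rfl
        · exact h.B1.swap
        · exact h.B2.swap
      obtain ⟨w, hw, w1, w2, w3⟩ := exists_inner_ahead (b true) (b false) (t := co i u)
        (by simpa using hgt)
      rw [Bool.not_not] at w2 w3
      refine M.not_skeleton_of_inner h.hB hw (cvx u hu ?_)
      refine (seg_mem (i := !i) (τ := σ) (z2.trans u1.symm) ?_).2 ⟨w1.trans z2.symm, ?_, ?_⟩ <;>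
        rw [Bool.not_not] <;> linarith
  -- A segment of the graph through `z` transverse to this edge would enter the interior of `c` or
  -- `d`.
  have key2 : ∀ u ∈ segment ℝ p q, co i u = t → u = z := by
    intro u hu hut
    by_contra hne
    have hne' : co (!i) z ≠ co (!i) u := fun h' => hne (pt_ext i (by rw [hut, z1]) h'.symm)
    obtain ⟨ρ, hρ⟩ : ∃ ρ, sg ρ * co (!i) z < sg ρ * co (!i) u := by
      rcases lt_or_gt_of_ne hne' with h | h
      · exact ⟨true, by simpa using h⟩
      · exact ⟨false, by simpa using h⟩
    obtain ⟨e, he, h1⟩ : ∃ e ∈ T.cells, ∀ ρ', InQ e.toRect z i ρ' ρ := by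
      rcases Bool.eq_or_eq_not ρ τ with rfl | rfl
      · exact ⟨c, h.hc, fun ρ' => (hzi ρ').1⟩
      · exact ⟨d, h.hd, fun ρ' => (hzi ρ').2⟩
    obtain ⟨w, hw, w1, w2, w3⟩ := exists_inner_ahead (h1 true) (h1 false) hρ
    exact M.not_skeleton_of_inner he hw (cvx u hu ((seg_mem (by rw [z1, hut]) hρ.le).2
      ⟨w1, w2.le, w3.le⟩))
  obtain ⟨i', τ', e1, e2⟩ := exists_dir hpq hax
  obtain ⟨z3, z4, z5⟩ := (seg_mem e1 e2.le).1 hzpq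
  rcases Bool.eq_or_eq_not i' i with rfl | rfl
  · have hp' := key2 p (left_mem_segment _ _ _) (by rw [← z3, z1])
    have hq' := key2 q (right_mem_segment _ _ _) (by rw [← e1, ← z3, z1])
    exact hpq (hp'.trans hq'.symm)
  · rw [Bool.not_not, z1] at z4 z5
    rcases Bool.eq_or_eq_not τ' σ with rfl | rfl
    · exact key q (right_mem_segment _ _ _) hq (by rw [← e1, ← z3, z2]) z5
    · simp only [sg_not] at z4
      exact key p (left_mem_segment _ _ _) hp (by rw [← z3, z2]) (by linarith)

/-- The interiors of both cells are joined to the common point off the graph given by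
`tpat_exists_common`. -/
theorem link_component {c d : Cell} (h : T.Link c d) {z : ℝ × ℝ}
    (hc : c.inner ⊆ connectedComponentIn T.cvrLinesᶜ z) :
    d.inner ⊆ connectedComponentIn T.cvrLinesᶜ z := by
  by_cases hne : c = d
  · rwa [← hne]
  obtain ⟨v, i, σ, τ, B, hp⟩ := M.link_tpat h hne
  obtain ⟨w, hwc, hwd, hw⟩ := M.tpat_exists_common hp
  obtain ⟨x, hx⟩ := inner_nonempty (M.ndF h.1)
  have h1 := connectedComponentIn_eq (hc hx)
  have h2 := connectedComponentIn_eq (M.inner_subset_component h.1 hwc hw hx)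
  rw [h1, ← h2]
  exact M.inner_subset_component h.2.1 hwd hw

/-- The cells that can be reached from `c` by links. -/
def _root_.TMesh.HMesh.linkClass (T : HMesh) (c : Cell) : Set Cell :=
  {d | Relation.ReflTransGen T.Link c d}

omit M in
theorem linkClass_sub {c d : Cell} (hc : c ∈ T.cells) (h : d ∈ T.linkClass c) : d ∈ T.cells := by
  rcases Relation.ReflTransGen.cases_tail h with rfl | ⟨e, -, h⟩
  · exact hc
  · exact h.2.1

theorem linkClass_inner {c d : Cell} (h : d ∈ T.linkClass c) {z : ℝ × ℝ}
    (hc : c.inner ⊆ connectedComponentIn T.cvrLinesᶜ z) :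
    d.inner ⊆ connectedComponentIn T.cvrLinesᶜ z := by
  induction h with
  | refl => exact hc
  | tail _ h ih => exact M.link_component h ih

theorem cvrLines_subset_inner : T.cvrLines ⊆ M.Ω.inner := by
  rintro z ⟨p, q, hp, hq, -, hz⟩
  exact (convex_inner _).segment_subset (M.inner_of_interiorVertex hp.1)
    (M.inner_of_interiorVertex hq.1) hz

/-- The graph lies in the open interior of `Ω`, so the half-line from `z` pointing away from `Ω`
misses it. -/
theorem unbounded_of_outside {z : ℝ × ℝ} {i σ : Bool} (h : sg σ * M.Ω.sd i σ ≤ sg σ * co i z) :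
    z ∉ T.cvrLines ∧ ¬ Bornology.IsBounded (connectedComponentIn T.cvrLinesᶜ z) := by
  have hout : ∀ w, sg σ * co i z ≤ sg σ * co i w → w ∉ T.cvrLines := fun w hw hw' =>
    absurd (mem_inner.1 (M.cvrLines_subset_inner hw') i σ) (by linarith)
  refine ⟨hout z le_rfl, fun hb => ?_⟩
  let g : ℝ → ℝ × ℝ := fun s => pt i (co i z + sg σ * s) (co (!i) z)
  have hg : Continuous g := by
    have : Continuous fun s : ℝ => co i z + sg σ * s := by fun_prop
    cases i
    · exact this.prodMk continuous_const
    · exact continuous_const.prodMk this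
  have hpre : IsPreconnected (g '' Set.Ici 0) :=
    isPreconnected_Ici.image g hg.continuousOn
  have hsub : g '' Set.Ici 0 ⊆ connectedComponentIn T.cvrLinesᶜ z := by
    refine hpre.subset_connectedComponentIn ⟨0, Set.self_mem_Ici, ?_⟩ ?_
    · exact pt_ext i (by simp [g]) (by simp [g])
    · rintro _ ⟨s, hs, rfl⟩
      refine hout _ ?_
      simp only [g, co_pt, mul_add, ← mul_assoc, sg_mul_sg, one_mul]
      linarith [Set.mem_Ici.1 hs]
  obtain ⟨R, hR⟩ := (hb.subset hsub).exists_norm_le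
  have hco : ∀ w : ℝ × ℝ, |co i w| ≤ ‖w‖ := by
    intro w
    cases i
    · exact norm_fst_le w
    · exact norm_snd_le w
  have hR0 : 0 ≤ R := (norm_nonneg _).trans (hR (g 0) ⟨0, Set.self_mem_Ici, rfl⟩)
  have h1 := (hco _).trans (hR (g (R + |co i z| + 1)) ⟨_, Set.mem_Ici.2 (by positivity), rfl⟩)
  simp only [g, co_pt] at h1
  have h2 := abs_nonneg (co i z)
  have h3 := neg_abs_le (co i z)
  have h4 := le_abs_self (co i z)
  have h5 := abs_le.1 h1
  cases σ <;> simp at h5 <;> linarith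

theorem unbounded_of_not_interior {c : Cell} (hc : c ∈ T.cells) (h : ¬ T.IsInteriorCell c)
    {z : ℝ × ℝ} (hz : c.inner ⊆ connectedComponentIn T.cvrLinesᶜ z) :
    ¬ Bornology.IsBounded (connectedComponentIn T.cvrLinesᶜ z) := by
  rw [M.isInteriorCell_iff] at h
  push Not at h
  obtain ⟨i, σ, hs⟩ := h hc
  set w := pt i (c.sd i σ) (c.sd (!i) false) with hw
  obtain ⟨h1, h2⟩ := M.unbounded_of_outside (z := w) (i := i) (σ := σ) (by simp [hw, hs])
  have hwc : w ∈ c.carrier := by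
    have := ((M.ndF hc).inQ_corner i (!σ) true).mem_carrier
    simpa [hw] using this
  have h3 := M.inner_subset_component hc hwc h1
  obtain ⟨x, hx⟩ := inner_nonempty (M.ndF hc)
  rwa [connectedComponentIn_eq (hz hx), ← connectedComponentIn_eq (h3 hx)]

/-- The component contains the interiors of all cells linked to one of its cells. A cell at the
boundary among them would make it unbounded. -/
theorem gCell_class {F : Set (ℝ × ℝ)} (hF : T.IsGCell F) :
    ∃ c ∈ T.cells, T.Good (T.linkClass c) ∧ c.inner ⊆ F := by
  obtain ⟨⟨z, hz, rfl⟩, hb⟩ := hF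
  have hzΩ : z ∈ M.Ω.carrier := by
    rw [mem_carrier]
    intro i σ
    by_contra! h
    exact (M.unbounded_of_outside h.le).2 hb
  obtain ⟨σ, τ, h⟩ := exists_inQ M.ndΩ hzΩ false
  obtain ⟨c, hc, h⟩ := M.ex h
  have hin := M.inner_subset_component hc h.mem_carrier hz
  refine ⟨c, hc, ⟨fun d hd e he => Relation.ReflTransGen.tail hd he, fun d hd => ?_⟩, hin⟩
  by_contra hd'
  exact M.unbounded_of_not_interior (linkClass_sub hc hd) hd' (M.linkClass_inner hd hin) hb

/-- The component lies in the closed domain of the class by `component_subset` and contains the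
interior of each cell of the class, which gives both inclusions for its closure. -/
theorem good_gCell {c : Cell} (hc : c ∈ T.cells) (hK : T.Good (T.linkClass c))
    {F : Set (ℝ × ℝ)} (hF : ∃ z ∈ T.cvrLinesᶜ, F = connectedComponentIn T.cvrLinesᶜ z)
    (hcF : c.inner ⊆ F) : T.IsGCell F ∧ closure F = tDomain (T.linkClass c) := by
  have hF' := hF
  obtain ⟨z, hz, rfl⟩ := hF
  have hsub : connectedComponentIn T.cvrLinesᶜ z ⊆ tDomain (T.linkClass c) := by
    obtain ⟨x, hx⟩ := inner_nonempty (M.ndF hc)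
    rw [connectedComponentIn_eq (hcF hx)]
    refine M.component_subset hK (M.inner_subset_compl hc hx) ?_
    simp only [tDomain, Set.mem_iUnion, exists_prop]
    exact ⟨c, Relation.ReflTransGen.refl, mem_carrier.2 fun i σ => (mem_inner.1 hx i σ).le⟩
  have hcl := M.isClosed_tDomain (fun d hd => linkClass_sub hc hd : T.linkClass c ⊆ T.cells)
  refine ⟨⟨hF', ?_⟩, (closure_minimal hsub hcl).antisymm ?_⟩
  · refine Bornology.IsBounded.subset ?_ hsub
    rw [tDomain, Bornology.isBounded_biUnion (M.fin.subset fun d hd => linkClass_sub hc hd)]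
    intro d _
    exact (Metric.isBounded_Icc _ _).prod (Metric.isBounded_Icc _ _)
  · simp only [tDomain, Set.iUnion_subset_iff]
    intro d hd
    rw [← closure_inner (M.ndF (linkClass_sub hc hd))]
    exact closure_mono (M.linkClass_inner hd hcF)

end Frame

namespace Frame

variable {T : HMesh} (M : Frame T.cells)

include M

/-! ### P-cells, T-connections and g-cells -/

omit M in
theorem gCell_eq {F F' : Set (ℝ × ℝ)} (hF : T.IsGCell F) (hF' : T.IsGCell F') {z : ℝ × ℝ}
    (h : z ∈ F) (h' : z ∈ F') : F = F' := by
  obtain ⟨⟨w, -, rfl⟩, -⟩ := hF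
  obtain ⟨⟨w', -, rfl⟩, -⟩ := hF'
  rw [connectedComponentIn_eq h, connectedComponentIn_eq h']

theorem subset_of_tDomain_subset {K K' : Set Cell} (hK : K ⊆ T.cells) (hK' : K' ⊆ T.cells)
    (h : tDomain K ⊆ tDomain K') : K ⊆ K' := by
  intro c hc
  obtain ⟨z, hz⟩ := inner_nonempty (M.ndF (hK hc))
  have hzK : z ∈ tDomain K := by
    simp only [tDomain, Set.mem_iUnion, exists_prop]
    exact ⟨c, hc, mem_carrier.2 fun i σ => (mem_inner.1 hz i σ).le⟩
  have := h hzK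
  simp only [tDomain, Set.mem_iUnion, exists_prop] at this
  obtain ⟨d, hd, hzd⟩ := this
  obtain ⟨σ, τ, hq⟩ := exists_inQ (M.ndF (hK' hd)) hzd false
  rwa [M.uniq (hK hc) (hK' hd) (inQ_of_mem_inner hz _ _ _) hq]

theorem eq_of_tDomain_eq {K K' : Set Cell} (hK : K ⊆ T.cells) (hK' : K' ⊆ T.cells)
    (h : tDomain K = tDomain K') : K = K' :=
  (M.subset_of_tDomain_subset hK hK' h.subset).antisymm
    (M.subset_of_tDomain_subset hK' hK h.symm.subset)

theorem interior_corner {c : Cell} (hc : T.IsInteriorCell c) {v : ℝ × ℝ} (hv : v ∈ c.corners) :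
    T.IsCrossing v ∨ T.IsTJunction v := by
  have hcar : v ∈ c.carrier := by
    obtain ⟨σ, τ, h, -⟩ := corner_mem (M.ndF hc.1) hv false
    exact h.mem_carrier
  have hin : v ∈ M.Ω.inner := by
    have := M.isInteriorCell_iff.1 hc
    refine mem_inner.2 fun i σ => (mem_carrier.1 hcar i σ).trans_lt ?_
    exact lt_of_le_of_ne (M.inΩ c (M.sub this.1) i σ) fun h => this.2 i σ (sg_cancel h)
  rcases M.crossing_or_tpat (M.interiorVertex_of_inner ⟨c, hc.1, hv⟩ hin) with h | ⟨_, _, _, _, _, _, h⟩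
  · exact Or.inl h
  · exact Or.inr (M.tpat_isTJunction h)

omit M in
theorem not_crossing_of_tJunction {v : ℝ × ℝ} (h : T.IsTJunction v) : ¬ T.IsCrossing v := fun h' => by
  have := h.2.symm.trans h'.2
  omega

theorem pCell_or_tCell {c : Cell} (hc : T.IsInteriorCell c) : T.IsPCell c ∨ T.IsTCell c := by
  by_cases h : ∀ v ∈ c.corners, T.IsCrossing v
  · exact Or.inl ⟨hc, h⟩
  · push Not at h
    obtain ⟨v, hv, h⟩ := h
    exact Or.inr ⟨hc, v, hv, (M.interior_corner hc hv).resolve_left h⟩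

omit M in
theorem not_tCell_of_pCell {c : Cell} (hc : T.IsPCell c) : ¬ T.IsTCell c := by
  rintro ⟨-, v, hv, h⟩
  exact not_crossing_of_tJunction h (hc.2 v hv)

omit M in
theorem linkClass_pCell {c : Cell} (hc : T.IsPCell c) : T.linkClass c = {c} := by
  ext d
  constructor
  · intro h
    rcases Relation.ReflTransGen.cases_head h with rfl | ⟨e, ⟨-, -, v, hv, ht⟩, -⟩
    · rfl
    · exact (not_crossing_of_tJunction ht (hc.2 v hv.1)).elim
  · rintro rfl
    exact Relation.ReflTransGen.refl

omit M in
theorem good_pCell {c : Cell} (hc : T.IsPCell c) : T.Good (T.linkClass c) := by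
  refine ⟨fun d hd e he => Relation.ReflTransGen.tail hd he, fun d hd => ?_⟩
  rw [linkClass_pCell hc] at hd
  rw [Set.mem_singleton_iff.1 hd]
  exact hc.1

omit M in
-- Links do not require interior cells, T-connectedness does. In a class that consists of interior
-- cells, linked cells have a T-junction as a corner, hence are T-cells, and the two relations
-- generate the same class.
theorem linkClass_eq {c : Cell} (hK : T.Good (T.linkClass c)) :
    T.linkClass c = {d | Relation.ReflTransGen T.TConnected c d} := by
  ext d
  constructor
  · intro h
    suffices Relation.ReflTransGen T.TConnected c d ∧ d ∈ T.linkClass c from this.1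
    induction h with
    | refl => exact ⟨.refl, .refl⟩
    | @tail d e _ h ih =>
      have he : e ∈ T.linkClass c := hK.closed _ ih.2 _ h
      obtain ⟨-, -, v, hv, ht⟩ := h
      exact ⟨ih.1.tail ⟨⟨hK.int d ih.2, v, hv.1, ht⟩, ⟨hK.int e he, v, hv.2, ht⟩, v, hv, ht⟩, he⟩
  · intro h
    induction h with
    | refl => exact .refl
    | tail _ h ih => exact ih.tail ⟨h.1.1.1, h.2.1.1.1, h.2.2⟩

omit M in
theorem isTConnection_linkClass {c : Cell} (hc : T.IsTCell c) (hK : T.Good (T.linkClass c)) :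
    T.IsTConnection (T.linkClass c) := ⟨c, hc, linkClass_eq hK⟩

omit M in
theorem tConnection_tCell {K : Set Cell} (hK : T.IsTConnection K) {c : Cell} (hc : c ∈ K) :
    T.IsTCell c := by
  obtain ⟨c₀, h₀, rfl⟩ := hK
  rcases Relation.ReflTransGen.cases_tail hc with rfl | ⟨e, -, h⟩
  · exact h₀
  · exact h.2.1

omit M in
theorem tConnection_sub {K : Set Cell} (hK : T.IsTConnection K) : K ⊆ T.cells := fun _ hc =>
  (tConnection_tCell hK hc).1.1

omit M in
theorem tDomain_singleton (c : Cell) : tDomain {c} = c.carrier := by simp [tDomain]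

theorem exists_gCell {c : Cell} (hc : c ∈ T.cells) (hK : T.Good (T.linkClass c)) :
    ∃ F, T.IsGCell F ∧ closure F = tDomain (T.linkClass c) ∧ c.inner ⊆ F := by
  obtain ⟨z, hz⟩ := inner_nonempty (M.ndF hc)
  have hz' := M.inner_subset_compl hc hz
  have h := M.inner_subset_component hc
    (mem_carrier.2 fun i σ => (mem_inner.1 hz i σ).le : z ∈ c.carrier) hz'
  obtain ⟨h1, h2⟩ := M.good_gCell hc hK ⟨z, hz', rfl⟩ h
  exact ⟨_, h1, h2, h⟩

omit M in
theorem isOpen_inner (r : Rect) : IsOpen r.inner := isOpen_Ioo.prod isOpen_Ioo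

theorem pGCell_inner {c : Cell} {F : Set (ℝ × ℝ)} (h : T.IsPGCell c F) : ∃ z ∈ c.inner, z ∈ F := by
  obtain ⟨z, hz⟩ := inner_nonempty (M.ndF h.1.1.1)
  have : z ∈ closure F := by
    rw [h.2.2]
    exact mem_carrier.2 fun i σ => (mem_inner.1 hz i σ).le
  exact mem_closure_iff.1 this _ (isOpen_inner _) hz

theorem existsUnique_pGCell {c : Cell} (hc : T.IsPCell c) : ∃! F, T.IsPGCell c F := by
  obtain ⟨F, hF, hcl, hin⟩ := M.exists_gCell hc.1.1 (good_pCell hc)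
  rw [linkClass_pCell hc, tDomain_singleton] at hcl
  refine ⟨F, ⟨hc, hF, hcl⟩, fun F' hF' => ?_⟩
  obtain ⟨z, hz, hz'⟩ := M.pGCell_inner hF'
  exact gCell_eq hF'.2.1 hF hz' (hin hz)

theorem pGCell_unique {c c' : Cell} {F : Set (ℝ × ℝ)} (h : T.IsPGCell c F) (h' : T.IsPGCell c' F) :
    c = c' := by
  have := M.eq_of_tDomain_eq (K := {c}) (K' := {c'}) (by simpa using h.1.1.1)
    (by simpa using h'.1.1.1) (by rw [tDomain_singleton, tDomain_singleton, ← h.2.2, ← h'.2.2])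
  simpa using this

theorem tGCell_unique {K K' : Set Cell} {F : Set (ℝ × ℝ)} (h : T.IsTGCell K F)
    (h' : T.IsTGCell K' F) : K = K' :=
  M.eq_of_tDomain_eq (tConnection_sub h.1) (tConnection_sub h'.1) (by rw [← h.2.2, ← h'.2.2])

theorem not_pGCell_of_tGCell {c : Cell} {K : Set Cell} {F : Set (ℝ × ℝ)} (h : T.IsPGCell c F)
    (h' : T.IsTGCell K F) : False := by
  have hK := M.eq_of_tDomain_eq (K := {c}) (K' := K) (by simpa using h.1.1.1)
    (tConnection_sub h'.1) (by rw [tDomain_singleton, ← h.2.2, ← h'.2.2])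
  exact not_tCell_of_pCell h.1 (tConnection_tCell h'.1 (hK ▸ rfl))

theorem gCell_cases {F : Set (ℝ × ℝ)} (hF : T.IsGCell F) :
    (∃ c, T.IsPGCell c F) ∨ ∃ K, T.IsTGCell K F := by
  obtain ⟨c, hc, hK, hin⟩ := M.gCell_class hF
  have hcl := (M.good_gCell hc hK hF.1 hin).2
  rcases M.pCell_or_tCell (hK.int c .refl) with h | h
  · rw [linkClass_pCell h, tDomain_singleton] at hcl
    exact Or.inl ⟨c, h, hF, hcl⟩
  · exact Or.inr ⟨_, isTConnection_linkClass h hK, hF, hcl⟩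

theorem gCell_xor {F : Set (ℝ × ℝ)} (hF : T.IsGCell F) :
    Xor (∃! c, T.IsPGCell c F) (∃! K, T.IsTGCell K F) := by
  rcases M.gCell_cases hF with ⟨c, h⟩ | ⟨K, h⟩
  · exact Or.inl ⟨⟨c, h, fun c' h' => M.pGCell_unique h' h⟩,
      fun ⟨K, hK, _⟩ => M.not_pGCell_of_tGCell h hK⟩
  · exact Or.inr ⟨⟨K, h, fun K' h' => M.tGCell_unique h' h⟩,
      fun ⟨c, hc, _⟩ => M.not_pGCell_of_tGCell hc h⟩

end Frame

/-! ### Quadratic polynomials and their polar forms -/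

/-- `h` is a quadratic polynomial function. -/
def Quad (h : ℝ → ℝ) : Prop := ∃ a b c : ℝ, ∀ x, h x = a + b * x + c * x ^ 2

theorem Quad.add {g h : ℝ → ℝ} (hg : Quad g) (hh : Quad h) : Quad fun x => g x + h x := by
  obtain ⟨a, b, c, e⟩ := hg
  obtain ⟨a', b', c', e'⟩ := hh
  exact ⟨a + a', b + b', c + c', fun x => by simp only [e, e']; ring⟩

theorem Quad.const_mul {h : ℝ → ℝ} (hh : Quad h) (r : ℝ) : Quad fun x => r * h x := by
  obtain ⟨a, b, c, e⟩ := hh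
  exact ⟨r * a, r * b, r * c, fun x => by simp only [e]; ring⟩

theorem Quad.sub {g h : ℝ → ℝ} (hg : Quad g) (hh : Quad h) : Quad fun x => g x - h x := by
  obtain ⟨a, b, c, e⟩ := hg
  obtain ⟨a', b', c', e'⟩ := hh
  exact ⟨a - a', b - b', c - c', fun x => by simp only [e, e']; ring⟩

theorem Quad.eq_zero {h : ℝ → ℝ} (hh : Quad h) {u v : ℝ} (huv : u < v)
    (h0 : ∀ x ∈ Set.Icc u v, h x = 0) (x : ℝ) : h x = 0 := by
  obtain ⟨a, b, c, e⟩ := hh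
  have h1 := h0 u ⟨le_rfl, huv.le⟩
  have h2 := h0 v ⟨huv.le, le_rfl⟩
  have h3 := h0 ((u + v) / 2) ⟨by linarith, by linarith⟩
  rw [e] at h1 h2 h3 ⊢
  have hne : v - u ≠ 0 := by linarith
  have hc : c = 0 := by
    have : c * (v - u) ^ 2 = 0 := by linear_combination 2 * h1 + 2 * h2 - 4 * h3
    simpa [hne] using this
  subst hc
  have hb : b = 0 := by
    have : b * (v - u) = 0 := by linear_combination h2 - h1
    simpa [hne] using this
  subst hb
  linear_combination h1

/-- The polar form of a quadratic polynomial function. -/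
def av (s t : ℝ) (h : ℝ → ℝ) : ℝ := 2 * h ((s + t) / 2) - (h s + h t) / 2

theorem av_comm (s t : ℝ) (h : ℝ → ℝ) : av s t h = av t s h := by
  simp only [av, add_comm]

theorem av_self (s : ℝ) (h : ℝ → ℝ) : av s s h = h s := by
  have : (s + s) / 2 = s := by ring
  simp only [av, this]
  ring

theorem av_eq {h : ℝ → ℝ} {a b c : ℝ} (e : ∀ x, h x = a + b * x + c * x ^ 2) (s t : ℝ) :
    av s t h = a + b * (s + t) / 2 + c * s * t := by
  simp only [av, e]; ring

/-- For fixed `s` the polar form is affine in the other argument, so two zeros suffice. -/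
theorem av_zero_of_two {h : ℝ → ℝ} (hh : Quad h) {s u v : ℝ} (huv : u ≠ v) (h1 : av s u h = 0)
    (h2 : av s v h = 0) (t : ℝ) : av s t h = 0 := by
  obtain ⟨a, b, c, e⟩ := hh
  rw [av_eq e] at *
  have h3 : b / 2 + c * s = 0 := by
    have : (b / 2 + c * s) * (u - v) = 0 := by linear_combination h1 - h2
    simpa [sub_ne_zero.2 huv] using this
  linear_combination h1 + (t - u) * h3

/-- The value `h x` is the polar form at `(x, x)`, and the affine function `av x ·` vanishes at `u`
and `v`. -/
theorem quad_zero_of_av {h : ℝ → ℝ} (hh : Quad h) {u v : ℝ} (huv : u ≠ v)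
    (h1 : ∀ t, av u t h = 0) (h2 : ∀ t, av v t h = 0) (x : ℝ) : h x = 0 := by
  rw [← av_self x h]
  refine av_zero_of_two hh huv ?_ ?_ x
  · rw [av_comm]; exact h1 x
  · rw [av_comm]; exact h2 x

theorem quad_av {p : ℝ → ℝ → ℝ} (hp : ∀ y, Quad fun x => p x y) (s t : ℝ) :
    Quad fun x => av s t fun y => p x y := by
  have := (((hp ((s + t) / 2)).const_mul 2).sub (((hp s).add (hp t)).const_mul (1 / 2)))
  convert this using 2 with x
  simp only [av]; ring

theorem av_swap (p : ℝ → ℝ → ℝ) (s t u v : ℝ) :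
    av s t (fun x => av u v fun y => p x y) = av u v fun y => av s t fun x => p x y := by
  simp only [av]; ring

theorem av_zero (s t : ℝ) {h : ℝ → ℝ} (hh : ∀ x, h x = 0) : av s t h = 0 := by simp [av, hh]

theorem quad_line {p : ℝ × ℝ → ℝ} (hp : p ∈ biPoly 2 2) (i : Bool) (b : ℝ) :
    Quad fun s => p (pt i s b) := by
  have hpow : ∀ k ≤ 2, Quad fun s => s ^ k := by
    intro k hk
    interval_cases k
    · exact ⟨1, 0, 0, fun x => by ring⟩
    · exact ⟨0, 1, 0, fun x => by ring⟩
    · exact ⟨0, 0, 1, fun x => by ring⟩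
  induction hp using Submodule.span_induction with
  | mem p hp =>
    obtain ⟨k, l, hk, hl, rfl⟩ := hp
    cases i
    · have := (hpow k hk).const_mul (b ^ l)
      convert this using 2 with s
      simp [pt, mul_comm]
    · have := (hpow l hl).const_mul (b ^ k)
      exact this
  | zero => exact ⟨0, 0, 0, fun x => by simp⟩
  | add p q _ _ hp hq => exact hp.add hq
  | smul r p _ hp => exact hp.const_mul r

/-- The polar form of a biquadratic polynomial at the sides of `D`. -/
def polar (D : Rect) (p : ℝ × ℝ → ℝ) : ℝ :=
  av (D.sd false false) (D.sd false true) fun s => av (D.sd true false) (D.sd true true) fun t =>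
    p (s, t)

theorem polar_eq (D : Rect) (p : ℝ × ℝ → ℝ) (i σ τ : Bool) :
    polar D p = av (D.sd i σ) (D.sd i (!σ)) fun s => av (D.sd (!i) τ) (D.sd (!i) (!τ)) fun t =>
      p (pt i s t) := by
  have h : ∀ i σ τ, (av (D.sd i σ) (D.sd i (!σ)) fun s => av (D.sd (!i) τ) (D.sd (!i) (!τ)) fun t =>
      p (pt i s t)) = av (D.sd i false) (D.sd i true) fun s => av (D.sd (!i) false) (D.sd (!i) true)
        fun t => p (pt i s t) := by
    intro i σ τ
    have hs : ∀ (j ρ : Bool) (h : ℝ → ℝ), av (D.sd j ρ) (D.sd j (!ρ)) h =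
        av (D.sd j false) (D.sd j true) h := by
      intro j ρ h
      cases ρ
      · rfl
      · exact av_comm _ _ _
    simp only [hs]
  rw [h]
  cases i
  · rfl
  · rw [av_swap (fun s t => p (pt true s t))]
    rfl

theorem polar_add (D : Rect) (p q : ℝ × ℝ → ℝ) : polar D (p + q) = polar D p + polar D q := by
  simp only [polar, av, Pi.add_apply]; ring

theorem polar_smul (D : Rect) (r : ℝ) (p : ℝ × ℝ → ℝ) : polar D (r • p) = r * polar D p := by
  simp only [polar, av, Pi.smul_apply, smul_eq_mul]; ring

theorem polar_zero (D : Rect) : polar D 0 = 0 := by simp [polar, av]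

/-! ### Bézier ordinates -/

theorem bernstein_two (t : ℝ) : (bernsteinPolynomial ℝ 2 0).eval t = (1 - t) ^ 2 ∧
    (bernsteinPolynomial ℝ 2 1).eval t = 2 * t * (1 - t) ∧
    (bernsteinPolynomial ℝ 2 2).eval t = t ^ 2 := by
  refine ⟨?_, ?_, ?_⟩ <;> simp [bernsteinPolynomial]

theorem exists_bernstein {a b : ℝ} (hab : a < b) {k : ℕ} (hk : k ≤ 2) : ∃ β : Fin 3 → ℝ, ∀ x : ℝ,
    x ^ k = ∑ j : Fin 3, β j * (bernsteinPolynomial ℝ 2 j).eval ((x - a) / (b - a)) := by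
  have hne : b - a ≠ 0 := by linarith
  have key : ∀ x : ℝ, ∃ t, (x - a) / (b - a) = t ∧ x = a + (b - a) * t := fun x =>
    ⟨_, rfl, by field_simp; ring⟩
  interval_cases k
  -- In all three cases the coefficients are the polar form of `x ^ k` at `(a, a)`, `(a, b)` and
  -- `(b, b)`.
  · refine ⟨![1, 1, 1], fun x => ?_⟩
    obtain ⟨t, ht, hx⟩ := key x
    obtain ⟨h0, h1, h2⟩ := bernstein_two t
    rw [ht]
    simp [Fin.sum_univ_three, h0, h1, h2]
    ring
  · refine ⟨![a, (a + b) / 2, b], fun x => ?_⟩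
    obtain ⟨t, ht, hx⟩ := key x
    obtain ⟨h0, h1, h2⟩ := bernstein_two t
    rw [ht]
    simp [Fin.sum_univ_three, h0, h1, h2]
    rw [hx]
    ring
  · refine ⟨![a ^ 2, a * b, b ^ 2], fun x => ?_⟩
    obtain ⟨t, ht, hx⟩ := key x
    obtain ⟨h0, h1, h2⟩ := bernstein_two t
    rw [ht]
    simp [Fin.sum_univ_three, h0, h1, h2]
    rw [hx]
    ring

theorem exists_bezierNet {p : ℝ × ℝ → ℝ} (hp : p ∈ biPoly 2 2) {D : Rect} (hD : D.Nondeg) :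
    ∃ b, IsBezierNet p D b := by
  induction hp using Submodule.span_induction with
  | mem p hp =>
    obtain ⟨k, l, hk, hl, rfl⟩ := hp
    obtain ⟨β, hβ⟩ := exists_bernstein (show D.x₀ < D.x₁ from hD false) hk
    obtain ⟨γ, hγ⟩ := exists_bernstein (show D.y₀ < D.y₁ from hD true) hl
    refine ⟨fun j k => β j * γ k, fun z => ?_⟩
    simp only
    rw [hβ, hγ, Finset.sum_mul_sum]
    refine Finset.sum_congr rfl fun j _ => Finset.sum_congr rfl fun k _ => ?_
    ring
  | zero => exact ⟨0, fun z => by simp⟩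
  | add p q _ _ hp hq =>
    obtain ⟨b, hb⟩ := hp
    obtain ⟨b', hb'⟩ := hq
    refine ⟨b + b', fun z => ?_⟩
    simp only [Pi.add_apply, hb z, hb' z, ← Finset.sum_add_distrib]
    refine Finset.sum_congr rfl fun j _ => Finset.sum_congr rfl fun k _ => ?_
    ring
  | smul r p _ hp =>
    obtain ⟨b, hb⟩ := hp
    refine ⟨r • b, fun z => ?_⟩
    simp only [Pi.smul_apply, smul_eq_mul, hb z, Finset.mul_sum]
    refine Finset.sum_congr rfl fun j _ => Finset.sum_congr rfl fun k _ => ?_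
    ring

/-- The formula holds for every net that represents `p`, so the choice made in `bezierNet` does not
matter and uniqueness of the net is not required. -/
theorem bezierNet_center {p : ℝ × ℝ → ℝ} {D : Rect} (hD : D.Nondeg) {b : Fin 3 → Fin 3 → ℝ}
    (hb : IsBezierNet p D b) : b 1 1 = polar D p := by
  have h1 : D.x₁ - D.x₀ ≠ 0 := by have : D.x₀ < D.x₁ := hD false; linarith
  have h2 : D.y₁ - D.y₀ ≠ 0 := by have : D.y₀ < D.y₁ := hD true; linarith
  have e1 : (D.x₁ - D.x₀) / (D.x₁ - D.x₀) = 1 := div_self h1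
  have e2 : (D.y₁ - D.y₀) / (D.y₁ - D.y₀) = 1 := div_self h2
  have m1 : ((D.x₀ + D.x₁) / 2 - D.x₀) / (D.x₁ - D.x₀) = 1 / 2 := by field_simp; ring
  have m2 : ((D.y₀ + D.y₁) / 2 - D.y₀) / (D.y₁ - D.y₀) = 1 / 2 := by field_simp; ring
  simp only [polar, av, Rect.sd, cond, hb _, e1, e2, m1, m2, sub_self, zero_div,
    Fin.sum_univ_three, Fin.val_zero, Fin.val_one, Fin.val_two, (bernstein_two _).1,
    (bernstein_two _).2.1, (bernstein_two _).2.2]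
  ring

theorem phi_eq_polar {p : ℝ × ℝ → ℝ} (hp : p ∈ biPoly 2 2) {D : Rect} (hD : D.Nondeg) :
    phi p D = polar D p :=
  bezierNet_center hD (Classical.epsilon_spec (exists_bezierNet hp hD))

/-! ### The polynomial pieces of a spline -/

theorem biPoly_eq {p q : ℝ × ℝ → ℝ} (hp : p ∈ biPoly 2 2) (hq : q ∈ biPoly 2 2) {D : Rect}
    (hD : D.Nondeg) (h : Set.EqOn p q D.carrier) : p = q := by
  have h1 : ∀ t ∈ Set.Icc D.y₀ D.y₁, ∀ s, p (s, t) - q (s, t) = 0 := fun t ht =>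
    ((quad_line hp false t).sub (quad_line hq false t)).eq_zero (hD false) fun s hs =>
      sub_eq_zero.2 (h ⟨hs, ht⟩)
  funext z
  refine sub_eq_zero.1 <|
    ((quad_line hp true z.1).sub (quad_line hq true z.1)).eq_zero (hD true) (fun t ht => ?_) z.2
  exact h1 t ht z.1

namespace HMesh

variable {T : HMesh} {f : ℝ × ℝ → ℝ}

theorem expression_spec (hf : f ∈ T.S2bar) {c : Cell} (hc : c ∈ T.cells) :
    expression f c.toRect ∈ biPoly 2 2 ∧ Set.EqOn f (expression f c.toRect) c.carrier := by
  obtain ⟨p, hp⟩ := hf.2.1 c hc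
  exact Classical.epsilon_spec
    (p := fun p => p ∈ biPoly 2 2 ∧ Set.EqOn f p c.carrier) ⟨p, hp⟩

theorem differentiable_line (hf : f ∈ T.S2bar) (i : Bool) (b : ℝ) :
    Differentiable ℝ fun s => f (pt i s b) := by
  cases i
  · exact (hf.1.1 b).differentiable (by simp)
  · exact (hf.1.2.2.1 b).differentiable (by simp)

end HMesh

theorem expression_add {T : HMesh} (M : Frame T.cells) {f g : ℝ × ℝ → ℝ} (hf : f ∈ T.S2bar)
    (hg : g ∈ T.S2bar) {c : Cell} (hc : c ∈ T.cells) :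
    expression (f + g) c.toRect = expression f c.toRect + expression g c.toRect := by
  obtain ⟨h1, h2⟩ := HMesh.expression_spec hf hc
  obtain ⟨h3, h4⟩ := HMesh.expression_spec hg hc
  obtain ⟨h5, h6⟩ := HMesh.expression_spec (T.S2bar.add_mem hf hg) hc
  refine biPoly_eq h5 (Submodule.add_mem _ h1 h3) (M.ndF hc) fun z hz => ?_
  rw [← h6 hz, Pi.add_apply, Pi.add_apply, h2 hz, h4 hz]

theorem expression_smul {T : HMesh} (M : Frame T.cells) {f : ℝ × ℝ → ℝ} (hf : f ∈ T.S2bar) (r : ℝ)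
    {c : Cell} (hc : c ∈ T.cells) :
    expression (r • f) c.toRect = r • expression f c.toRect := by
  obtain ⟨h1, h2⟩ := HMesh.expression_spec hf hc
  obtain ⟨h5, h6⟩ := HMesh.expression_spec (T.S2bar.smul_mem r hf) hc
  refine biPoly_eq h5 (Submodule.smul_mem _ r h1) (M.ndF hc) fun z hz => ?_
  rw [← h6 hz, Pi.smul_apply, Pi.smul_apply, h2 hz]

/-- With one argument equal to `ξ`, the polar form depends only on the value and the slope at `ξ`.
The slope of `h` is a one-sided derivative of `F`, whence the closed formula in terms of `F` alone.
-/
theorem av_of_tangent {h F : ℝ → ℝ} (hh : Quad h) {ξ a : ℝ} (ha : a ≠ ξ)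
    (hF : DifferentiableAt ℝ F ξ) (hE : Set.EqOn F h (Set.uIcc ξ a)) (t : ℝ) :
    av ξ t h = F ξ + deriv F ξ * (t - ξ) / 2 := by
  obtain ⟨x, y, w, e⟩ := hh
  have hd : HasDerivAt h (y + 2 * w * ξ) ξ := by
    have : h = fun s => x + y * s + w * s ^ 2 := funext e
    rw [this]
    have := (((hasDerivAt_id ξ).const_mul y).const_add x).add (((hasDerivAt_id ξ).pow 2).const_mul w)
    refine this.congr_deriv ?_
    simp only [id_eq]; ring
  have hu : UniqueDiffWithinAt ℝ (Set.uIcc ξ a) ξ :=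
    (uniqueDiffOn_Icc (by simpa using ha)) ξ Set.left_mem_uIcc
  have hd2 : HasDerivWithinAt h (deriv F ξ) (Set.uIcc ξ a) ξ :=
    hF.hasDerivAt.hasDerivWithinAt.congr (fun s hs => (hE hs).symm) (hE Set.left_mem_uIcc).symm
  have h1 : y + 2 * w * ξ = deriv F ξ := hu.eq_deriv _ hd.hasDerivWithinAt hd2
  rw [av_eq e, ← h1, hE Set.left_mem_uIcc, e]
  ring

/-- Polynomials that meet with matching tangents along a part of the line through a side of `D`
have the same central ordinate over `D`. -/
theorem polar_glue {f p q : ℝ × ℝ → ℝ} {i : Bool}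
    (hf : ∀ b, Differentiable ℝ fun s => f (pt i s b)) (hp : p ∈ biPoly 2 2) (hq : q ∈ biPoly 2 2)
    {ξ u v a b : ℝ} (huv : u < v) (ha : a ≠ ξ) (hb : b ≠ ξ)
    (hpa : ∀ y ∈ Set.Icc u v, ∀ s ∈ Set.uIcc ξ a, f (pt i s y) = p (pt i s y))
    (hqb : ∀ y ∈ Set.Icc u v, ∀ s ∈ Set.uIcc ξ b, f (pt i s y) = q (pt i s y))
    {D : Rect} {ρ : Bool} (hD : D.sd i ρ = ξ) : polar D p = polar D q := by
  -- The difference is quadratic in `y` and vanishes for `y` between `u` and `v`, hence everywhere.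
  -- This is why `D` need not be near the segment where the pieces meet.
  have key : ∀ y, (av ξ (D.sd i (!ρ)) fun s => p (pt i s y)) - (av ξ (D.sd i (!ρ)) fun s =>
      q (pt i s y)) = 0 := by
    refine Quad.eq_zero ?_ huv fun y hy => ?_
    · refine Quad.sub (quad_av (p := fun y s => p (pt i s y)) (fun s => ?_) _ _)
        (quad_av (p := fun y s => q (pt i s y)) (fun s => ?_) _ _)
      · simpa [pt_not] using quad_line hp (!i) s
      · simpa [pt_not] using quad_line hq (!i) s
    · rw [av_of_tangent (quad_line hp i y) ha (hf y ξ) (fun s hs => hpa y hy s hs),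
        av_of_tangent (quad_line hq i y) hb (hf y ξ) (fun s hs => hqb y hy s hs), sub_self]
  rw [polar_eq D p i ρ true, polar_eq D q i ρ true, av_swap (fun s t => p (pt i s t)),
    av_swap (fun s t => q (pt i s t)), hD]
  congr 1
  funext y
  exact sub_eq_zero.1 (key y)

/-- A biquadratic polynomial vanishes if its polar form vanishes on a rectangle `B` and on eight
rectangles around it. -/
theorem biPoly_zero_of_polar {p : ℝ × ℝ → ℝ} (hp : p ∈ biPoly 2 2) {B : Rect} (hB : B.Nondeg)
    (h00 : polar B p = 0)
    (h10 : ∀ i σ, ∃ D : Rect, D.Nondeg ∧ D.sd i (!σ) = B.sd i σ ∧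
      (∀ ρ, D.sd (!i) ρ = B.sd (!i) ρ) ∧ polar D p = 0)
    (h11 : ∀ σ τ, ∃ D : Rect, D.Nondeg ∧ D.sd false (!σ) = B.sd false σ ∧
      D.sd true (!τ) = B.sd true τ ∧ polar D p = 0) : p = 0 := by
  have hq : ∀ (i : Bool) (s t : ℝ), Quad fun x => av s t fun y => p (pt i x y) := fun i s t =>
    quad_av (fun y => quad_line hp i y) s t
  have hne : ∀ {D : Rect} {i σ : Bool}, D.Nondeg → D.sd i (!σ) = B.sd i σ →
      B.sd i (!σ) ≠ D.sd i σ := by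
    intro D i σ hD h h'
    have h1 := hD.lt i σ
    have h2 := hB.lt i σ
    rw [h, ← h'] at h1
    linarith
  have hBne : ∀ i, B.sd i false ≠ B.sd i true := fun i => (hB i).ne
  -- averaging over one interval of `B`
  have side : ∀ i x, (av (B.sd (!i) false) (B.sd (!i) true) fun y => p (pt i x y)) = 0 := by
    intro i
    -- As an affine function of `t` this vanishes at the opposite side of `B`, by `h00`, and at the
    -- far side of the rectangle `D` beyond the side, by `h10`.
    have hs : ∀ σ t, (av (B.sd i σ) t fun x => av (B.sd (!i) false) (B.sd (!i) true)
        fun y => p (pt i x y)) = 0 := by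
      intro σ t
      obtain ⟨D, hD, h1, h2, h3⟩ := h10 i σ
      refine av_zero_of_two (hq i _ _) (hne hD h1) ?_ ?_ t
      · rw [polar_eq B p i σ false] at h00
        exact h00
      · rw [polar_eq D p i (!σ) false, h1, h2, h2, Bool.not_not] at h3
        exact h3
    exact quad_zero_of_av (hq i _ _) (hBne i) (hs false) (hs true)
  -- The rectangle beyond the corner supplies one value; the other values needed for affine
  -- dependence on `x`, then on `y`, have an interval of `B` as one pair of arguments and vanish by
  -- `side`.
  have corner : ∀ σ τ x y, (av (B.sd false σ) x fun s => av (B.sd true τ) y fun t => p (s, t)) = 0 := by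
    intro σ τ
    obtain ⟨D, hD, h1, h2, h3⟩ := h11 σ τ
    rw [polar_eq D p false (!σ) (!τ)] at h3
    simp only [Bool.not_not, Bool.not_false, h1, h2] at h3
    have e1 : ∀ x, (av (B.sd false σ) x fun s => av (B.sd true τ) (D.sd true τ)
        fun t => p (s, t)) = 0 := by
      refine av_zero_of_two (hq false _ _) (hne hD h1) ?_ h3
      change (av _ _ fun s => av _ _ fun t => p (s, t)) = 0
      rw [av_swap (fun s t => p (s, t))]
      refine av_zero _ _ fun t => ?_
      have := side true t
      cases σ
      · exact this
      · rw [av_comm]; exact this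
    intro x y
    rw [av_swap (fun s t => p (s, t))]
    refine av_zero_of_two (hq true _ _) (hne hD h2) ?_ ?_ y
    · change (av _ _ fun t => av _ _ fun s => p (s, t)) = 0
      rw [← av_swap (fun s t => p (s, t))]
      refine av_zero _ _ fun s => ?_
      have := side false s
      cases τ
      · exact this
      · rw [av_comm]; exact this
    · change (av _ _ fun t => av _ _ fun s => p (s, t)) = 0
      rw [← av_swap (fun s t => p (s, t))]
      exact e1 x
  funext z
  have h1 : ∀ σ x t, (av (B.sd false σ) x fun s => p (s, t)) = 0 := by
    intro σ x
    refine quad_zero_of_av (hq true _ _) (hBne true) ?_ ?_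
    all_goals
      intro y
      rw [← av_swap (fun s t => p (s, t))]
      exact corner _ _ _ _
  exact quad_zero_of_av (quad_line hp false z.2) (hBne false) (fun x => h1 false x z.2)
    (fun x => h1 true x z.2) z.1

/-! ### Carrying ordinates across grid lines -/

namespace Frame

variable {T : HMesh} (M : Frame T.cells) {f : ℝ × ℝ → ℝ}

include M

omit M in
theorem polar_across (hf : f ∈ T.S2bar) {c d : Cell} (hc : c ∈ T.cells) (hd : d ∈ T.cells)
    {z : ℝ × ℝ} {i σ τ : Bool} (h1 : InQ c.toRect z i σ τ) (h2 : InQ d.toRect z i (!σ) τ)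
    {D : Rect} {ρ : Bool} (hD : D.sd i ρ = co i z) :
    polar D (expression f c.toRect) = polar D (expression f d.toRect) := by
  obtain ⟨p1, p2⟩ := HMesh.expression_spec hf hc
  obtain ⟨q1, q2⟩ := HMesh.expression_spec hf hd
  obtain ⟨t, ht, ht'⟩ := exists_between (lt_min h1.2.2 h2.2.2)
  rw [lt_min_iff] at ht'
  obtain ⟨w, rfl⟩ : ∃ w, t = sg τ * w := ⟨sg τ * t, by rw [← mul_assoc, sg_mul_sg, one_mul]⟩
  have hwne : co (!i) z ≠ w := fun h => by rw [h] at ht; exact lt_irrefl _ ht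
  -- points of the cell `e` near the line
  have mem : ∀ (e : Cell) (ρ' : Bool), InQ e.toRect z i ρ' τ → sg τ * w < sg τ * e.sd (!i) τ →
      ∀ y ∈ Set.Icc (min (co (!i) z) w) (max (co (!i) z) w), ∀ s ∈ Set.uIcc (co i z) (e.sd i ρ'),
      pt i s y ∈ e.carrier := by
    intro e ρ' he hw y hy s hs
    have hy' : sg τ * co (!i) z ≤ sg τ * y ∧ sg τ * y ≤ sg τ * w := by
      cases τ
      · simp only [sg_false] at *
        rw [min_eq_right (by linarith), max_eq_left (by linarith)] at hy
        exact ⟨by linarith [hy.2], by linarith [hy.1]⟩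
      · simp only [sg_true] at *
        rw [min_eq_left (by linarith), max_eq_right (by linarith)] at hy
        exact ⟨by linarith [hy.1], by linarith [hy.2]⟩
    have hs' : sg ρ' * co i z ≤ sg ρ' * s ∧ sg ρ' * s ≤ sg ρ' * e.sd i ρ' := by
      have := he.1.2
      cases ρ'
      · simp only [sg_false] at *
        rw [Set.uIcc_of_ge (by linarith)] at hs
        exact ⟨by linarith [hs.2], by linarith [hs.1]⟩
      · simp only [sg_true] at *
        rw [Set.uIcc_of_le (by linarith)] at hs
        exact ⟨by linarith [hs.1], by linarith [hs.2]⟩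
    rw [mem_carrier, bool_forall i]
    simp only [co_pt, co_not_pt]
    refine ⟨fun ρ => ?_, fun ρ => ?_⟩
    · rcases Bool.eq_or_eq_not ρ ρ' with rfl | rfl
      · exact hs'.2
      · have := he.1.1
        simp only [sg_not]; linarith [hs'.1]
    · rcases Bool.eq_or_eq_not ρ τ with rfl | rfl
      · linarith [hy'.2]
      · have := he.2.1
        simp only [sg_not]; linarith [hy'.1]
  refine polar_glue (fun b => HMesh.differentiable_line hf i b) p1 q1
    (min_lt_max.2 hwne) (a := c.sd i σ) (b := d.sd i (!σ)) ?_ ?_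
    (fun y hy s hs => p2 (mem c σ h1 ht'.1 y hy s hs))
    (fun y hy s hs => q2 (mem d (!σ) h2 ht'.2 y hy s hs)) hD
  · intro h; have := h1.1.2; rw [h] at this; exact lt_irrefl _ this
  · intro h; have := h2.1.2; rw [h] at this; exact lt_irrefl _ this

theorem polar_boundary (hf : f ∈ T.S2bar) {c : Cell} (hc : c ∈ T.cells) {i σ : Bool}
    (hs : c.sd i σ = M.Ω.sd i σ) {D : Rect} {ρ : Bool} (hD : D.sd i ρ = c.sd i σ) :
    polar D (expression f c.toRect) = 0 := by
  obtain ⟨p1, p2⟩ := HMesh.expression_spec hf hc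
  rw [← polar_zero D]
  have hlt := (M.ndF hc).lt i σ
  refine polar_glue (fun b => HMesh.differentiable_line hf i b) p1 (Submodule.zero_mem _)
    (M.ndF hc (!i)) (a := c.sd i (!σ)) (b := c.sd i σ + sg σ) ?_ ?_ (fun y hy s hs' => p2 ?_)
    (fun y hy s hs' => ?_) hD
  · intro h; rw [h] at hlt; exact lt_irrefl _ hlt
  · simpa using sg_ne_zero σ
  · rw [mem_carrier, bool_forall i]
    simp only [co_pt, co_not_pt]
    constructor
    · rw [Set.mem_uIcc] at hs'
      intro ρ
      cases σ <;> cases ρ <;> simp at * <;> rcases hs' with h | h <;> linarith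
    · intro ρ
      cases ρ <;> simp <;> linarith [hy.1, hy.2]
  -- Outside of the region `f` is zero by definition; on the boundary line itself this follows by
  -- continuity.
  · by_cases hsx : s = c.sd i σ
    · have hcont : Continuous fun s => f (pt i s y) :=
        (HMesh.differentiable_line hf i y).continuous
      have hcl : IsClosed {s | f (pt i s y) = 0} := isClosed_eq hcont continuous_const
      have hsub : {s | sg σ * c.sd i σ < sg σ * s} ⊆ {s | f (pt i s y) = 0} := by
        intro s hs1
        refine hf.2.2 _ fun h => ?_
        rw [M.region_eq] at h
        have := mem_carrier.1 h i σ
        rw [co_pt, ← hs] at this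
        exact absurd this (not_le.2 hs1)
      refine hcl.closure_subset_iff.2 hsub ?_
      rw [hsx]
      cases σ
      · simp only [sg_false, neg_mul, one_mul, neg_lt_neg_iff]
        exact (closure_Iio (c.sd i false)).symm ▸ Set.self_mem_Iic
      · simp only [sg_true, one_mul]
        exact (closure_Ioi (c.sd i true)).symm ▸ Set.self_mem_Ici
    · refine hf.2.2 _ fun h => ?_
      rw [M.region_eq] at h
      have := mem_carrier.1 h i σ
      rw [co_pt, ← hs] at this
      rw [Set.mem_uIcc] at hs'
      cases σ <;> simp at * <;> rcases hs' with h | h <;>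
        exact hsx (by linarith)

end Frame

/-- The cell `B`, of at most the level of `N`, covers the side of `N` in direction `σ` of the axis
`i` from outside. -/
structure HMesh.Cov (T : HMesh) (N B : Cell) (i σ : Bool) : Prop where
  hB : B ∈ T.cells
  le : B.level ≤ N.level
  line : N.sd i σ = B.sd i (!σ)
  ext : ∀ ρ, sg ρ * N.sd (!i) ρ ≤ sg ρ * B.sd (!i) ρ

/-- The rectangle `e` lies in the half of `A` in direction `σ` of the axis `i`. -/
def InHalf (A : Rect) (i σ : Bool) (e : Rect) : Prop := sg σ * A.mid i ≤ sg σ * e.sd i (!σ)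

namespace Frame

variable {T : HMesh} (M : Frame T.cells)

include M

/-! ### The T-rectangle-domain -/

omit M in
theorem tRect_sd {K : Set Cell} {i σ : Bool} {a : ℝ} (hnd : ∀ c ∈ K, c.Nondeg)
    (h1 : ∃ c ∈ K, c.sd i σ = a) (h2 : ∀ c ∈ K, sg σ * c.sd i σ ≤ sg σ * a) :
    (tRect K).sd i σ = a := by
  obtain ⟨c, hc, hca⟩ := h1
  have hmem : a ∈ co i '' tDomain K := by
    refine ⟨pt i (c.sd i σ) (c.sd (!i) false), ?_, by simp [hca]⟩
    simp only [tDomain, Set.mem_iUnion, exists_prop]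
    have := ((hnd c hc).inQ_corner i (!σ) true).mem_carrier
    exact ⟨c, hc, by simpa using this⟩
  have hle : ∀ b ∈ co i '' tDomain K, sg σ * b ≤ sg σ * a := by
    rintro _ ⟨z, hz, rfl⟩
    simp only [tDomain, Set.mem_iUnion, exists_prop] at hz
    obtain ⟨d, hd, hz⟩ := hz
    exact (mem_carrier.1 hz i σ).trans (h2 d hd)
  cases σ
  · have : IsLeast (co i '' tDomain K) a := ⟨hmem, fun b hb => by simpa using hle b hb⟩
    cases i <;> exact this.csInf_eq
  · have : IsGreatest (co i '' tDomain K) a := ⟨hmem, fun b hb => by simpa using hle b hb⟩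
    cases i <;> exact this.csSup_eq

theorem sub_tRect {K : Set Cell} (hK : K ⊆ T.cells) {c : Cell} (hc : c ∈ K) :
    Sub c.toRect (tRect K) := by
  intro i σ
  obtain ⟨d, hd, hmax⟩ := Set.exists_max_image K (fun c => sg σ * c.sd i σ) (M.fin.subset hK) ⟨c, hc⟩
  rw [tRect_sd (fun c hc => M.ndF (hK hc)) ⟨d, hd, rfl⟩ hmax]
  exact hmax c hc

theorem tRect_nondeg {K : Set Cell} (hK : K ⊆ T.cells) (hne : K.Nonempty) : (tRect K).Nondeg := by
  intro i
  obtain ⟨c, hc⟩ := hne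
  have h1 := M.sub_tRect hK hc i true
  have h2 := M.sub_tRect hK hc i false
  have h3 := M.ndF (hK hc) i
  simp only [sg_true, sg_false] at h1 h2
  linarith

/-! ### Cells inside of a larger cell of the hierarchy -/

omit M in
theorem cov_under {N B c : Cell} {i σ : Bool} (h : T.Cov N B i σ) (hc : c ∈ T.cells)
    (hs : Sub c.toRect N.toRect) (hl : N.level < c.level) (ht : c.sd i σ = N.sd i σ) :
    T.Under c B i σ :=
  ⟨hc, h.hB, h.le.trans_lt hl, ht.trans h.line, fun ρ => (hs (!i) ρ).trans (h.ext ρ)⟩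

/-- The ancestor of `N` on the level of `B` has a side on the line where `B` begins. As `c` reaches
that line from inside of `N`, so does `N`, and `B` spans the whole side of that ancestor. -/
theorem under_cov {N B c : Cell} {i σ : Bool} (h : T.Under c B i σ) (hN : N ∈ M.V)
    (hs : Sub c.toRect N.toRect) (hl : B.level ≤ N.level) :
    c.sd i σ = N.sd i σ ∧ T.Cov N B i σ := by
  obtain ⟨A, hA, hA1, hA2⟩ := M.anc hN hl
  obtain ⟨h1, h2⟩ := M.under_anc h hA hA1 (hs.trans hA2)
  have h3 : c.sd i σ = N.sd i σ := by
    refine sg_antisymm (σ := σ) (hs i σ) ?_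
    rw [h.line, ← h2]
    exact hA2 i σ
  exact ⟨h3, h.hB, hl, h3 ▸ h.line, fun ρ => by rw [← h1]; exact hA2 (!i) ρ⟩

theorem cov_unique {N B B' : Cell} {i σ : Bool} (hN : N ∈ M.V) (h : T.Cov N B i σ)
    (h' : T.Cov N B' i σ) : B = B' := by
  have key : ∀ B, T.Cov N B i σ → InQ B.toRect (pt i (N.sd i σ) (N.sd (!i) false)) i σ true := by
    intro B h
    constructor
    · rw [co_pt, h.line]; exact (M.ndF h.hB).in1_sd i σ
    · rw [co_not_pt]
      have h1 := h.ext true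
      have h2 := h.ext false
      have h3 := M.nd N hN (!i)
      simp only [sg_true, sg_false] at h1 h2
      constructor <;> simp <;> linarith
  exact M.uniq h.hB h'.hB (key B h) (key B' h')

/-- The cell of the mesh in a corner of a divided cell of the hierarchy. -/
theorem corner_leaf {N e : Cell} (hN : N ∈ M.V) (he : e ∈ T.cells) (hs : Sub e.toRect N.toRect)
    (hl : N.level < e.level) (i σ τ : Bool) : ∃ c ∈ T.cells, Sub c.toRect N.toRect ∧
      N.level < c.level ∧ c.sd i σ = N.sd i σ ∧ c.sd (!i) τ = N.sd (!i) τ := by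
  have h1 := (M.nd N hN).inQ_corner i (!σ) (!τ)
  rw [Bool.not_not, Bool.not_not] at h1
  obtain ⟨c, hc, h2⟩ := M.ex ((M.inΩ N hN).inQ h1)
  have hlc : N.level < c.level := by
    by_contra! h
    have := M.leaf_eq he hc (hs.trans (M.nested (M.sub hc) hN h h2 h1))
    subst this
    omega
  have hcs := M.nested hN (M.sub hc) hlc.le h1 h2
  have a := h2.1.1
  have b := h2.2.1
  simp only [co_pt, co_not_pt, sg_not, Bool.not_not] at a b
  exact ⟨c, hc, hcs, hlc, sg_antisymm (hcs i σ) (by linarith),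
    sg_antisymm (hcs (!i) τ) (by linarith)⟩

/-- The ancestor of `c` on the level of `B` contains `d` by `tpat_sub`, and it lies in `A`. -/
theorem tpat_sub_of_le {v : ℝ × ℝ} {i σ τ : Bool} {B c d A : Cell} (h : T.TPat v i σ τ B c d)
    (hA : A ∈ M.V) (hl : A.level ≤ B.level) (hs : Sub c.toRect A.toRect) :
    Sub d.toRect A.toRect := by
  obtain ⟨A', hA', h1, h2⟩ := M.anc (M.sub h.hc) (M.tpat_level h).le
  exact (M.tpat_sub h hA' h1 h2).trans (M.nested_of_sub hA hA' (M.sub h.hc) (by omega) hs h2)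

theorem inHalf_of_side {A c : Cell} (hA : A ∈ M.V) (hc : c ∈ M.V) (hs : Sub c.toRect A.toRect)
    (hl : A.level < c.level) {i σ : Bool} (h : c.sd i σ = A.sd i σ) :
    InHalf A.toRect i σ c.toRect := by
  obtain ⟨ρ, hρ⟩ := M.half hA hc hs hl i
  rcases Bool.eq_or_eq_not ρ σ with rfl | rfl
  · have := mid_lt (M.nd A hA) i ρ
    rw [h] at hρ
    linarith
  · unfold InHalf
    simp only [sg_not] at hρ
    linarith

omit M in
theorem InHalf.not_side {A c : Rect} (hA : A.Nondeg) {i σ : Bool} (h : InHalf A i (!σ) c) :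
    c.sd i σ ≠ A.sd i σ := by
  intro h'
  unfold InHalf at h
  have := mid_lt hA i σ
  simp only [sg_not, Bool.not_not, h'] at h
  linarith

/-- A link inside of a cell `A` of the hierarchy that does not use a side of `A` that crosses the
middle line does not cross the middle line. -/
theorem inHalf_step {v : ℝ × ℝ} {i σ j ρ τ : Bool} {A B c d : Cell} (h : T.TPat v j ρ τ B c d)
    (hA : A ∈ M.V) (hl : A.level ≤ B.level) (hs : Sub c.toRect A.toRect)
    (hn : ¬ (B.level = A.level ∧ j = !i)) (hc : InHalf A.toRect i σ c.toRect) :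
    InHalf A.toRect i σ d.toRect := by
  have hds := M.tpat_sub_of_le h hA hl hs
  have hu := M.tpat_under h
  have hu' := M.tpat_under h.swap
  rcases hl.eq_or_lt with hl | hl
  -- If `B` is on the level of `A`, the junction lies on a side of `A` parallel to the middle line;
  -- `c` and `d` both touch this side, so they are in the same half.
  · have hj : j = i := by
      rcases Bool.eq_or_eq_not j i with h | h
      · exact h
      · exact (hn ⟨hl.symm, h⟩).elim
    subst hj
    have h1 := (M.under_cov hu hA hs hl.ge).1
    have h2 := (M.under_cov hu' hA hds hl.ge).1
    rcases Bool.eq_or_eq_not ρ σ with rfl | rfl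
    · exact M.inHalf_of_side hA (M.sub h.hd) hds (hl ▸ hu'.lt) h2
    · have := InHalf.not_side (M.nd A hA) (σ := !σ) (by rwa [Bool.not_not])
      exact (this h1).elim
  -- If `B` is smaller than `A`, both cells lie in a common proper descendant `A'` of `A`, which
  -- lies in one half.
  · obtain ⟨A', hA', h1, h2⟩ := M.anc (M.sub h.hc) (M.tpat_level h).le
    have h3 := M.tpat_sub h hA' h1 h2
    have h4 := M.nested_of_sub hA hA' (M.sub h.hc) (by omega) hs h2
    obtain ⟨ρ', hρ'⟩ := M.half hA hA' h4 (by omega) i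
    unfold InHalf at hc ⊢
    rcases Bool.eq_or_eq_not ρ' σ with rfl | rfl
    · have h5 := h2 i ρ'
      have h6 := (M.ndF h.hc).lt i ρ'
      linarith
    · have h5 := h3.not i σ
      simp only [sg_not] at hρ'
      linarith

theorem polar_under {f : ℝ × ℝ → ℝ} (hf : f ∈ T.S2bar) {c B : Cell} {i σ : Bool}
    (h : T.Under c B i σ) {D : Rect} {ρ : Bool} (hD : D.sd i ρ = c.sd i σ) :
    polar D (expression f c.toRect) = polar D (expression f B.toRect) := by
  obtain ⟨h1, h2⟩ := M.under_inQ h true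
  exact (polar_across hf h.hB h.hc h2 h1 (by rw [hD, co_pt])).symm

/-- The values from the cells that cover two sides of a divided cell with a common corner. -/
theorem polar_cov_cov {f : ℝ × ℝ → ℝ} (hf : f ∈ T.S2bar) {N e B B' : Cell} (hN : N ∈ M.V)
    (he : e ∈ T.cells) (hs : Sub e.toRect N.toRect) (hl : N.level < e.level) {i σ τ : Bool}
    (h : T.Cov N B i σ) (h' : T.Cov N B' (!i) τ) {D : Rect} (hD : D.sd i σ = N.sd i σ)
    (hD' : D.sd (!i) τ = N.sd (!i) τ) :
    polar D (expression f B.toRect) = polar D (expression f B'.toRect) := by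
  obtain ⟨c, hc, h1, h2, h3, h4⟩ := M.corner_leaf hN he hs hl i σ τ
  rw [← M.polar_under hf (cov_under h hc h1 h2 h3) (hD.trans h3.symm),
    ← M.polar_under hf (cov_under h' hc h1 h2 h4) (hD'.trans h4.symm)]

/-! ### One-neighbour-cells -/

theorem tCell_under {c : Cell} (hc : T.IsTCell c) : ∃ B i σ, T.Under c B i σ := by
  obtain ⟨h, v, hv, ht⟩ := hc
  exact M.tJunction_under h.1 hv ht

/-- Among all larger cells touched by cells of `K`, take one of lowest level, and let `A` be the
ancestor on that level of the cell touching it. Every link in `K` passes at a cell of at least this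
level, so by `tpat_sub_of_le` it does not leave `A`. -/
theorem exists_neighbour {K : Set Cell} (hK : T.IsTConnection K) :
    ∃ A ∈ M.V, (∀ c ∈ K, Sub c.toRect A.toRect ∧ A.level < c.level) ∧
      (∃ C, T.IsNeighbour K C ∧ C.level = A.level) ∧
      (∀ c ∈ K, ∀ B i σ, T.Under c B i σ → A.level ≤ B.level) := by
  classical
  have hTc := fun c (hc : c ∈ K) => tConnection_tCell hK hc
  have hne : ∃ n, ∃ c ∈ K, ∃ B i σ, T.Under c B i σ ∧ B.level = n := by
    obtain ⟨c, hc, rfl⟩ := hK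
    obtain ⟨B, i, σ, h⟩ := M.tCell_under hc
    exact ⟨_, c, .refl, B, i, σ, h, rfl⟩
  obtain ⟨c₀, hc₀, B₀, i₀, σ₀, h₀, hl₀⟩ := Nat.find_spec hne
  have hmin : ∀ c ∈ K, ∀ B i σ, T.Under c B i σ → Nat.find hne ≤ B.level :=
    fun c hc B i σ h => Nat.find_min' hne ⟨c, hc, B, i, σ, h, rfl⟩
  obtain ⟨A, hA, hA1, hA2⟩ := M.anc (M.sub h₀.hc) (hl₀ ▸ h₀.lt.le)
  rw [← hA1] at hmin hl₀
  have hstep : ∀ d e, d ∈ K → T.TConnected d e → Sub d.toRect A.toRect → Sub e.toRect A.toRect := by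
    intro d e hd hde hs
    by_cases hne : d = e
    · rwa [← hne]
    obtain ⟨v, i, σ, τ, B, hp⟩ := M.link_tpat ⟨hde.1.1.1, hde.2.1.1.1, hde.2.2⟩ hne
    exact M.tpat_sub_of_le hp hA (hmin d hd B i σ (M.tpat_under hp)) hs
  have hsub : ∀ c ∈ K, Sub c.toRect A.toRect := by
    obtain ⟨r, hr, rfl⟩ := hK
    have hiff : ∀ d, Relation.ReflTransGen T.TConnected r d →
        (Sub r.toRect A.toRect ↔ Sub d.toRect A.toRect) := by
      intro d hd
      induction hd with
      | refl => rfl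
      | @tail b d hb h ih =>
        refine ih.trans ⟨hstep b d hb h, hstep d b (hb.tail h) ⟨h.2.1, h.1, ?_⟩⟩
        obtain ⟨v, hv, ht⟩ := h.2.2
        exact ⟨v, ⟨hv.2, hv.1⟩, ht⟩
    have hr : Sub r.toRect A.toRect := (hiff c₀ hc₀).2 hA2
    exact fun d hd => (hiff d hd).1 hr
  -- Every cell of `K` touches a larger cell of at least the level of `A`, hence is strictly below
  -- `A`. As `B₀` is on the level of `A`, it is not in `K`.
  refine ⟨A, hA, fun c hc => ⟨hsub c hc, ?_⟩, ⟨B₀, ⟨fun hB => ?_, c₀, hc₀, M.under_adjacent h₀⟩,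
    hl₀⟩, hmin⟩
  · obtain ⟨B, i, σ, h⟩ := M.tCell_under (hTc c hc)
    exact (hmin c hc B i σ h).trans_lt h.lt
  · obtain ⟨B, i, σ, h⟩ := M.tCell_under (hTc B₀ hB)
    have h1 := hmin B₀ hB B i σ h
    have h2 := h.lt
    omega

theorem exists_oneNeighbour {K : Set Cell} (hK : T.IsTConnection K) :
    ∃ C, T.IsOneNeighbour K C := by
  classical
  obtain ⟨A, -, -, ⟨C, hC, -⟩, -⟩ := M.exists_neighbour hK
  have hne : ∃ n, ∃ C, T.IsNeighbour K C ∧ C.level = n := ⟨_, C, hC, rfl⟩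
  obtain ⟨C, hC, hl⟩ := Nat.find_spec hne
  exact ⟨C, hC, fun C' hC' => hl ▸ Nat.find_min' hne ⟨C', hC', rfl⟩⟩

/-- With `A` from `exists_neighbour`, each one-neighbour-cell covers a side of `A`, and a cell of
`K` reaches this side, so that `tRect K` shares it. Adjacent sides are then compared by
`polar_cov_cov`. -/
theorem oneNeighbour_polar {K : Set Cell} (hK : T.IsTConnection K) {f : ℝ × ℝ → ℝ}
    (hf : f ∈ T.S2bar) {C C' : Cell} (hC : T.IsOneNeighbour K C) (hC' : T.IsOneNeighbour K C') :
    polar (tRect K) (expression f C.toRect) = polar (tRect K) (expression f C'.toRect) := by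
  obtain ⟨A, hA, hsub, ⟨B₀, hB₀, hl₀⟩, hmin⟩ := M.exists_neighbour hK
  have hKF := tConnection_sub hK
  have hD : ∀ {d : Cell} {i σ : Bool}, d ∈ K → d.sd i σ = A.sd i σ →
      (tRect K).sd i σ = A.sd i σ := fun {d i σ} hd h =>
    tRect_sd (fun c hc => M.ndF (hKF hc)) ⟨d, hd, h⟩ fun c hc => (hsub c hc).1 i σ
  have key : ∀ C, T.IsOneNeighbour K C → ∃ i σ, T.Cov A C i σ ∧ ∃ d ∈ K, d.sd i σ = A.sd i σ := by
    rintro C ⟨⟨hCK, d, hd, hadj⟩, hmin'⟩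
    have h1 := hmin' B₀ hB₀
    obtain ⟨z, i, σ, τ, hz, hz'⟩ := M.adjacent_inQ hadj
    have h2 := (hsub d hd).2
    have hu := M.under_of_adj hadj.2.1 hadj.1 hz hz' (by omega)
    obtain ⟨h3, h4⟩ := M.under_cov hu hA (hsub d hd).1 (by omega)
    exact ⟨i, σ, h4, d, hd, h3⟩
  obtain ⟨i, σ, hc, d, hd, hds⟩ := key C hC
  obtain ⟨i', σ', hc', d', hd', hds'⟩ := key C' hC'
  have hl := (hsub d hd).2
  rcases Bool.eq_or_eq_not i' i with rfl | rfl
  · rcases Bool.eq_or_eq_not σ' σ with rfl | rfl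
    · rw [M.cov_unique hA hc hc']
    -- Covers of opposite sides: `K` has cells at both sides, so it crosses the middle line of `A`.
    -- By `inHalf_step` this takes a cover `B` of a third side, which is adjacent to both.
    · obtain ⟨τ, B, hB, b, hb, hbs⟩ : ∃ τ B, T.Cov A B (!i') τ ∧
          ∃ b ∈ K, b.sd (!i') τ = A.sd (!i') τ := by
        by_contra! hno
        have hstep : ∀ b e, b ∈ K → T.TConnected b e → InHalf A.toRect i' σ b.toRect →
            InHalf A.toRect i' σ e.toRect := by
          intro b e hb hbe hs
          by_cases hne : b = e
          · rwa [← hne]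
          obtain ⟨v, j, ρ, τ, B, hp⟩ := M.link_tpat ⟨hbe.1.1.1, hbe.2.1.1.1, hbe.2.2⟩ hne
          have hu := M.tpat_under hp
          refine M.inHalf_step hp hA (hmin b hb B j ρ hu) (hsub b hb).1 ?_ hs
          rintro ⟨hBl, rfl⟩
          obtain ⟨h1, h2⟩ := M.under_cov hu hA (hsub b hb).1 hBl.le
          exact hno ρ B h2 b hb h1
        have hiff : ∀ b ∈ K, ∀ e ∈ K, InHalf A.toRect i' σ b.toRect →
            InHalf A.toRect i' σ e.toRect := by
          obtain ⟨r, hr, rfl⟩ := hK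
          have : ∀ e, Relation.ReflTransGen T.TConnected r e →
              (InHalf A.toRect i' σ r.toRect ↔ InHalf A.toRect i' σ e.toRect) := by
            intro e he
            induction he with
            | refl => rfl
            | @tail b e hb h ih =>
              refine ih.trans ⟨hstep b e hb h, hstep e b (hb.tail h) ⟨h.2.1, h.1, ?_⟩⟩
              obtain ⟨v, hv, ht⟩ := h.2.2
              exact ⟨v, ⟨hv.2, hv.1⟩, ht⟩
          exact fun b hb e he h => (this e he).1 ((this b hb).2 h)
        have h1 := M.inHalf_of_side hA (M.sub (hKF hd)) (hsub d hd).1 (hsub d hd).2 hds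
        have h2 := hiff d hd d' hd' h1
        exact InHalf.not_side (M.nd A hA) (σ := !σ) (by rwa [Bool.not_not]) hds'
      rw [M.polar_cov_cov hf hA (hKF hd) (hsub d hd).1 hl hc hB (hD hd hds) (hD hb hbs),
        M.polar_cov_cov hf hA (hKF hd) (hsub d hd).1 hl hc' hB (hD hd' hds') (hD hb hbs)]
  · exact M.polar_cov_cov hf hA (hKF hd) (hsub d hd).1 hl hc hc' (hD hd hds) (hD hd' hds')

end Frame

/-! ### Injectivity: the conditions on a cell and beyond its sides -/

/-- A spline all of whose values on the P-g-cells and the T-g-cells are zero. -/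
structure HMesh.Null (T : HMesh) (f : ℝ × ℝ → ℝ) : Prop where
  mem : f ∈ T.S2bar
  pCell : ∀ c, T.IsPCell c → polar c.toRect (expression f c.toRect) = 0
  tCell : ∀ c, T.IsTCell c → T.Good (T.linkClass c) → ∀ C, T.IsOneNeighbour (T.linkClass c) C →
    polar (tRect (T.linkClass c)) (expression f C.toRect) = 0

/-- The spline `f` vanishes on all cells of level less than `k`. -/
def HMesh.ZeroBelow (T : HMesh) (f : ℝ × ℝ → ℝ) (k : ℕ) : Prop :=
  ∀ c ∈ T.cells, c.level < k → expression f c.toRect = 0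

/-- Outside of the side of the cell `N` of the hierarchy in direction `σ` of the axis `i` there is
the boundary or a cell of lower level. -/
def Frame.Rim {T : HMesh} (M : Frame T.cells) (N : Cell) (i σ : Bool) : Prop :=
  N.sd i σ = M.Ω.sd i σ ∨ ∃ C, T.Cov N C i σ ∧ C.level < N.level

theorem exists_rect (i : Bool) (g h : Bool → ℝ) :
    ∃ D : Rect, (∀ σ, D.sd i σ = g σ) ∧ ∀ σ, D.sd (!i) σ = h σ := by
  cases i
  · exact ⟨⟨g false, g true, h false, h true⟩, by simp [Rect.sd], by simp [Rect.sd]⟩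
  · exact ⟨⟨h false, h true, g false, g true⟩, by simp [Rect.sd], by simp [Rect.sd]⟩

theorem exists_interval_end (σ : Bool) (a : ℝ) : ∃ g : Bool → ℝ, g σ = a ∧ g false < g true := by
  cases σ
  · exact ⟨fun τ => cond τ (a + 1) a, rfl, by simp⟩
  · exact ⟨fun τ => cond τ a (a - 1), rfl, by simp⟩

/-- A rectangle on the other side of a side of `B`. -/
theorem exists_side_rect {B : Rect} (hB : B.Nondeg) (i σ : Bool) :
    ∃ D : Rect, D.Nondeg ∧ D.sd i (!σ) = B.sd i σ ∧ ∀ ρ, D.sd (!i) ρ = B.sd (!i) ρ := by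
  obtain ⟨g, hg, hlt⟩ := exists_interval_end (!σ) (B.sd i σ)
  obtain ⟨D, h1, h2⟩ := exists_rect i g fun ρ => B.sd (!i) ρ
  refine ⟨D, (bool_forall i).2 ⟨by rwa [h1, h1], by rw [h2, h2]; exact hB _⟩, by rw [h1, hg], h2⟩

/-- A rectangle opposite to `B` at a corner of `B`. -/
theorem exists_corner_rect (B : Rect) (s : Bool → Bool) :
    ∃ D : Rect, D.Nondeg ∧ ∀ j, D.sd j (!s j) = B.sd j (s j) := by
  obtain ⟨g, hg, hlt⟩ := exists_interval_end (!s false) (B.sd false (s false))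
  obtain ⟨h, hh, hlt'⟩ := exists_interval_end (!s true) (B.sd true (s true))
  obtain ⟨D, h1, h2⟩ := exists_rect false g h
  rw [Bool.not_false] at h2
  exact ⟨D, Bool.forall_bool.2 ⟨by rwa [h1, h1], by rwa [h2, h2]⟩,
    Bool.forall_bool.2 ⟨by rw [h1, hg], by rw [h2, hh]⟩⟩

namespace Frame

variable {T : HMesh} (M : Frame T.cells)

include M

/-- The cells linked to a cell that touches the side of `B` reach both ends of this side. -/
theorem full_side {K : Set Cell} (hK : K ⊆ T.cells) (hcl : ∀ c ∈ K, ∀ d, T.Link c d → d ∈ K)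
    {e B : Cell} {i σ : Bool} (he : e ∈ K) (h : T.Under e B i σ) (ρ : Bool) :
    ∃ c ∈ K, c.sd (!i) ρ = B.sd (!i) ρ := by
  -- Take the cell reaching furthest along the side. If it stopped short of the end, its corner
  -- there would be a T-junction, and a linked cell would reach further.
  obtain ⟨c, ⟨hc, hcu⟩, hmax⟩ := Set.exists_max_image {c | c ∈ K ∧ T.Under c B i σ}
    (fun c => sg ρ * c.sd (!i) ρ) (M.fin.subset fun c hc => hK hc.1) ⟨e, he, h⟩
  refine ⟨c, hc, ?_⟩
  by_contra hne
  obtain ⟨d, hd⟩ := M.under_tpat hcu (lt_of_le_of_ne (hcu.ext ρ) fun h => hne (sg_cancel h))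
  have h1 := hmax d ⟨hcl c hc d (M.link_of_tpat hd).symm, M.tpat_under hd⟩
  have h2 := hd.c1.2.2
  rw [co_not_pt] at h2
  exact absurd h1 (not_le.2 h2)

omit M in
theorem linkClass_induction {e : Cell} {P : Cell → Prop} (he : P e)
    (hstep : ∀ c d, P c → T.Link c d → P d) : ∀ c ∈ T.linkClass e, P c := by
  intro c hc
  induction hc with
  | refl => exact he
  | tail _ h ih => exact hstep _ _ ih h

/-- If no cell of the class of `e` touches a cell of lower level than `B`, then `B` is a
one-neighbour-cell of it. -/
theorem trapped {f : ℝ × ℝ → ℝ} (hf : T.Null f) {e B : Cell} {i σ : Bool} (h : T.Under e B i σ)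
    (hint : ∀ c ∈ T.linkClass e, T.IsInteriorCell c)
    (hmin : ∀ c ∈ T.linkClass e, ∀ C j ρ, T.Under c C j ρ → B.level ≤ C.level) :
    polar (tRect (T.linkClass e)) (expression f B.toRect) = 0 := by
  have hG : T.Good (T.linkClass e) := ⟨fun c hc d hd => Relation.ReflTransGen.tail hc hd, hint⟩
  have he : T.IsTCell e := ⟨hint e .refl, M.under_tJunction h⟩
  have hT := isTConnection_linkClass he hG
  have hlt : ∀ c ∈ T.linkClass e, B.level < c.level := by
    intro c hc
    obtain ⟨C, j, ρ, hu⟩ := M.tCell_under (tConnection_tCell hT hc)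
    exact (hmin c hc C j ρ hu).trans_lt hu.lt
  refine hf.tCell e he hG B ⟨⟨fun hB => lt_irrefl _ (hlt B hB), e, .refl, M.under_adjacent h⟩, ?_⟩
  rintro C ⟨-, c, hc, hadj⟩
  -- A neighbour of lower level than `B` would be a larger cell touched by the class, against
  -- `hmin`.
  by_contra! hl
  obtain ⟨z, j, ρ, τ, h1, h2⟩ := M.adjacent_inQ hadj
  have hu := M.under_of_adj hadj.2.1 hadj.1 h1 h2 (hl.trans (hlt c hc))
  exact absurd (hmin c hc C j ρ hu) (not_le.2 hl)

theorem polar_rim {f : ℝ × ℝ → ℝ} (hf : f ∈ T.S2bar) {N c : Cell}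
    (h0 : T.ZeroBelow f N.level) {i σ : Bool} (h : M.Rim N i σ) (hc : c ∈ T.cells)
    (hs : Sub c.toRect N.toRect) (hl : N.level < c.level) (ht : c.sd i σ = N.sd i σ) {D : Rect}
    (hD : D.sd i σ = N.sd i σ) : polar D (expression f c.toRect) = 0 := by
  rcases h with h | ⟨C, hC, hCl⟩
  · exact M.polar_boundary hf hc (ht.trans h) (hD.trans ht.symm)
  · rw [M.polar_under hf (cov_under hC hc hs hl ht) (hD.trans ht.symm), h0 C hC.hB hCl, polar_zero]

/-- A P-cell has the value by hypothesis, a T-cell touches a larger cell where `f` is already zero,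
and any other cell has a side on the boundary. -/
theorem polar_self {f : ℝ × ℝ → ℝ} (hf : T.Null f) {B : Cell} (hB : B ∈ T.cells)
    (h0 : T.ZeroBelow f B.level) : polar B.toRect (expression f B.toRect) = 0 := by
  by_cases hi : T.IsInteriorCell B
  · rcases M.pCell_or_tCell hi with h | h
    · exact hf.pCell B h
    · obtain ⟨C, i, σ, hu⟩ := M.tCell_under h
      rw [M.polar_under hf.mem hu (ρ := σ) rfl, h0 C hu.hB hu.lt, polar_zero]
  · rw [M.isInteriorCell_iff] at hi
    push Not at hi
    obtain ⟨i, σ, h⟩ := hi hB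
    exact M.polar_boundary hf.mem hB h (ρ := σ) rfl

theorem sd_ne {B : Cell} (hB : B ∈ T.cells) (i σ : Bool) : B.sd i σ ≠ M.Ω.sd i (!σ) := by
  intro h
  have h1 := (M.inΩ B (M.sub hB)).not i σ
  have h2 := (M.ndF hB).lt i σ
  rw [h] at h2
  linarith

theorem sd_eq_of_boundary {N c : Cell} (hN : N ∈ M.V) (hs : Sub c.toRect N.toRect) {i σ : Bool}
    (h : c.sd i σ = M.Ω.sd i σ) : N.sd i σ = M.Ω.sd i σ ∧ c.sd i σ = N.sd i σ := by
  have h1 := hs i σ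
  have h2 := M.inΩ N hN i σ
  rw [h] at h1
  have h3 := sg_antisymm h2 h1
  exact ⟨h3, h.trans h3.symm⟩

/-- `N` is the divided cell of the hierarchy opposite to `B`. Either the value over `N` can be
carried along corners of `N` to a side where `f` is zero, or the cells linked to `e` are confined to
`N` and form a T-connection with `B` as a one-neighbour-cell. -/
theorem side_condition_of_under {f : ℝ × ℝ → ℝ} (hf : T.Null f) {B e : Cell} {i σ : Bool}
    (hu : T.Under e B i (!σ)) (h0 : T.ZeroBelow f B.level) :
    ∃ D : Rect, D.Nondeg ∧ D.sd i (!σ) = B.sd i σ ∧ (∀ ρ, D.sd (!i) ρ = B.sd (!i) ρ) ∧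
      polar D (expression f B.toRect) = 0 := by
  obtain ⟨N, hN, hNl, hNs⟩ := M.anc (M.sub hu.hc) hu.lt.le
  have hel : N.level < e.level := hNl ▸ hu.lt
  obtain ⟨hN1, hN2⟩ := M.under_anc hu hN hNl hNs
  rw [Bool.not_not] at hN2
  obtain ⟨heN, hcov⟩ := M.under_cov hu hN hNs hNl.ge
  rw [← hNl] at h0
  -- A rim next to the side of `B`: the mesh cell in the common corner of `N` touches both.
  by_cases hZ : ∃ τ, M.Rim N (!i) τ
  · obtain ⟨τ, hτ⟩ := hZ
    refine ⟨N.toRect, M.nd N hN, hN2, hN1, ?_⟩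
    obtain ⟨c, hc, hs, hl, h1, h2⟩ := M.corner_leaf hN hu.hc hNs hel i (!σ) τ
    rw [← M.polar_under hf.mem (cov_under hcov hc hs hl h1) h1.symm]
    exact M.polar_rim hf.mem h0 hτ hc hs hl h2 rfl
  -- A rim opposite to `B`: a cover `C` of a third side of `N` connects the two, through two
  -- corners.
  by_cases hZ' : M.Rim N i σ ∧ ∃ C τ, T.Cov N C (!i) τ
  · obtain ⟨hσ, C, τ, hC⟩ := hZ'
    refine ⟨N.toRect, M.nd N hN, hN2, hN1, ?_⟩
    rw [M.polar_cov_cov hf.mem hN hu.hc hNs hel hcov hC rfl rfl]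
    obtain ⟨c, hc, hs, hl, h1, h2⟩ := M.corner_leaf hN hu.hc hNs hel i σ τ
    rw [← M.polar_under hf.mem (cov_under hC hc hs hl h2) h2.symm]
    exact M.polar_rim hf.mem h0 hσ hc hs hl h1 rfl
  push Not at hZ hZ'
  have hrim : ∀ c : Cell, (M.Rim N i σ → InHalf N.toRect i (!σ) c.toRect) → ∀ j ρ,
      c.sd j ρ = N.sd j ρ → M.Rim N j ρ → j = i ∧ ρ = !σ := by
    intro c hc j ρ h1 h2
    rcases Bool.eq_or_eq_not j i with rfl | rfl
    · rcases Bool.eq_or_eq_not ρ σ with rfl | rfl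
      · exact (InHalf.not_side (M.nd N hN) (hc h2) h1).elim
      · exact ⟨rfl, rfl⟩
    · exact (hZ ρ h2).elim
  have hlev : ∀ c : Cell, Sub c.toRect N.toRect → (M.Rim N i σ → InHalf N.toRect i (!σ) c.toRect) →
      ∀ C j ρ, T.Under c C j ρ → N.level ≤ C.level := by
    intro c hs hh C j ρ h
    by_contra! hl
    obtain ⟨h1, h2⟩ := M.under_cov h hN hs hl.le
    obtain ⟨rfl, rfl⟩ := hrim c hh j ρ h1 (Or.inr ⟨C, h2, hl⟩)
    have := M.cov_unique hN hcov h2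
    subst this
    omega
  -- Now no link leaves `N`. If the side opposite to `B` is a rim, no third side is covered, so no
  -- link crosses the middle line and the class never reaches that rim.
  have hinv : ∀ c ∈ T.linkClass e, Sub c.toRect N.toRect ∧
      (M.Rim N i σ → InHalf N.toRect i (!σ) c.toRect) := by
    refine linkClass_induction ⟨hNs, fun _ => M.inHalf_of_side hN (M.sub hu.hc) hNs hel heN⟩ ?_
    rintro c d ⟨hs, hh⟩ hl
    by_cases hne : c = d
    · exact hne ▸ ⟨hs, hh⟩
    obtain ⟨v, j, ρ, τ, C, hp⟩ := M.link_tpat hl hne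
    have hcu := M.tpat_under hp
    have hCl := hlev c hs hh C j ρ hcu
    refine ⟨M.tpat_sub_of_le hp hN hCl hs, fun hσ => M.inHalf_step hp hN hCl hs ?_ (hh hσ)⟩
    rintro ⟨h1, rfl⟩
    exact hZ' hσ C ρ (M.under_cov hcu hN hs h1.le).2
  have hKF : T.linkClass e ⊆ T.cells := fun c hc => linkClass_sub hu.hc hc
  have hsd : ∀ j ρ, (∃ c ∈ T.linkClass e, c.sd j ρ = N.sd j ρ) →
      (tRect (T.linkClass e)).sd j ρ = N.sd j ρ := fun j ρ h =>
    tRect_sd (fun c hc => M.ndF (hKF hc)) h fun c hc => (hinv c hc).1 j ρ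
  -- The T-rectangle-domain is a valid `D`: `e` reaches the side of `B`, and by `full_side` the
  -- class spans its whole length.
  refine ⟨tRect (T.linkClass e), M.tRect_nondeg hKF ⟨e, .refl⟩,
    (hsd i (!σ) ⟨e, .refl, heN⟩).trans hN2, fun ρ => ?_, M.trapped hf hu (fun c hc => ?_) ?_⟩
  · rw [← hN1]
    refine hsd _ _ ?_
    rw [hN1]
    exact M.full_side hKF (fun c hc d hd => Relation.ReflTransGen.tail hc hd) .refl hu ρ
  · refine M.isInteriorCell_iff.2 ⟨hKF hc, fun j ρ h => ?_⟩
    obtain ⟨h1, h2⟩ := M.sd_eq_of_boundary hN (hinv c hc).1 h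
    obtain ⟨rfl, rfl⟩ := hrim c (hinv c hc).2 j ρ h2 (Or.inl h1)
    exact M.sd_ne hu.hB j σ (hN2.symm.trans h1)
  · intro c hc C j ρ h
    rw [← hNl]
    exact hlev c (hinv c hc).1 (hinv c hc).2 C j ρ h

/-- The cases are the level of a cell `e` across the side. On a lower level `f` is zero on it; on
the same level it is the mirror position of `B`, and `polar_self` applies to it; on a higher level
it touches the larger cell `B`. -/
theorem side_condition {f : ℝ × ℝ → ℝ} (hf : T.Null f) {B : Cell} (hB : B ∈ T.cells)
    (h0 : T.ZeroBelow f B.level) (i σ : Bool) :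
    ∃ D : Rect, D.Nondeg ∧ D.sd i (!σ) = B.sd i σ ∧ (∀ ρ, D.sd (!i) ρ = B.sd (!i) ρ) ∧
      polar D (expression f B.toRect) = 0 := by
  by_cases hbd : B.sd i σ = M.Ω.sd i σ
  · obtain ⟨D, h1, h2, h3⟩ := exists_side_rect (M.ndF hB) i σ
    exact ⟨D, h1, h2, h3, M.polar_boundary hf.mem hB hbd h2⟩
  have hq := (M.ndF hB).inQ_corner i (!σ) true
  rw [Bool.not_not, Bool.not_true] at hq
  have hΩ : In1 M.Ω i σ (B.sd i σ) := by
    have h1 := (M.inΩ B (M.sub hB)).not i σ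
    have h2 := (M.ndF hB).lt i σ
    exact ⟨by linarith, lt_of_le_of_ne (M.inΩ B (M.sub hB) i σ) fun h => hbd (sg_cancel h)⟩
  obtain ⟨e, he, heq⟩ := M.ex (z := pt i (B.sd i σ) (B.sd (!i) false)) (i := i) (σ := σ) (τ := true)
    ⟨by rwa [co_pt], ((M.inΩ B (M.sub hB)).inQ hq).2⟩
  have hpol : ∀ D : Rect, D.sd i (!σ) = B.sd i σ →
      polar D (expression f B.toRect) = polar D (expression f e.toRect) := fun D hD =>
    (polar_across hf.mem he hB heq hq (by rw [hD, co_pt])).symm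
  rcases lt_trichotomy e.level B.level with hl | hl | hl
  · obtain ⟨D, h1, h2, h3⟩ := exists_side_rect (M.ndF hB) i σ
    exact ⟨D, h1, h2, h3, by rw [hpol D h2, h0 e he hl, polar_zero]⟩
  · have hne : e ≠ B := by
      rintro rfl
      have := heq.1.2
      simp at this
    obtain ⟨h1, h2, -, -⟩ := M.across hB he hq (by rwa [Bool.not_not]) hne (M.sub he) hl (Sub.refl _)
    rw [co_pt] at h2
    exact ⟨e.toRect, M.ndF he, h2, h1, by rw [hpol _ h2, M.polar_self hf he (hl ▸ h0)]⟩
  · exact M.side_condition_of_under hf (M.under_of_adj hB he hq (by rwa [Bool.not_not]) hl) h0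

end Frame

/-! ### Injectivity: the conditions beyond the corners, and the induction -/

namespace Frame

variable {T : HMesh} (M : Frame T.cells)

include M

/-- The cell `e` lies in a corner, in the directions opposite to `s`, of all its ancestors of level
at least `k`. -/
theorem corner_condition_of_under {f : ℝ × ℝ → ℝ} (hf : T.Null f) {e : Cell} {s : Bool → Bool}
    {k : ℕ} (h0 : T.ZeroBelow f k) (hs : ∀ A ∈ M.V, k ≤ A.level → Sub e.toRect A.toRect →
      ∀ j, A.sd j (!s j) = e.sd j (!s j)) (hne : ∀ j, e.sd j (!s j) ≠ M.Ω.sd j (!s j))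
    {B : Cell} {i σ : Bool} (hu : T.Under e B i σ) :
    ∃ D : Rect, D.Nondeg ∧ (∀ j, D.sd j (!s j) = e.sd j (!s j)) ∧
      polar D (expression f e.toRect) = 0 := by
  classical
  -- `B` is chosen of lowest level among the larger cells that `e` touches; the class of `e` will
  -- turn out to have `B` as a one-neighbour-cell.
  have hex : ∃ n, ∃ B i σ, T.Under e B i σ ∧ B.level = n := ⟨_, B, i, σ, hu, rfl⟩
  obtain ⟨B, i, σ, hu, hl⟩ := Nat.find_spec hex
  have hmin : ∀ C j ρ, T.Under e C j ρ → B.level ≤ C.level := fun C j ρ h =>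
    hl ▸ Nat.find_min' hex ⟨C, j, ρ, h, rfl⟩
  have he := M.sub hu.hc
  rcases lt_or_ge B.level k with hlk | hlk
  · exact ⟨e.toRect, M.ndF hu.hc, fun _ => rfl,
      by rw [M.polar_under hf.mem hu (ρ := σ) rfl, h0 B hu.hB hlk, polar_zero]⟩
  -- an ancestor has no other side in common with its descendant
  have far : ∀ A ∈ M.V, k ≤ A.level → ∀ c ∈ M.V, A.level < c.level → Sub e.toRect c.toRect →
      Sub c.toRect A.toRect → ∀ j, c.sd j (s j) ≠ A.sd j (s j) := by
    intro A hA hAk c hc hAc hec hcA j h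
    have h1 := hs A hA hAk (hec.trans hcA) j
    have h2 := hs c hc (hAk.trans hAc.le) hec j
    obtain ⟨ρ, hρ⟩ := M.half_lt hA hc hcA hAc j
    rcases Bool.eq_or_eq_not ρ (s j) with rfl | rfl
    · rw [h] at hρ; exact lt_irrefl _ hρ
    · rw [h1, h2] at hρ; exact lt_irrefl _ hρ
  obtain ⟨A, hA, hAl, hAs⟩ := M.anc he hu.lt.le
  obtain ⟨hA1, hA2⟩ := M.under_anc hu hA hAl hAs
  have hσ : σ = !s i := by
    rcases Bool.eq_or_eq_not σ (s i) with rfl | h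
    · exact (far A hA (hAl ▸ hlk) e he (hAl ▸ hu.lt) (Sub.refl _) hAs i (hu.line.trans hA2.symm)).elim
    · exact h
  subst hσ
  -- On level `k` itself `f` vanishes on everything below `B`, so the side condition for `B` gives a
  -- rectangle with the required corner.
  rcases hlk.eq_or_lt with hlk | hlk
  · subst hlk
    obtain ⟨D, h1, h2, h3, h4⟩ := M.side_condition hf hu.hB h0 i (s i)
    have h5 : D.sd i (!s i) = e.sd i (!s i) := by rw [h2, hu.line, Bool.not_not]
    refine ⟨D, h1, (bool_forall i).2 ⟨h5, ?_⟩, by rw [M.polar_under hf.mem hu h5, h4]⟩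
    rw [h3, ← hA1, hs A hA hAl.ge hAs]
  obtain ⟨P, hP, hPl, hAP⟩ := M.parent A hA (B.level - 1) (by omega)
  have hAPs := children_sub hAP (M.nd P hP)
  have farP : ∀ j, A.sd j (s j) ≠ P.sd j (s j) :=
    far P hP (by omega) A hA (by omega) hAs hAPs
  -- A larger cell `C` below the level of `A` would cover a side of `A`. On a side away from the
  -- corner it would force `A` and its parent `P` to share that side, against `farP`; on a side at
  -- the corner `e` would touch it too, against minimality of `B`.
  have hlev : ∀ c : Cell, Sub c.toRect A.toRect → ∀ C j ρ, T.Under c C j ρ → A.level ≤ C.level := by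
    intro c hcA C j ρ h
    by_contra! hC
    obtain ⟨h1, h2⟩ := M.under_cov h hA hcA hC.le
    rcases Bool.eq_or_eq_not ρ (s j) with rfl | rfl
    · exact farP j (h1.symm.trans (M.under_cov h hP (hcA.trans hAPs) (by omega)).1)
    · have := hmin C j _ (cov_under h2 hu.hc hAs (hAl ▸ hu.lt)
        (hs A hA (by omega) hAs j).symm)
      omega
  have hsub : ∀ c ∈ T.linkClass e, Sub c.toRect A.toRect := by
    refine linkClass_induction hAs fun c d hc hl => ?_
    by_cases hne : c = d
    · exact hne ▸ hc
    obtain ⟨v, j, ρ, τ, C, hp⟩ := M.link_tpat hl hne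
    exact M.tpat_sub_of_le hp hA (hlev c hc C j ρ (M.tpat_under hp)) hc
  have hKF : T.linkClass e ⊆ T.cells := fun c hc => linkClass_sub hu.hc hc
  have hsd : ∀ j, (tRect (T.linkClass e)).sd j (!s j) = e.sd j (!s j) := by
    intro j
    refine tRect_sd (fun c hc => M.ndF (hKF hc)) ⟨e, .refl, rfl⟩ fun c hc => ?_
    rw [← hs A hA (by omega) hAs]
    exact hsub c hc j (!s j)
  refine ⟨_, M.tRect_nondeg hKF ⟨e, .refl⟩, hsd, ?_⟩
  rw [M.polar_under hf.mem hu (hsd i)]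
  refine M.trapped hf hu (fun c hc => ?_) fun c hc C j ρ h => hAl ▸ hlev c (hsub c hc) C j ρ h
  refine M.isInteriorCell_iff.2 ⟨hKF hc, fun j ρ h => ?_⟩
  obtain ⟨h1, -⟩ := M.sd_eq_of_boundary hA (hsub c hc) h
  rcases Bool.eq_or_eq_not ρ (s j) with rfl | rfl
  · have := (M.sd_eq_of_boundary hP hAPs h1).2
    exact farP j this
  · rw [hs A hA (by omega) hAs] at h1
    exact hne j h1

/-- Every cell at the corner `w` of `B` has the same value over any rectangle beyond the corner. If
one of them is of lower level, `f` is zero on it. Otherwise use the cell `e` diagonally opposite: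
itself as rectangle if it is a P-cell or at the boundary, and `corner_condition_of_under` if it is a
T-cell. -/
theorem corner_condition {f : ℝ × ℝ → ℝ} (hf : T.Null f) {B : Cell} (hB : B ∈ T.cells)
    (h0 : T.ZeroBelow f B.level) (s : Bool → Bool) :
    ∃ D : Rect, D.Nondeg ∧ (∀ j, D.sd j (!s j) = B.sd j (s j)) ∧
      polar D (expression f B.toRect) = 0 := by
  obtain ⟨D₀, hD₀, hD₀'⟩ := exists_corner_rect B.toRect s
  by_cases hbd : ∃ j, B.sd j (s j) = M.Ω.sd j (s j)
  · obtain ⟨j, hj⟩ := hbd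
    exact ⟨D₀, hD₀, hD₀', M.polar_boundary hf.mem hB hj (hD₀' j)⟩
  push Not at hbd
  obtain ⟨w, hw⟩ : ∃ w, ∀ j, co j w = B.sd j (s j) :=
    ⟨(B.sd false (s false), B.sd true (s true)), by simp [co]⟩
  have hBw : ∀ j, In1 B.toRect j (!s j) (co j w) := fun j => by
    rw [hw]; simpa using (M.ndF hB).in1_sd j (!s j)
  have hnB : ∀ j, ¬ In1 B.toRect j (s j) (co j w) := fun j h => by
    have := h.2
    rw [hw] at this
    exact lt_irrefl _ this
  have hΩ : ∀ j, In1 M.Ω j (s j) (co j w) := fun j => by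
    have h := ((M.inΩ B (M.sub hB)).in1 (hBw j)).flip
    rw [Bool.not_not, hw] at h
    rw [hw]
    exact h (hbd j).symm
  obtain ⟨e, he, heq⟩ := M.ex (z := w) (i := false) ⟨hΩ false, hΩ true⟩
  have heq : ∀ j, In1 e.toRect j (s j) (co j w) := Bool.forall_bool.2 heq
  have hside : ∀ j, ∃ d ∈ T.cells, InQ d.toRect w j (s j) (!s (!j)) := fun j =>
    M.ex ⟨hΩ j, (M.inΩ B (M.sub hB)).in1 (hBw (!j))⟩
  choose d hd hdq using hside
  have hpd : ∀ D : Rect, (∀ j, D.sd j (!s j) = B.sd j (s j)) → ∀ j,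
      polar D (expression f B.toRect) = polar D (expression f (d j).toRect) := fun D hD j =>
    (polar_across hf.mem (hd j) hB (hdq j) ⟨hBw j, hBw (!j)⟩ (ρ := !s j) (by rw [hD, hw])).symm
  have hpe : ∀ D : Rect, (∀ j, D.sd j (!s j) = B.sd j (s j)) →
      polar D (expression f B.toRect) = polar D (expression f e.toRect) := fun D hD => by
    rw [hpd D hD true]
    exact (polar_across hf.mem he (hd true) (i := false) ⟨heq false, heq true⟩ (hdq true).swap
      (ρ := !s false) (by rw [hD, hw])).symm
  by_cases hlow : ∃ c ∈ T.cells, c.level < B.level ∧ ∀ D : Rect,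
      (∀ j, D.sd j (!s j) = B.sd j (s j)) →
        polar D (expression f B.toRect) = polar D (expression f c.toRect)
  · obtain ⟨c, hc, hl, h⟩ := hlow
    exact ⟨D₀, hD₀, hD₀', by rw [h _ hD₀', h0 c hc hl, polar_zero]⟩
  push Not at hlow
  have hld : ∀ j, B.level ≤ (d j).level := fun j => by
    by_contra! h
    obtain ⟨D, h1, h2⟩ := hlow _ (hd j) h
    exact h2 (hpd D h1 j)
  have hle : B.level ≤ e.level := by
    by_contra! h
    obtain ⟨D, h1, h2⟩ := hlow e he h
    exact h2 (hpe D h1)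
  -- If `A` extended past `w` along the axis `j`, its ancestor on the level of `B` would contain the
  -- cell `d (!j)` next to `B`. By `across` it would then have the extent of `B` along `j`, which
  -- ends at `w`.
  have hcor : ∀ A ∈ M.V, B.level ≤ A.level → Sub e.toRect A.toRect →
      ∀ j, A.sd j (!s j) = co j w := by
    intro A hA hAl hAs j
    by_contra hne
    obtain ⟨A', hA', hl', hs'⟩ := M.anc hA hAl
    have h1 := hs'.in1 ((hAs.in1 (heq j)).flip hne)
    have h2 : In1 A'.toRect (!j) (s (!j)) (co (!j) w) := hs'.in1 (hAs.in1 (heq (!j)))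
    have h3 := (hdq (!j)).swap
    rw [Bool.not_not] at h3
    have h4 := M.nested hA' (M.sub (hd (!j))) (hl'.trans_le (hld _)) ⟨h1, h2⟩ h3
    have hne' : d (!j) ≠ B := fun h => hnB (!j) (h ▸ h3.2)
    have h5 := (M.across hB (hd (!j)) (i := !j) (σ := !s (!j)) (τ := !s j) (z := w)
      ⟨hBw (!j), by rw [Bool.not_not]; exact hBw j⟩ (by rw [Bool.not_not]; exact h3.swap)
      hne' hA' hl' h4).1 (s j)
    rw [Bool.not_not] at h5
    have h6 := (hs'.in1 (hAs.in1 (heq j))).2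
    rw [h5, hw] at h6
    exact lt_irrefl _ h6
  have hce := hcor e (M.sub he) hle (Sub.refl _)
  have hfin : ∀ D : Rect, (∀ j, D.sd j (!s j) = e.sd j (!s j)) →
      ∀ j, D.sd j (!s j) = B.sd j (s j) := fun D hD j => by rw [hD, hce, hw]
  by_cases hT : T.IsTCell e
  · obtain ⟨C, i, σ, hu⟩ := M.tCell_under hT
    obtain ⟨D, h1, h2, h3⟩ := M.corner_condition_of_under hf h0
      (fun A hA hAl hAs j => (hcor A hA hAl hAs j).trans (hce j).symm)
      (fun j h => M.sd_ne hB j (s j) (by rw [← hw, ← hce, h])) hu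
    exact ⟨D, h1, hfin D h2, by rw [hpe D (hfin D h2), h3]⟩
  · refine ⟨e.toRect, M.ndF he, hfin _ fun _ => rfl, ?_⟩
    rw [hpe _ (hfin _ fun _ => rfl)]
    by_cases hi : T.IsInteriorCell e
    · exact hf.pCell e ((M.pCell_or_tCell hi).resolve_right hT)
    · rw [M.isInteriorCell_iff] at hi
      push Not at hi
      obtain ⟨i, σ, h⟩ := hi he
      exact M.polar_boundary hf.mem he h (ρ := σ) rfl

theorem expression_eq_zero {f : ℝ × ℝ → ℝ} (hf : T.Null f) {c : Cell} (hc : c ∈ T.cells) :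
    expression f c.toRect = 0 := by
  induction hk : c.level using Nat.strong_induction_on generalizing c with
  | _ k ih =>
    subst hk
    have h0 : T.ZeroBelow f c.level := fun d hd hl => ih _ hl hd rfl
    refine biPoly_zero_of_polar (HMesh.expression_spec hf.mem hc).1 (M.ndF hc)
      (M.polar_self hf hc h0) (M.side_condition hf hc h0) fun σ τ => ?_
    obtain ⟨D, h1, h2, h3⟩ := M.corner_condition hf hc h0 fun j => cond j τ σ
    exact ⟨D, h1, h2 false, h2 true, h3⟩

theorem eq_zero_of_null {f : ℝ × ℝ → ℝ} (hf : T.Null f) : f = 0 := by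
  funext z
  by_cases hz : z ∈ T.region
  · simp only [HMesh.region, Set.mem_iUnion, exists_prop] at hz
    obtain ⟨c, hc, hz⟩ := hz
    rw [(HMesh.expression_spec hf.mem hc).2 hz, M.expression_eq_zero hf hc]
  · exact hf.mem.2.2 z hz

end Frame

/-! ### The linear map and its uniqueness -/

namespace Frame

variable {T : HMesh} (M : Frame T.cells)

include M

theorem phi_pCell {f : ℝ × ℝ → ℝ} (hf : f ∈ T.S2bar) {c : Cell} (hc : T.IsPCell c) :
    phi (expression f c.toRect) c.toRect = polar c.toRect (expression f c.toRect) :=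
  phi_eq_polar (HMesh.expression_spec hf hc.1.1).1 (M.ndF hc.1.1)

omit M in
theorem oneNeighbour_mem {K : Set Cell} {C : Cell} (hC : T.IsOneNeighbour K C) : C ∈ T.cells := by
  obtain ⟨⟨-, c, -, h⟩, -⟩ := hC
  exact h.2.1

theorem phi_tConnection {f : ℝ × ℝ → ℝ} (hf : f ∈ T.S2bar) {K : Set Cell} (hK : T.IsTConnection K)
    {C : Cell} (hC : T.IsOneNeighbour K C) :
    phi (expression f C.toRect) (tRect K) = polar (tRect K) (expression f C.toRect) := by
  refine phi_eq_polar (HMesh.expression_spec hf (oneNeighbour_mem hC)).1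
    (M.tRect_nondeg (tConnection_sub hK) ?_)
  obtain ⟨c, -, rfl⟩ := hK
  exact ⟨c, .refl⟩

/-- The value on a g-cell is given by one cell and one rectangle. -/
theorem exists_datum {F : Set (ℝ × ℝ)} (hF : T.IsGCell F) : ∃ C ∈ T.cells, ∃ D : Rect,
    ∀ f ∈ T.S2bar,
      (∀ c, T.IsPGCell c F →
        phi (expression f c.toRect) c.toRect = polar D (expression f C.toRect)) ∧
      ∀ K, T.IsTGCell K F → ∀ C', T.IsOneNeighbour K C' →
        phi (expression f C'.toRect) (tRect K) = polar D (expression f C.toRect) := by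
  rcases M.gCell_cases hF with ⟨c, hc⟩ | ⟨K, hK⟩
  · refine ⟨c, hc.1.1.1, c.toRect, fun f hf => ⟨fun c' hc' => ?_,
      fun K hK => (M.not_pGCell_of_tGCell hc hK).elim⟩⟩
    rw [M.pGCell_unique hc' hc, M.phi_pCell hf hc.1]
  · obtain ⟨C, hC⟩ := M.exists_oneNeighbour hK.1
    refine ⟨C, oneNeighbour_mem hC, tRect K, fun f hf =>
      ⟨fun c hc => (M.not_pGCell_of_tGCell hc hK).elim, fun K' hK' C' hC' => ?_⟩⟩
    rw [M.tGCell_unique hK' hK] at hC' ⊢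
    rw [M.phi_tConnection hf hK.1 hC', M.oneNeighbour_polar hK.1 hf hC' hC]

omit M in
/-- Linear functionals on the splines, one for each g-cell, define a linear map to the piecewise
constant functions. -/
theorem exists_linearMap (L : Set (ℝ × ℝ) → T.S2bar →ₗ[ℝ] ℝ) :
    ∃ Φ : T.S2bar →ₗ[ℝ] T.S0bar, ∀ f F, T.IsGCell F → ∀ z ∈ F, (Φ f : ℝ × ℝ → ℝ) z = L F f := by
  classical
  -- Different g-cells are disjoint, so the chosen g-cell is the only one containing `z`; off the
  -- g-cells the value is zero, as `S0bar` demands.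
  let φ (f : T.S2bar) (z : ℝ × ℝ) : ℝ := if h : ∃ F, T.IsGCell F ∧ z ∈ F then L h.choose f else 0
  have hφ : ∀ f F, T.IsGCell F → ∀ z ∈ F, φ f z = L F f := by
    intro f F hF z hz
    have h : ∃ F, T.IsGCell F ∧ z ∈ F := ⟨F, hF, hz⟩
    rw [show φ f z = L h.choose f from dif_pos h,
      gCell_eq h.choose_spec.1 hF h.choose_spec.2 hz]
  refine ⟨{ toFun := fun f => ⟨φ f, fun F hF => ⟨L F f, hφ f F hF⟩, fun z hz => dif_neg ?_⟩
            map_add' := fun f g => ?_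
            map_smul' := fun r f => ?_ }, hφ⟩
  · rintro ⟨F, hF, h⟩
    exact hz F hF h
  · refine Subtype.ext (funext fun z => ?_)
    change φ (f + g) z = φ f z + φ g z
    simp only [φ]
    split_ifs <;> simp
  · refine Subtype.ext (funext fun z => ?_)
    change φ (r • f) z = r * φ f z
    simp only [φ]
    split_ifs <;> simp

/-- The functional `f ↦ φ(f|_C : D)`. -/
theorem exists_functional {C : Cell} (hC : C ∈ T.cells) (D : Rect) :
    ∃ L : T.S2bar →ₗ[ℝ] ℝ, ∀ f : T.S2bar, L f = polar D (expression f C.toRect) :=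
  ⟨{ toFun := fun f => polar D (expression f C.toRect)
     map_add' := fun f g => by
      rw [Submodule.coe_add, expression_add M f.2 g.2 hC, polar_add]
     map_smul' := fun r f => by
      rw [Submodule.coe_smul, expression_smul M f.2 r hC, polar_smul]; rfl }, fun _ => rfl⟩

theorem exists_mapsTo : ∃ Φ : T.S2bar →ₗ[ℝ] T.S0bar, ∀ f : T.S2bar, T.MapsTo f (Φ f) := by
  have : ∀ F, ∃ L : T.S2bar →ₗ[ℝ] ℝ, T.IsGCell F → ∀ f : T.S2bar,
      (∀ c, T.IsPGCell c F → phi (expression f c.toRect) c.toRect = L f) ∧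
      ∀ K, T.IsTGCell K F → ∀ C, T.IsOneNeighbour K C →
        phi (expression f C.toRect) (tRect K) = L f := by
    intro F
    by_cases hF : T.IsGCell F
    · obtain ⟨C, hC, D, h⟩ := M.exists_datum hF
      obtain ⟨L, hL⟩ := M.exists_functional hC D
      exact ⟨L, fun _ f => hL f ▸ h f f.2⟩
    · exact ⟨0, fun h => (hF h).elim⟩
  choose L hL using this
  obtain ⟨Φ, hΦ⟩ := exists_linearMap L
  exact ⟨Φ, fun f => ⟨fun c F h z hz => (hΦ f F h.2.1 z hz).trans ((hL F h.2.1 f).1 c h).symm,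
    fun K F h C hC z hz => (hΦ f F h.2.1 z hz).trans ((hL F h.2.1 f).2 K h C hC).symm⟩⟩

/-- Every g-cell comes from a P-cell or a T-connection, and a T-connection always has a
one-neighbour-cell, so the rule prescribes a value on each g-cell. -/
theorem mapsTo_unique {f : ℝ × ℝ → ℝ} {g g' : T.S0bar} (hg : T.MapsTo f g) (hg' : T.MapsTo f g') :
    g = g' := by
  refine Subtype.ext (funext fun z => ?_)
  by_cases hz : ∃ F, T.IsGCell F ∧ z ∈ F
  · obtain ⟨F, hF, hz⟩ := hz
    rcases M.gCell_cases hF with ⟨c, hc⟩ | ⟨K, hK⟩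
    · rw [hg.1 c F hc z hz, hg'.1 c F hc z hz]
    · obtain ⟨C, hC⟩ := M.exists_oneNeighbour hK.1
      rw [hg.2 K F hK C hC z hz, hg'.2 K F hK C hC z hz]
  · push Not at hz
    rw [g.2.2 z hz, g'.2.2 z hz]

theorem null_of_mapsTo {f : ℝ × ℝ → ℝ} (hf : f ∈ T.S2bar) (h : T.MapsTo f 0) : T.Null f := by
  refine ⟨hf, fun c hc => ?_, fun c hc hK C hC => ?_⟩
  · obtain ⟨F, hF, -⟩ := M.existsUnique_pGCell hc
    obtain ⟨z, -, hz⟩ := M.pGCell_inner hF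
    rw [← M.phi_pCell hf hc, ← h.1 c F hF z hz]
    rfl
  · obtain ⟨F, hF, hcl, hin⟩ := M.exists_gCell hc.1.1 hK
    obtain ⟨z, hz⟩ := inner_nonempty (M.ndF hc.1.1)
    have hT := isTConnection_linkClass hc hK
    rw [← M.phi_tConnection hf hT hC, ← h.2 _ F ⟨hT, hF, hcl⟩ C hC z (hin hz)]
    rfl

end Frame

end TMesh

end

theorem mainTheorem5 (T : TMesh.HMesh) :
    -- every T-connection has a one-neighbour-cell, and all of them give the same value
    (∀ K, T.IsTConnection K →
      (∃ C, T.IsOneNeighbour K C) ∧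
      ∀ f ∈ T.S2bar, ∀ C C', T.IsOneNeighbour K C → T.IsOneNeighbour K C' →
        TMesh.phi (TMesh.expression f C.toRect) (TMesh.tRect K) =
          TMesh.phi (TMesh.expression f C'.toRect) (TMesh.tRect K)) ∧
    -- every P-cell has its g-cell; every g-cell belongs to exactly one P-cell or T-connection
    (∀ c, T.IsPCell c → ∃! F, T.IsPGCell c F) ∧
    (∀ F, T.IsGCell F → Xor (∃! c, T.IsPGCell c F) (∃! K, T.IsTGCell K F)) ∧
    -- the rule defines a map, which is linear and injective
    ∃ Φ : T.S2bar →ₗ[ℝ] T.S0bar,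
      (∀ f : T.S2bar, T.MapsTo f (Φ f)) ∧
      (∀ (f : T.S2bar) (g : T.S0bar), T.MapsTo f g → g = Φ f) ∧
      Function.Injective Φ := by
  obtain ⟨M⟩ := TMesh.exists_frame T.hier
  refine ⟨fun K hK => ⟨M.exists_oneNeighbour hK, fun f hf C C' hC hC' => ?_⟩,
    fun c hc => M.existsUnique_pGCell hc, fun F hF => M.gCell_xor hF, ?_⟩
  · rw [M.phi_tConnection hf hK hC, M.phi_tConnection hf hK hC', M.oneNeighbour_polar hK hf hC hC']
  · obtain ⟨Φ, hΦ⟩ := M.exists_mapsTo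
    refine ⟨Φ, hΦ, fun f g hg => M.mapsTo_unique hg (hΦ f), ?_⟩
    rw [← LinearMap.ker_eq_bot, LinearMap.ker_eq_bot']
    intro f hf
    have h := hΦ f
    rw [hf] at h
    exact Subtype.ext (M.eq_zero_of_null (M.null_of_mapsTo f.2 h))
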